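/- Let $n\ge 4$ and let $\mathbb Z[\delta]$ be the polynomial ring in one indeterminate. *Diagrams.* The standard $n$-box is a rectangle with nodes $1,\dots,n$ on its north face and $1',\dots,n'$ on its south face, numbered from left to right. A *decorated pseudo $n$-diagram* is, up to isotopy, a finite set of disjoint curves in the box, such that every node is the end of exactly one curve and all other curves are loops; each curve carries a finite number of decorations (all alike), and there are no decorations at all if no edge joins two nodes of the north face. It is *L-decorated* if all decorations can be moved simultaneously to the left wall of the box without crossing any edge. Let $\mathcal P_n^L$ be the free $\mathbb Z[\delta]$-module on the L-decorated pseudo $n$-diagrams, an associative unital algebra under concatenation of diagrams (in $d'd$, $d'$ is placed on top of $d$ and decorations on curves that are joined are put together). Let $\widehat{\mathcal P}_n^L$ be the quotient of $\mathcal P_n^L$ by the relations: (1) an undecorated loop equals $\delta$; (2) two adjacent decorations on the same curve cancel; (3) a curve loses a decoration in the presence of another curve that is a loop with one decoration. *Algebras.* For $1\le i\le n-1$ let $d_i$ be the undecorated diagram with edges $\{i,i+1\}$, $\{i',(i+1)'\}$ and $\{j,j'\}$ for $j\ne i,i+1$, and let $d_{\overline 1}$ be obtained from $d_1$ by putting one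 decoration on each of the edges $\{1,2\}$ and $\{1',2'\}$. Let $\mathbb{D}TL(D_n)$ be the unital $\mathbb Z[\delta]$-subalgebra of $\widehat{\mathcal P}_n^L$ generated by $d_{\overline 1},d_1,\dots,d_{n-1}$, and let $LFD(D_n)$ be its quotient by the additional relation that a loop with one decoration equals $0$. An L-decorated pseudo $n$-diagram is *$D$-admissible of type II* if none of the relations (1)–(3) can be applied to it, it has no loops, and its total number of decorations is even. **Proposition.** Every $D$-admissible diagram of type II represents an element of $\mathbb{D}TL(D_n)$. The images of these diagrams in $LFD(D_n)$, as $d$ runs over the $D$-admissible diagrams of type II, are pairwise distinct and form a basis of $LFD(D_n)$ as a $\mathbb Z[\delta]$-module. -/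

import Mathlib

open Polynomial

namespace DecTL

/-!
# Decorated diagrams

A decorated pseudo-diagram is recorded by its curves: for each curve the multiset of the nodes at
which it ends (two nodes for an edge, none for a loop) and the number of decorations it carries.
Decorations are all alike and adjacent blocks on a curve may be conjoined, so only their number
matters. Up to isotopy the edges of a plane diagram are determined by the nodes they join. The
place of a loop is not recorded: loops without decoration have the same value wherever they lie,
and loops with a decoration all lie in the region next to the left wall.
-/

/-- A curve: the nodes at which it ends, and the number of its decorations. -/
abbrev Strand (V : Type*) := Multiset V × ℕ

/-- All ends of the curves in `M`. -/
def ends {V : Type*} (M : Multiset (Strand V)) : Multiset V := (M.map Prod.fst).sum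

/-- Rename the nodes. -/
def relabel {V W : Type*} (f : V → W) (M : Multiset (Strand V)) : Multiset (Strand W) :=
  M.map (fun e => (e.1.map f, e.2))

/-- Join the curves that meet at the node `v` into a single curve, which carries the decorations of
all of them; the node `v` disappears. If a single curve has both its ends at `v`, it is closed
to a loop. -/
def fuse {V : Type*} [DecidableEq V] (v : V) (M : Multiset (Strand V)) : Multiset (Strand V) :=
  ((M.filter (fun e => v ∈ e.1)).sum.1.filter (fun x => x ≠ v),
    (M.filter (fun e => v ∈ e.1)).sum.2) ::ₘ M.filter (fun e => v ∉ e.1)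

/-- Join curves at each of the nodes in the list `l`. -/
def fuseList {V : Type*} [DecidableEq V] (l : List V) (M : Multiset (Strand V)) :
    Multiset (Strand V) :=
  l.foldr fuse M

/-- A curve is an edge, with two ends, or a loop, without ends. -/
def IsCurve {V : Type*} (e : Strand V) : Prop := Multiset.card e.1 = 0 ∨ Multiset.card e.1 = 2

/-- The nodes of the standard `k`-box: `Sum.inl i` lies on the north face and `Sum.inr i` on the
south face; `i` runs from left to right, starting with `0`. -/
abbrev Node (k : ℕ) := Fin k ⊕ Fin k

/-- Put a `k`-box between the levels `s` (north face) and `t` (south face). -/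
def place {k : ℕ} {Λ : Type*} (s t : Λ) : Node k → Λ × Fin k :=
  Sum.elim (fun i => (s, i)) (fun i => (t, i))

/-- The nodes at level `m`. -/
def level (k : ℕ) {Λ : Type*} (m : Λ) : List (Λ × Fin k) :=
  (List.finRange k).map fun i => (m, i)

/-- Put `d` on top of `d'`, so that the south face of `d` and the north face of `d'` are both at
level `1`. -/
def stack {k : ℕ} (d d' : Multiset (Strand (Node k))) : Multiset (Strand (Fin 3 × Fin k)) :=
  relabel (place 0 1) d + relabel (place 1 2) d'

/-- Level `0` becomes the north face and level `2` the south face. -/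
def unplace {k : ℕ} (x : Fin 3 × Fin k) : Node k := if x.1 = 0 then Sum.inl x.2 else Sum.inr x.2

/-- Concatenation, `d` on top of `d'`. -/
def concat {k : ℕ} (d d' : Multiset (Strand (Node k))) : Multiset (Strand (Node k)) :=
  relabel unplace (fuseList (level k 1) (stack d d'))

/-- Each curve is an edge or a loop, and each node is the end of exactly one edge. -/
def IsDiagram {k : ℕ} (d : Multiset (Strand (Node k))) : Prop :=
  (∀ e ∈ d, IsCurve e) ∧ ∀ v, (ends d).count v = 1

/-- The position of a node on the boundary of the box, read clockwise from the left wall: first the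
north face from left to right, then the south face from right to left. -/
def nodePos {k : ℕ} (v : Node k) : ℕ :=
  Sum.elim (fun i : Fin k => (i : ℕ)) (fun i : Fin k => 2 * k - 1 - i) v

/-- No two edges cross: the ends `a, c` of one edge and `b, x` of another one never occur in
the order `a < b < c < x`. -/
def Planar {V : Type*} (pos : V → ℕ) (M : Multiset (Strand V)) : Prop :=
  ∀ e ∈ M, ∀ f ∈ M, ∀ a ∈ e.1, ∀ b ∈ f.1, ∀ c ∈ e.1, ∀ x ∈ f.1,
    ¬ (pos a < pos b ∧ pos b < pos c ∧ pos c < pos x)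

/-- No edge separates a decorated edge from the left wall. As positions are read from the left wall,
an edge with ends `a < c` separates from the left wall the nodes between `a` and `c`. -/
def LeftExposed {V : Type*} (pos : V → ℕ) (M : Multiset (Strand V)) : Prop :=
  ∀ e ∈ M, e.2 ≠ 0 → ∀ f ∈ M, ∀ a ∈ f.1, ∀ b ∈ e.1, ∀ c ∈ f.1,
    ¬ (pos a < pos b ∧ pos b < pos c)

/-- The number of non-propagating edges in the north face. -/
def aValue {k : ℕ} (d : Multiset (Strand (Node k))) : ℕ :=
  Multiset.card (d.filter fun e => e.1 ≠ 0 ∧ ∀ v ∈ e.1, v.isLeft = true)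

/-- Undecorated vertical edges at the places in `l`. -/
def straight {k : ℕ} (l : List (Fin k)) : Multiset (Strand (Node k)) :=
  (l.map fun i => (({Sum.inl i, Sum.inr i} : Multiset (Node k)), 0) : List (Strand (Node k)))

/-- The curves of the identity diagram. -/
def idStrands (k : ℕ) : Multiset (Strand (Node k)) := straight (List.finRange k)

/-- An edge joining `i` and `j` in the north face and one in the south face, both with `m`
decorations, and undecorated vertical edges elsewhere. -/
def simpleStrands {k : ℕ} (i j : Fin k) (m : ℕ) : Multiset (Strand (Node k)) :=
  (({Sum.inl i, Sum.inl j} : Multiset (Node k)), m) ::ₘ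
    (({Sum.inr i, Sum.inr j} : Multiset (Node k)), m) ::ₘ
      straight ((List.finRange k).filter fun l => l ≠ i ∧ l ≠ j)

/-! Facts needed for the monoid of decorated diagrams. -/

section Gluing

variable {V W : Type*}

theorem ends_add (M N : Multiset (Strand V)) : ends (M + N) = ends M + ends N := by
  simp [ends]

theorem ends_cons (e : Strand V) (N : Multiset (Strand V)) : ends (e ::ₘ N) = e.1 + ends N := by
  simp [ends]

theorem ends_eq (M : Multiset (Strand V)) : ends M = M.sum.1 := by
  induction M using Multiset.induction_on with
  | empty => rfl
  | cons e M ih => simp [ends_cons, ih]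

theorem mem_ends {M : Multiset (Strand V)} {v : V} : v ∈ ends M ↔ ∃ e ∈ M, v ∈ e.1 := by
  induction M using Multiset.induction_on with
  | empty => simp [ends]
  | cons e M ih => simp [ends_cons, ih]

theorem ends_relabel (f : V → W) (M : Multiset (Strand V)) :
    ends (relabel f M) = (ends M).map f := by
  induction M using Multiset.induction_on with
  | empty => simp [ends, relabel]
  | cons e M ih =>
    rw [ends_cons, Multiset.map_add, ← ih]
    simp [relabel, ends]

theorem relabel_add (f : V → W) (M N : Multiset (Strand V)) :
    relabel f (M + N) = relabel f M + relabel f N := by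
  simp [relabel]

theorem relabel_relabel {U : Type*} (g : W → U) (f : V → W) (M : Multiset (Strand V)) :
    relabel g (relabel f M) = relabel (g ∘ f) M := by
  simp [relabel]

theorem relabel_congr {f g : V → W} {M : Multiset (Strand V)}
    (h : ∀ v ∈ ends M, f v = g v) : relabel f M = relabel g M := by
  refine Multiset.map_congr rfl fun e he => ?_
  rw [Multiset.map_congr rfl fun x hx => h x (mem_ends.2 ⟨e, he, hx⟩)]

theorem relabel_id (M : Multiset (Strand V)) : relabel id M = M := by
  simp [relabel]

theorem sum_relabel (f : V → W) (M : Multiset (Strand V)) :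
    (relabel f M).sum = (M.sum.1.map f, M.sum.2) := by
  induction M using Multiset.induction_on with
  | empty => rfl
  | cons e M ih =>
    simp only [relabel] at ih
    simp [relabel, ih]

theorem ends_filter_add_not (p : Strand V → Prop) [DecidablePred p] (M : Multiset (Strand V)) :
    ends (M.filter p) + ends (M.filter fun e => ¬ p e) = ends M := by
  rw [← ends_add, Multiset.filter_add_not]

theorem mem_ends_sum {F : Multiset (Multiset (Strand V))} {v : V} :
    v ∈ ends F.sum ↔ ∃ S ∈ F, v ∈ ends S := by
  induction F using Multiset.induction_on with
  | empty => simp [ends]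
  | cons S F ih => simp [ends_add, ih]

variable [DecidableEq V]

theorem fuse_add_of_notMem {v : V} (M : Multiset (Strand V)) {N : Multiset (Strand V)}
    (h : v ∉ ends N) : fuse v (M + N) = fuse v M + N := by
  have h1 : ∀ e ∈ N, v ∉ e.1 := fun e he hv => h (mem_ends.2 ⟨e, he, hv⟩)
  have h2 : N.filter (fun e => v ∈ e.1) = 0 := Multiset.filter_eq_nil.2 h1
  have h3 : N.filter (fun e => v ∉ e.1) = N := Multiset.filter_eq_self.2 h1
  simp only [fuse, Multiset.filter_add, h2, h3, add_zero, Multiset.cons_add]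

theorem ends_fuse (v : V) (M : Multiset (Strand V)) :
    ends (fuse v M) = (ends M).filter (fun x => x ≠ v) := by
  have h : (ends (M.filter fun e => v ∉ e.1)).filter (fun x => x ≠ v)
      = ends (M.filter fun e => v ∉ e.1) := by
    refine Multiset.filter_eq_self.2 fun x hx => ?_
    rintro rfl
    obtain ⟨e, he, hx⟩ := mem_ends.1 hx
    exact (Multiset.mem_filter.1 he).2 hx
  rw [fuse, ends_cons, ← ends_eq, ← ends_filter_add_not (fun e => v ∈ e.1) M,
    Multiset.filter_add, h]

theorem ends_fuseList (l : List V) (M : Multiset (Strand V)) :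
    ends (fuseList l M) = (ends M).filter (fun x => x ∉ l) := by
  induction l with
  | nil => simp [fuseList]
  | cons v l ih =>
    change ends (fuse v (fuseList l M)) = _
    rw [ends_fuse, ih, Multiset.filter_filter]
    refine Multiset.filter_congr fun x _ => by simp

theorem mem_ends_fuseList {l : List V} {M : Multiset (Strand V)} {x : V} :
    x ∈ ends (fuseList l M) ↔ x ∈ ends M ∧ x ∉ l := by
  rw [ends_fuseList, Multiset.mem_filter]

theorem count_ends_fuseList {l : List V} (M : Multiset (Strand V)) {x : V} (h : x ∉ l) :
    (ends (fuseList l M)).count x = (ends M).count x := by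
  rw [ends_fuseList, Multiset.count_filter, if_pos h]

theorem fuse_comm (v w : V) (M : Multiset (Strand V)) :
    fuse v (fuse w M) = fuse w (fuse v M) := by
  rcases eq_or_ne v w with rfl | hvw
  · rfl
  set A := M.filter (fun e => v ∈ e.1 ∧ w ∈ e.1) with hA
  set B := M.filter (fun e => v ∈ e.1 ∧ w ∉ e.1) with hB
  set C := M.filter (fun e => v ∉ e.1 ∧ w ∈ e.1) with hC
  set D := M.filter (fun e => v ∉ e.1 ∧ w ∉ e.1) with hD
  have e1 : M.filter (fun e => v ∈ e.1) = A + B := by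
    rw [hA, hB, ← Multiset.filter_add_not (fun e => w ∈ e.1) (M.filter (fun e => v ∈ e.1)),
      Multiset.filter_filter, Multiset.filter_filter]
    congr 1 <;> exact Multiset.filter_congr fun x _ => and_comm
  have e2 : M.filter (fun e => w ∈ e.1) = A + C := by
    rw [hA, hC, ← Multiset.filter_add_not (fun e => v ∈ e.1) (M.filter (fun e => w ∈ e.1)),
      Multiset.filter_filter, Multiset.filter_filter]
  have e3 : M.filter (fun e => v ∉ e.1) = C + D := by
    rw [hC, hD, ← Multiset.filter_add_not (fun e => w ∈ e.1) (M.filter (fun e => v ∉ e.1)),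
      Multiset.filter_filter, Multiset.filter_filter]
    congr 1 <;> exact Multiset.filter_congr fun x _ => and_comm
  have e4 : M.filter (fun e => w ∉ e.1) = B + D := by
    rw [hB, hD, ← Multiset.filter_add_not (fun e => v ∈ e.1) (M.filter (fun e => w ∉ e.1)),
      Multiset.filter_filter, Multiset.filter_filter]
  have f1 : B.filter (fun e => v ∈ e.1) = B := Multiset.filter_eq_self.2 fun e he =>
    (Multiset.mem_filter.1 he).2.1
  have f2 : B.filter (fun e => v ∉ e.1) = 0 := Multiset.filter_eq_nil.2 fun e he =>
    not_not.2 (Multiset.mem_filter.1 he).2.1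
  have f3 : D.filter (fun e => v ∈ e.1) = 0 := Multiset.filter_eq_nil.2 fun e he =>
    (Multiset.mem_filter.1 he).2.1
  have f4 : D.filter (fun e => v ∉ e.1) = D := Multiset.filter_eq_self.2 fun e he =>
    (Multiset.mem_filter.1 he).2.1
  have g1 : C.filter (fun e => w ∈ e.1) = C := Multiset.filter_eq_self.2 fun e he =>
    (Multiset.mem_filter.1 he).2.2
  have g2 : C.filter (fun e => w ∉ e.1) = 0 := Multiset.filter_eq_nil.2 fun e he =>
    not_not.2 (Multiset.mem_filter.1 he).2.2
  have g3 : D.filter (fun e => w ∈ e.1) = 0 := Multiset.filter_eq_nil.2 fun e he =>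
    (Multiset.mem_filter.1 he).2.2
  have g4 : D.filter (fun e => w ∉ e.1) = D := Multiset.filter_eq_self.2 fun e he =>
    (Multiset.mem_filter.1 he).2.2
  have hBw : w ∉ B.sum.1 := by
    rw [← ends_eq, mem_ends]; rintro ⟨e, he, h⟩; exact (Multiset.mem_filter.1 he).2.2 h
  have hCv : v ∉ C.sum.1 := by
    rw [← ends_eq, mem_ends]; rintro ⟨e, he, h⟩; exact (Multiset.mem_filter.1 he).2.1 h
  have hFw : fuse w M = ((A + C).sum.1.filter (fun x => x ≠ w), (A + C).sum.2) ::ₘ (B + D) := by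
    rw [fuse, e2, e4]
  have hFv : fuse v M = ((A + B).sum.1.filter (fun x => x ≠ v), (A + B).sum.2) ::ₘ (C + D) := by
    rw [fuse, e1, e3]
  rw [hFw, hFv]
  by_cases hA0 : A = 0
  · simp only [fuse, hA0, zero_add, Multiset.filter_cons, Multiset.filter_add, f1, f2, f3, f4,
      g1, g2, g3, g4, Multiset.mem_filter, hBw, hCv, false_and, if_false, not_false_eq_true,
      if_true, add_zero]
    simp only [← Multiset.singleton_add]
    abel
  · obtain ⟨a, ha⟩ := Multiset.exists_mem_of_ne_zero hA0
    have hav : v ∈ A.sum.1 := by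
      rw [← ends_eq]; exact mem_ends.2 ⟨a, ha, (Multiset.mem_filter.1 ha).2.1⟩
    have haw : w ∈ A.sum.1 := by
      rw [← ends_eq]; exact mem_ends.2 ⟨a, ha, (Multiset.mem_filter.1 ha).2.2⟩
    simp only [fuse, Multiset.filter_cons, Multiset.filter_add, f1, f2, f3, f4,
      g1, g2, g3, g4, Multiset.mem_filter, Multiset.sum_add, Prod.fst_add, Multiset.mem_add, hav,
      haw, hvw, hvw.symm, true_or, ne_eq, not_false_eq_true, and_self, if_true, not_true_eq_false,
      if_false, zero_add, add_zero, Multiset.sum_singleton, Prod.snd_add, Multiset.filter_filter]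
    congr 1
    refine Prod.ext ?_ ?_
    · dsimp only
      have h1 : B.sum.1.filter (fun x => ¬ x = v) =
          B.sum.1.filter (fun x => ¬ x = v ∧ ¬ x = w) := Multiset.filter_congr fun x hx => by
        have : x ≠ w := fun h => hBw (h ▸ hx)
        simp [this]
      have h2 : C.sum.1.filter (fun x => ¬ x = w) =
          C.sum.1.filter (fun x => ¬ x = v ∧ ¬ x = w) := Multiset.filter_congr fun x hx => by
        have : x ≠ v := fun h => hCv (h ▸ hx)
        simp [this]
      simp only [h1, h2, and_comm]
      abel
    · simp only []
      abel

theorem fuseList_append (l l' : List V) (M : Multiset (Strand V)) :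
    fuseList (l ++ l') M = fuseList l (fuseList l' M) :=
  List.foldr_append

theorem fuseList_comm (l l' : List V) (M : Multiset (Strand V)) :
    fuseList l (fuseList l' M) = fuseList l' (fuseList l M) := by
  rw [← fuseList_append, ← fuseList_append]
  have : LeftCommutative (fuse : V → Multiset (Strand V) → Multiset (Strand V)) := ⟨fuse_comm⟩
  exact List.Perm.foldr_eq List.perm_append_comm M

theorem fuseList_add_of_notMem {l : List V} (M : Multiset (Strand V)) {N : Multiset (Strand V)}
    (h : ∀ v ∈ l, v ∉ ends N) : fuseList l (M + N) = fuseList l M + N := by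
  induction l with
  | nil => rfl
  | cons v l ih =>
    change fuse v (fuseList l (M + N)) = fuse v (fuseList l M) + N
    rw [ih fun w hw => h w (List.mem_cons_of_mem _ hw),
      fuse_add_of_notMem _ (h v List.mem_cons_self)]

theorem relabel_fuse [DecidableEq W] {f : V → W} (hf : Function.Injective f) (v : V)
    (M : Multiset (Strand V)) : relabel f (fuse v M) = fuse (f v) (relabel f M) := by
  have h1 : (relabel f M).filter (fun e => f v ∈ e.1) =
      relabel f (M.filter (fun e => v ∈ e.1)) := by
    simp only [relabel, Multiset.filter_map]
    congr 1
    refine Multiset.filter_congr fun e _ => ?_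
    simp [hf.eq_iff]
  have h2 : (relabel f M).filter (fun e => f v ∉ e.1) =
      relabel f (M.filter (fun e => v ∉ e.1)) := by
    simp only [relabel, Multiset.filter_map]
    congr 1
    refine Multiset.filter_congr fun e _ => ?_
    simp [hf.eq_iff]
  have h3 : ∀ t : Multiset V, (t.map f).filter (fun x => x ≠ f v) =
      (t.filter (fun x => x ≠ v)).map f := fun t => by
    rw [Multiset.filter_map]
    congr 1
    refine Multiset.filter_congr fun x _ => ?_
    simp [hf.eq_iff]
  rw [fuse, fuse, h1, h2, sum_relabel, h3]
  simp [relabel]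

theorem relabel_fuseList [DecidableEq W] {f : V → W} (hf : Function.Injective f) (l : List V)
    (M : Multiset (Strand V)) : relabel f (fuseList l M) = fuseList (l.map f) (relabel f M) := by
  induction l with
  | nil => rfl
  | cons v l ih =>
    change relabel f (fuse v (fuseList l M)) = fuse (f v) (fuseList (l.map f) (relabel f M))
    rw [relabel_fuse hf, ih]

theorem isCurve_fuse {v : V} {M : Multiset (Strand V)} (hM : ∀ e ∈ M, IsCurve e)
    (hv : (ends M).count v = 2) : ∀ e ∈ fuse v M, IsCurve e := by
  intro e he
  rw [fuse, Multiset.mem_cons] at he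
  rcases he with rfl | he
  · set A := M.filter (fun e => v ∈ e.1) with hA
    have hc : (ends A).count v = 2 := by
      rw [← hv, ← ends_filter_add_not (fun e => v ∈ e.1) M, Multiset.count_add,
        Multiset.count_eq_zero_of_notMem (s := ends (M.filter fun e => v ∉ e.1)), add_zero]
      rw [mem_ends]
      rintro ⟨e, he, h⟩
      exact (Multiset.mem_filter.1 he).2 h
    have key : ∀ B : Multiset (Strand V), (∀ e ∈ B, v ∈ e.1 ∧ IsCurve e) →
        Multiset.card (ends B) = 2 * Multiset.card B ∧
          Multiset.card B ≤ (ends B).count v := by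
      intro B
      induction B using Multiset.induction_on with
      | empty => simp [ends]
      | cons e B ih =>
        intro h
        obtain ⟨h1, h2⟩ := ih fun e he => h e (Multiset.mem_cons_of_mem he)
        obtain ⟨h3, h4⟩ := h e (Multiset.mem_cons_self e B)
        have h5 := Multiset.one_le_count_iff_mem.2 h3
        have h6 : Multiset.card e.1 ≠ 0 := fun h => by
          rw [Multiset.card_eq_zero] at h; simp [h] at h3
        have h7 : Multiset.card e.1 = 2 := h4.resolve_left h6
        rw [ends_cons, Multiset.card_add, Multiset.count_add, Multiset.card_cons]
        omega
    obtain ⟨h1, h2⟩ := key A fun e he =>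
      ⟨(Multiset.mem_filter.1 he).2, hM e (Multiset.mem_filter.1 he).1⟩
    have h3 : Multiset.card A ≠ 0 := fun h => by
      rw [Multiset.card_eq_zero] at h; simp [h, ends] at hc
    have h4 : Multiset.card ((ends A).filter fun x => x ≠ v) + 2 = Multiset.card (ends A) := by
      have := congrArg Multiset.card (Multiset.filter_add_not (fun x => v = x) (ends A))
      rw [Multiset.card_add, ← Multiset.countP_eq_card_filter] at this
      rw [← this, ← hc, Multiset.count, add_comm]
      congr 2
      exact Multiset.filter_congr fun x _ => ne_comm
    unfold IsCurve
    rw [← ends_eq]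
    dsimp only
    omega
  · exact hM e (Multiset.mem_filter.1 he).1

theorem isCurve_fuseList {l : List V} (hl : l.Nodup) {M : Multiset (Strand V)}
    (hM : ∀ e ∈ M, IsCurve e) (hv : ∀ v ∈ l, (ends M).count v = 2) :
    ∀ e ∈ fuseList l M, IsCurve e := by
  induction l with
  | nil => exact hM
  | cons v l ih =>
    change ∀ e ∈ fuse v (fuseList l M), IsCurve e
    rw [List.nodup_cons] at hl
    refine isCurve_fuse (ih hl.2 fun w hw => hv w (List.mem_cons_of_mem _ hw)) ?_
    rw [ends_fuseList, Multiset.count_filter, if_pos hl.1, hv v List.mem_cons_self]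

/-- Gluing straight strands `{w i, v i}` to `M` along the points `v i` renames `v i` to `w i`. -/
theorem fuseList_straight {ι : Type*} (v w : ι → V) (hv : Function.Injective v)
    (hvw : ∀ i j, w i ≠ v j) (l : List ι) (hl : l.Nodup) (M : Multiset (Strand V))
    (hM : ∀ i, (ends M).count (v i) = 1) :
    ∃ h : V → V, (∀ i ∈ l, h (v i) = w i) ∧ (∀ x, (∀ i ∈ l, x ≠ v i) → h x = x) ∧
      fuseList (l.map v) ((l.map fun i => (({w i, v i} : Multiset V), 0) : List (Strand V)) + M)
        = relabel h M := by
  induction l with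
  | nil => exact ⟨id, by simp, by simp, by simp [fuseList, relabel_id]⟩
  | cons i l ih =>
    rw [List.nodup_cons] at hl
    obtain ⟨h, h1, h2, h3⟩ := ih hl.2
    have hvi : h (v i) = v i := h2 _ fun j hj e => hl.1 (hv e ▸ hj)
    have hcount : (ends (relabel h M)).count (v i) = 1 := by
      rw [ends_relabel, Multiset.count_map, ← hM i, Multiset.count,
        Multiset.countP_eq_card_filter]
      congr 1
      refine Multiset.filter_congr fun x _ => ⟨fun e => ?_, fun e => ?_⟩
      · by_cases hx : ∃ j ∈ l, x = v j
        · obtain ⟨j, hj, rfl⟩ := hx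
          rw [h1 j hj] at e
          exact absurd e.symm (hvw _ _)
        · push Not at hx
          rw [h2 x hx] at e
          exact e
      · rw [← e, hvi]
    refine ⟨fun x => if x = v i then w i else h x, ?_, ?_, ?_⟩
    · intro j hj
      rcases List.mem_cons.1 hj with rfl | hj
      · simp
      · have : v j ≠ v i := fun e => hl.1 (hv e ▸ hj)
        simp [this, h1 j hj]
    · intro x hx
      have : x ≠ v i := hx i List.mem_cons_self
      simp [this, h2 x fun j hj => hx j (List.mem_cons_of_mem _ hj)]
    · change fuse (v i) (fuseList (l.map v) _) = _
      have e1 : (((i :: l).map fun i => (({w i, v i} : Multiset V), 0) : List (Strand V)) :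
          Multiset (Strand V)) + M =
          ((l.map fun i => (({w i, v i} : Multiset V), 0) : List (Strand V)) + M)
            + {(({w i, v i} : Multiset V), 0)} := by
        rw [List.map_cons, ← Multiset.cons_coe, ← Multiset.singleton_add]
        abel
      rw [e1, fuseList_add_of_notMem, h3]
      · set N := relabel h M with hN
        obtain ⟨e, he, hve⟩ := mem_ends.1 (Multiset.one_le_count_iff_mem.1 hcount.ge)
        obtain ⟨N', hN'⟩ := Multiset.exists_cons_of_mem he
        obtain ⟨t, ht⟩ := Multiset.exists_cons_of_mem hve
        have hc : t.count (v i) + (ends N').count (v i) = 0 := by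
          rw [hN', ends_cons, ht, Multiset.count_add, Multiset.count_cons_self] at hcount
          omega
        have ht0 : v i ∉ t := by
          rw [← Multiset.count_eq_zero]; omega
        have hN0 : v i ∉ ends N' := by
          rw [← Multiset.count_eq_zero]; omega
        have e2 : relabel (fun x => if x = v i then w i else h x) M
            = relabel (fun x => if x = v i then w i else x) N := by
          rw [hN, relabel_relabel]
          refine relabel_congr fun x _ => ?_
          by_cases hx : x = v i
          · simp [hx, hvi]
          · simp only [hx, if_false, Function.comp]
            rw [if_neg]
            intro e
            by_cases hx' : ∃ j ∈ l, x = v j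
            · obtain ⟨j, hj, rfl⟩ := hx'
              rw [h1 j hj] at e
              exact hvw _ _ e
            · push Not at hx'
              rw [h2 x hx'] at e
              exact hx e
        rw [e2, hN', Multiset.cons_add, ← Multiset.singleton_add, add_comm N', ← add_assoc,
          fuse_add_of_notMem _ hN0, ← Multiset.singleton_add, relabel_add]
        congr 1
        · have hs : ({e} + {(({w i, v i} : Multiset V), 0)} : Multiset (Strand V)).filter
              (fun e => v i ∈ e.1) = {e} + {(({w i, v i} : Multiset V), 0)} := by
            refine Multiset.filter_eq_self.2 fun a ha => ?_
            simp only [Multiset.mem_add, Multiset.mem_singleton] at ha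
            rcases ha with rfl | rfl
            · exact hve
            · simp
          have hs' : ({e} + {(({w i, v i} : Multiset V), 0)} : Multiset (Strand V)).filter
              (fun e => v i ∉ e.1) = 0 := by
            refine Multiset.filter_eq_nil.2 fun a ha => ?_
            simp only [Multiset.mem_add, Multiset.mem_singleton] at ha
            rcases ha with rfl | rfl
            · exact not_not.2 hve
            · simp
          have ht1 : t.filter (fun x => ¬ x = v i) = t := Multiset.filter_eq_self.2 fun x hx e =>
            ht0 (e ▸ hx)
          have ht2 : t.map (fun x => if x = v i then w i else x) = t := by
            conv_rhs => rw [← Multiset.map_id t]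
            refine Multiset.map_congr rfl fun x hx => ?_
            have hne : x ≠ v i := fun hh => ht0 (hh ▸ hx)
            rw [if_neg hne, id]
          rw [fuse, hs, hs']
          simp only [relabel, Multiset.sum_add, Multiset.sum_singleton, Prod.fst_add, ht,
            Multiset.filter_add, Prod.snd_add, Multiset.map_singleton, Multiset.map_cons, if_true,
            ht2, Multiset.filter_cons, ht1, ne_eq, not_true_eq_false, if_false, zero_add,
            Multiset.insert_eq_cons, Multiset.filter_singleton, hvw, not_false_eq_true, add_zero]
          rw [add_comm t, Multiset.singleton_add]
          simp
        · symm
          conv_rhs => rw [← relabel_id N']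
          refine relabel_congr fun x hx => ?_
          have hne : x ≠ v i := fun hh => hN0 (hh ▸ hx)
          rw [if_neg hne, id]
      · intro x hx
        obtain ⟨j, hj, rfl⟩ := List.mem_map.1 hx
        have hij : v j ≠ v i := fun e => hl.1 (hv e ▸ hj)
        simp [ends, hij, (hvw i j).symm]

def groupStrand (l : List V) (S : Multiset (Strand V)) : Strand V :=
  ((ends S).filter (fun x => x ∉ l), S.sum.2)

theorem groupStrand_fst (l : List V) (S : Multiset (Strand V)) (p : V → Prop) [DecidablePred p]
    (h : ∀ x, x ∉ l ↔ p x) : (groupStrand l S).1 = (ends S).filter p :=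
  Multiset.filter_congr fun x _ => h x

theorem sum_groupStrand (l : List V) (F : Multiset (Multiset (Strand V))) :
    (F.map (groupStrand l)).sum = groupStrand l F.sum := by
  induction F using Multiset.induction_on with
  | empty => simp [groupStrand, ends]; rfl
  | cons S F ih =>
    rw [Multiset.map_cons, Multiset.sum_cons, ih, Multiset.sum_cons]
    simp [groupStrand, ends_add]

theorem mem_fuseList {l : List V} {M : Multiset (Strand V)} {e : Strand V} (he : e ∈ M)
    (h : ∀ x ∈ e.1, x ∉ l) : e ∈ fuseList l M := by
  induction l with
  | nil => exact he
  | cons v l ih =>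
    refine Multiset.mem_cons_of_mem (Multiset.mem_filter.2 ⟨ih fun x hx hl => ?_, fun hv => ?_⟩)
    · exact h x hx (List.mem_cons_of_mem _ hl)
    · exact h v hv List.mem_cons_self

/-- The strands obtained by fusing correspond to groups of the original strands that are
linked to each other at the fused points. -/
theorem exists_groups (l : List V) (hl : l.Nodup) (M : Multiset (Strand V)) :
    ∃ F : Multiset (Multiset (Strand V)), F.sum = M ∧ fuseList l M = F.map (groupStrand l) ∧
      (∀ v ∈ l, ∀ S ∈ F, (ends S).count v = 0 ∨ (ends S).count v = (ends M).count v) ∧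
      (∀ S ∈ F, ∀ g : V → ℕ, (∀ e ∈ S, ∀ x ∈ e.1, ∀ y ∈ e.1, g x = g y) →
        ∀ x ∈ ends S, ∀ y ∈ ends S, g x = g y) ∧
      (∀ S ∈ F, ∀ e ∈ S, e.1 = 0 → S = {e}) := by
  induction l with
  | nil =>
    refine ⟨M.map fun e => {e}, Multiset.sum_map_singleton M, ?_, by simp, ?_, ?_⟩
    · rw [Multiset.map_map]
      conv_lhs => rw [fuseList, List.foldr_nil, ← Multiset.map_id M]
      refine Multiset.map_congr rfl fun e _ => ?_
      simp [groupStrand, ends]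
    · intro S hS g hg x hx y hy
      obtain ⟨e, _, rfl⟩ := Multiset.mem_map.1 hS
      refine hg e (Multiset.mem_singleton_self e) x ?_ y ?_
      · simpa [ends] using hx
      · simpa [ends] using hy
    · intro S hS e he _
      obtain ⟨e', _, rfl⟩ := Multiset.mem_map.1 hS
      rw [Multiset.mem_singleton.1 he]
  | cons v l ih =>
    rw [List.nodup_cons] at hl
    obtain ⟨F, h1, h2, h3, h4, h5⟩ := ih hl.2
    set G := F.filter (fun S => v ∈ ends S) with hG
    set H := F.filter (fun S => v ∉ ends S) with hH
    have hGH : G + H = F := Multiset.filter_add_not _ _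
    have hmem : ∀ S, v ∈ (groupStrand l S).1 ↔ v ∈ ends S := fun S => by
      simp [groupStrand, hl.1]
    have hHsum : v ∉ ends H.sum := by
      rw [mem_ends_sum]
      rintro ⟨S, hS, h⟩
      exact (Multiset.mem_filter.1 hS).2 h
    refine ⟨G.sum ::ₘ H, ?_, ?_, ?_, ?_, ?_⟩
    · rw [Multiset.sum_cons, ← Multiset.sum_add, hGH, h1]
    · change fuse v (fuseList l M) = _
      have e1 : (F.map (groupStrand l)).filter (fun e => v ∈ e.1) = G.map (groupStrand l) := by
        rw [Multiset.filter_map]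
        congr 1
        exact Multiset.filter_congr fun S _ => hmem S
      have e2 : (F.map (groupStrand l)).filter (fun e => v ∉ e.1) = H.map (groupStrand l) := by
        rw [Multiset.filter_map]
        congr 1
        exact Multiset.filter_congr fun S _ => not_congr (hmem S)
      rw [h2, fuse, e1, e2, sum_groupStrand, Multiset.map_cons]
      congr 1
      · refine Prod.ext ?_ rfl
        simp only [groupStrand, Multiset.filter_filter]
        refine Multiset.filter_congr fun x _ => by simp
      · refine Multiset.map_congr rfl fun S hS => Prod.ext ?_ rfl
        have hv : v ∉ ends S := (Multiset.mem_filter.1 hS).2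
        refine Multiset.filter_congr fun x hx => ?_
        have : x ≠ v := fun h => hv (h ▸ hx)
        simp [this]
    · intro w hw S hS
      rw [Multiset.mem_cons] at hS
      rcases List.mem_cons.1 hw with rfl | hw
      · rcases hS with rfl | hS
        · right
          rw [← h1, ← hGH, Multiset.sum_add, ends_add, Multiset.count_add,
            Multiset.count_eq_zero_of_notMem hHsum, add_zero]
        · exact Or.inl (Multiset.count_eq_zero_of_notMem (Multiset.mem_filter.1 hS).2)
      · rcases hS with rfl | hS
        · have hle : (ends G.sum).count w ≤ (ends M).count w := by
            rw [← h1, ← hGH, Multiset.sum_add, ends_add, Multiset.count_add]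
            exact Nat.le_add_right _ _
          have hmul : ∀ K : Multiset (Multiset (Strand V)), (∀ S ∈ K, S ∈ F) →
              ∃ m : ℕ, (ends K.sum).count w = m * (ends M).count w := by
            intro K
            induction K using Multiset.induction_on with
            | empty => exact fun _ => ⟨0, by simp [ends]⟩
            | cons S K ihK =>
              intro hK
              obtain ⟨m, hm⟩ := ihK fun S hS => hK S (Multiset.mem_cons_of_mem hS)
              rw [Multiset.sum_cons, ends_add, Multiset.count_add, hm]
              rcases h3 w hw S (hK S (Multiset.mem_cons_self _ _)) with h | h
              · exact ⟨m, by rw [h, zero_add]⟩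
              · exact ⟨m + 1, by rw [h]; ring⟩
          obtain ⟨m, hm⟩ := hmul G fun S hS => (Multiset.mem_filter.1 hS).1
          rcases m with _ | _ | m
          · left; rw [hm, zero_mul]
          · right; rw [hm, zero_add, one_mul]
          · left
            rw [hm] at hle ⊢
            have : (ends M).count w = 0 := by nlinarith
            rw [this, mul_zero]
        · exact h3 w hw S (Multiset.mem_filter.1 hS).1
    · intro S hS g hg
      rw [Multiset.mem_cons] at hS
      rcases hS with rfl | hS
      · have key : ∀ x ∈ ends G.sum, g x = g v := by
          intro x hx
          obtain ⟨S, hS, hx⟩ := mem_ends_sum.1 hx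
          refine h4 S (Multiset.mem_filter.1 hS).1 g (fun e he => hg e ?_) x hx v
            (Multiset.mem_filter.1 hS).2
          obtain ⟨K, hK⟩ := Multiset.exists_cons_of_mem hS
          rw [hK, Multiset.sum_cons]
          exact Multiset.mem_add.2 (Or.inl he)
        intro x hx y hy
        rw [key x hx, key y hy]
      · exact h4 S (Multiset.mem_filter.1 hS).1 g hg
    · intro S hS e he he0
      rw [Multiset.mem_cons] at hS
      rcases hS with rfl | hS
      · exfalso
        have : ∃ S ∈ G, e ∈ S := by
          clear_value G
          induction G using Multiset.induction_on with
          | empty => simp at he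
          | cons S K ihK => exact (Multiset.mem_join (S := S ::ₘ K)).1 he
        obtain ⟨S, hS, heS⟩ := this
        have h6 := h5 S (Multiset.mem_filter.1 hS).1 e heS he0
        have h7 : v ∈ ends S := (Multiset.mem_filter.1 hS).2
        rw [h6] at h7
        simp [ends, he0] at h7
      · exact h5 S (Multiset.mem_filter.1 hS).1 e he he0

end Gluing

section Concat

variable {k : ℕ}

theorem mem_level {Λ : Type*} {m : Λ} {x : Λ × Fin k} : x ∈ level k m ↔ x.1 = m := by
  rcases x with ⟨l, i⟩
  simp [level, eq_comm]

theorem nodup_level {Λ : Type*} (m : Λ) : (level k m).Nodup :=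
  (List.nodup_finRange k).map fun _ _ h => (Prod.mk.inj h).2

theorem place_injective {Λ : Type*} {s t : Λ} (h : s ≠ t) :
    Function.Injective (place s t : Node k → Λ × Fin k) := by
  rintro (i | i) (j | j) e
  · simpa [place] using e
  · exact absurd (Prod.mk.inj e).1 h
  · exact absurd (Prod.mk.inj e).1.symm h
  · simpa [place] using e

theorem mem_ends_place {Λ : Type*} {s t : Λ} {d : Multiset (Strand (Node k))} {x : Λ × Fin k}
    (h : x ∈ ends (relabel (place s t) d)) : x.1 = s ∨ x.1 = t := by
  rw [ends_relabel, Multiset.mem_map] at h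
  obtain ⟨(i | i), _, rfl⟩ := h
  · exact Or.inl rfl
  · exact Or.inr rfl

theorem relabel_place_concat {Λ : Type*} [DecidableEq Λ] {s m t : Λ} (hsm : s ≠ m) (hmt : m ≠ t)
    (hst : s ≠ t) (d d' : Multiset (Strand (Node k))) :
    relabel (place s t) (concat d d') =
      fuseList (level k m) (relabel (place s m) d + relabel (place m t) d') := by
  have hg : Function.Injective (![s, m, t] : Fin 3 → Λ) := by
    intro i j
    fin_cases i <;> fin_cases j <;> simp [hsm, hmt, hst, hsm.symm, hmt.symm, hst.symm]
  have hg' : Function.Injective (Prod.map ![s, m, t] id : Fin 3 × Fin k → Λ × Fin k) :=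
    hg.prodMap Function.injective_id
  rw [concat, relabel_relabel,
    relabel_congr (g := (Prod.map ![s, m, t] id : Fin 3 × Fin k → Λ × Fin k)),
    relabel_fuseList hg']
  · congr 1
    · simp [level]
    · rw [stack, relabel_add, relabel_relabel, relabel_relabel]
      congr 1 <;> refine relabel_congr ?_ <;> rintro (i | i) _ <;> rfl
  · rintro ⟨l, i⟩ hx
    rw [mem_ends_fuseList, mem_level] at hx
    have h1 : l ≠ 1 := hx.2
    fin_cases l
    · rfl
    · exact absurd rfl h1
    · rfl

theorem relabel_injective {V W : Type*} {f : V → W} (hf : Function.Injective f) :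
    Function.Injective (relabel f) := by
  refine Multiset.map_injective ?_
  rintro ⟨x, m⟩ ⟨y, n⟩ h
  have := Prod.mk.inj h
  exact Prod.ext (Multiset.map_injective hf this.1) this.2

theorem concat_assoc (a b c : Multiset (Strand (Node k))) :
    concat (concat a b) c = concat a (concat b c) := by
  refine relabel_injective (place_injective (k := k) (s := (0 : Fin 4)) (t := 3) (by decide)) ?_
  rw [relabel_place_concat (m := (2 : Fin 4)) (by decide) (by decide) (by decide),
    relabel_place_concat (m := (1 : Fin 4)) (by decide) (by decide) (by decide),
    relabel_place_concat (m := (1 : Fin 4)) (by decide) (by decide) (by decide),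
    relabel_place_concat (m := (2 : Fin 4)) (by decide) (by decide) (by decide),
    ← fuseList_add_of_notMem, fuseList_comm, add_assoc, add_comm (relabel (place 0 1) a),
    fuseList_add_of_notMem, add_comm]
  · intro v hv h
    rw [mem_level] at hv
    rcases mem_ends_place h with h | h <;> rw [hv] at h <;> revert h <;> decide
  · intro v hv h
    rw [mem_level] at hv
    rcases mem_ends_place h with h | h <;> rw [hv] at h <;> revert h <;> decide

theorem count_ends_relabel {V W : Type*} [DecidableEq V] [DecidableEq W] {f : V → W}
    (hf : Function.Injective f) (M : Multiset (Strand V)) (v : V) :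
    (ends (relabel f M)).count (f v) = (ends M).count v := by
  rw [ends_relabel, Multiset.count_map_eq_count' f _ hf]

theorem id_concat (d : Multiset (Strand (Node k))) (hd : ∀ v, (ends d).count v = 1) :
    concat (idStrands k) d = d := by
  have hi : Function.Injective (place 1 2 : Node k → Fin 3 × Fin k) :=
    place_injective (by decide)
  obtain ⟨h, h1, h2, h3⟩ := fuseList_straight (V := Fin 3 × Fin k) (fun i : Fin k => (1, i))
    (fun i => (0, i)) (fun _ _ h => (Prod.mk.inj h).2) (fun i j => by simp) (List.finRange k)
    (List.nodup_finRange k) (relabel (place 1 2) d)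
    (fun i => (count_ends_relabel hi d (Sum.inl i)).trans (hd _))
  have e1 : stack (idStrands k) d = (((List.finRange k).map fun i =>
      (({(0, i), (1, i)} : Multiset (Fin 3 × Fin k)), 0) : List (Strand (Fin 3 × Fin k))) :
        Multiset (Strand (Fin 3 × Fin k))) + relabel (place 1 2) d := by
    rw [stack]
    congr 1
    simp only [relabel, idStrands, straight, place, Multiset.map_coe, List.map_map]
    congr 1
  rw [concat, e1, level, h3, relabel_relabel, relabel_relabel]
  conv_rhs => rw [← relabel_id d]
  refine relabel_congr ?_
  rintro (i | i) _
  · change unplace (h (1, i)) = _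
    rw [h1 i (List.mem_finRange i)]
    rfl
  · change unplace (h (2, i)) = _
    rw [h2 _ fun j _ => by simp]
    rfl

theorem concat_id (d : Multiset (Strand (Node k))) (hd : ∀ v, (ends d).count v = 1) :
    concat d (idStrands k) = d := by
  have hi : Function.Injective (place 0 1 : Node k → Fin 3 × Fin k) :=
    place_injective (by decide)
  obtain ⟨h, h1, h2, h3⟩ := fuseList_straight (V := Fin 3 × Fin k) (fun i : Fin k => (1, i))
    (fun i => (2, i)) (fun _ _ h => (Prod.mk.inj h).2) (fun i j => by simp) (List.finRange k)
    (List.nodup_finRange k) (relabel (place 0 1) d)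
    (fun i => (count_ends_relabel hi d (Sum.inr i)).trans (hd _))
  have e1 : stack d (idStrands k) = (((List.finRange k).map fun i =>
      (({(2, i), (1, i)} : Multiset (Fin 3 × Fin k)), 0) : List (Strand (Fin 3 × Fin k))) :
        Multiset (Strand (Fin 3 × Fin k))) + relabel (place 0 1) d := by
    rw [stack, add_comm]
    congr 1
    simp only [relabel, idStrands, straight, place, Multiset.map_coe, List.map_map]
    congr 1
    refine List.map_congr_left fun i _ => ?_
    exact Prod.ext (Multiset.pair_comm _ _) rfl
  rw [concat, e1, level, h3, relabel_relabel, relabel_relabel]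
  conv_rhs => rw [← relabel_id d]
  refine relabel_congr ?_
  rintro (i | i) _
  · change unplace (h (0, i)) = _
    rw [h2 _ fun j _ => by simp]
    rfl
  · change unplace (h (1, i)) = _
    rw [h1 i (List.mem_finRange i)]
    rfl

theorem count_stack {d d' : Multiset (Strand (Node k))} (hd : ∀ v, (ends d).count v = 1)
    (hd' : ∀ v, (ends d').count v = 1) (x : Fin 3 × Fin k) :
    (ends (stack d d')).count x = if x.1 = 1 then 2 else 1 := by
  have hi : Function.Injective (place 0 1 : Node k → Fin 3 × Fin k) :=
    place_injective (by decide)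
  have hi' : Function.Injective (place 1 2 : Node k → Fin 3 × Fin k) :=
    place_injective (by decide)
  rw [stack, ends_add, Multiset.count_add]
  rcases x with ⟨l, i⟩
  fin_cases l
  · have h1 := (count_ends_relabel hi d (Sum.inl i)).trans (hd _)
    have h2 : (ends (relabel (place 1 2) d')).count ((0 : Fin 3), i) = 0 :=
      Multiset.count_eq_zero.2 fun h => by
        rcases mem_ends_place h with h | h <;> revert h <;> simp
    simpa [place] using (congrArg₂ (· + ·) h1 h2)
  · have h1 := (count_ends_relabel hi d (Sum.inr i)).trans (hd _)
    have h2 := (count_ends_relabel hi' d' (Sum.inl i)).trans (hd' _)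
    simpa [place] using (congrArg₂ (· + ·) h1 h2)
  · have h1 : (ends (relabel (place 0 1) d)).count ((2 : Fin 3), i) = 0 :=
      Multiset.count_eq_zero.2 fun h => by
        rcases mem_ends_place h with h | h <;> revert h <;> simp
    have h2 := (count_ends_relabel hi' d' (Sum.inr i)).trans (hd' _)
    simpa [place] using (congrArg₂ (· + ·) h1 h2)

theorem isCurve_relabel {V W : Type*} {f : V → W} {M : Multiset (Strand V)}
    (h : ∀ e ∈ M, IsCurve e) : ∀ e ∈ relabel f M, IsCurve e := by
  intro e he
  obtain ⟨e', he', rfl⟩ := Multiset.mem_map.1 he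
  simpa [IsCurve] using h e' he'

theorem isCurve_concat {d d' : Multiset (Strand (Node k))} (hd : ∀ v, (ends d).count v = 1)
    (hd' : ∀ v, (ends d').count v = 1) (h : ∀ e ∈ d, IsCurve e) (h' : ∀ e ∈ d', IsCurve e) :
    ∀ e ∈ concat d d', IsCurve e := by
  refine isCurve_relabel (isCurve_fuseList (nodup_level _) ?_ ?_)
  · intro e he
    rcases Multiset.mem_add.1 he with he | he
    · exact isCurve_relabel h e he
    · exact isCurve_relabel h' e he
  · intro v hv
    rw [count_stack hd hd', if_pos (mem_level.1 hv)]

theorem count_concat {d d' : Multiset (Strand (Node k))} (hd : ∀ v, (ends d).count v = 1)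
    (hd' : ∀ v, (ends d').count v = 1) (v : Node k) : (ends (concat d d')).count v = 1 := by
  have hi : Function.Injective (place 0 2 : Node k → Fin 3 × Fin k) :=
    place_injective (by decide)
  rw [← count_ends_relabel hi, relabel_place_concat (m := (1 : Fin 3)) (by decide) (by decide)
    (by decide), count_ends_fuseList]
  · have := count_stack hd hd' (place 0 2 v)
    rw [stack] at this
    rw [this]
    rcases v with i | i <;> simp [place]
  · rw [mem_level]
    rcases v with i | i <;> simp [place]

def boxPos {Λ : Type*} [DecidableEq Λ] (s : Λ) (x : Λ × Fin k) : ℕ :=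
  if x.1 = s then (x.2 : ℕ) else 2 * k - 1 - x.2

theorem boxPos_place {Λ : Type*} [DecidableEq Λ] {s t : Λ} (h : s ≠ t) (v : Node k) :
    boxPos s (place s t v) = nodePos v := by
  rcases v with i | i
  · simp [boxPos, place, nodePos]
  · simp [boxPos, place, nodePos, h.symm]

theorem planar_relabel {V W : Type*} {pos : V → ℕ} {pos' : W → ℕ} {f : V → W}
    (h : ∀ v, pos' (f v) = pos v) (M : Multiset (Strand V)) :
    Planar pos' (relabel f M) ↔ Planar pos M := by
  simp only [Planar, relabel, Multiset.forall_mem_map_iff, h]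

theorem leftExposed_relabel {V W : Type*} {pos : V → ℕ} {pos' : W → ℕ} {f : V → W}
    (h : ∀ v, pos' (f v) = pos v) (M : Multiset (Strand V)) :
    LeftExposed pos' (relabel f M) ↔ LeftExposed pos M := by
  simp only [LeftExposed, relabel, Multiset.forall_mem_map_iff, h]

def below {V : Type*} (pos : V → ℕ) (A : Multiset V) (y : V) : ℕ :=
  A.countP fun x => pos x < pos y

theorem exists_pair {V : Type*} {e : Strand V} (h : IsCurve e) :
    e.1 = 0 ∨ ∃ a b, e.1 = {a, b} := by
  rcases h with h | h
  · exact Or.inl (Multiset.card_eq_zero.1 h)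
  · exact Or.inr (Multiset.card_eq_two.1 h)

theorem below_strand {V : Type*} {pos : V → ℕ} {M : Multiset (Strand V)} (hM : Planar pos M)
    {e f : Strand V} (he : e ∈ M) (hf : f ∈ M) (hc : IsCurve e) {y z : V} (hy : y ∈ f.1)
    (hz : z ∈ f.1) (hne : ∀ x ∈ e.1, pos x ≠ pos y ∧ pos x ≠ pos z) :
    below pos e.1 y % 2 = below pos e.1 z % 2 := by
  rcases exists_pair hc with h | ⟨a, b, h⟩
  · simp [below, h]
  · have ha : a ∈ e.1 := by simp [h]
    have hb : b ∈ e.1 := by simp [h]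
    have h1 := hM e he f hf a ha y hy b hb z hz
    have h2 := hM e he f hf a ha z hz b hb y hy
    have h3 := hM e he f hf b hb y hy a ha z hz
    have h4 := hM e he f hf b hb z hz a ha y hy
    have h5 := hM f hf e he y hy a ha z hz b hb
    have h6 := hM f hf e he z hz a ha y hy b hb
    have h7 := hM f hf e he y hy b hb z hz a ha
    have h8 := hM f hf e he z hz b hb y hy a ha
    obtain ⟨n1, n2⟩ := hne a ha
    obtain ⟨n3, n4⟩ := hne b hb
    simp only [below, h, Multiset.insert_eq_cons, Multiset.countP_cons, ← Multiset.cons_zero,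
      Multiset.countP_zero]
    split_ifs <;> omega

theorem below_add {V : Type*} (pos : V → ℕ) (A B : Multiset V) (y : V) :
    below pos (A + B) y = below pos A y + below pos B y := Multiset.countP_add _ _ _

theorem below_ends {V : Type*} {pos : V → ℕ} {M S : Multiset (Strand V)} (hM : Planar pos M)
    {f : Strand V} (hf : f ∈ M) {y z : V} (hy : y ∈ f.1) (hz : z ∈ f.1) (hS : ∀ e ∈ S, e ∈ M)
    (hc : ∀ e ∈ S, IsCurve e) (hne : ∀ x ∈ ends S, pos x ≠ pos y ∧ pos x ≠ pos z) :
    below pos (ends S) y % 2 = below pos (ends S) z % 2 := by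
  induction S using Multiset.induction_on with
  | empty => simp [below, ends]
  | cons e S ih =>
    rw [ends_cons, below_add, below_add, Nat.add_mod, Nat.add_mod (below pos e.1 z),
      below_strand hM (hS e (Multiset.mem_cons_self _ _)) hf (hc e (Multiset.mem_cons_self _ _))
        hy hz fun x hx => hne x (by rw [ends_cons]; exact Multiset.mem_add.2 (Or.inl hx)),
      ih (fun e he => hS e (Multiset.mem_cons_of_mem he))
        (fun e he => hc e (Multiset.mem_cons_of_mem he))
        fun x hx => hne x (by rw [ends_cons]; exact Multiset.mem_add.2 (Or.inr hx))]

theorem below_ends_exposed {V : Type*} {pos : V → ℕ} {M S : Multiset (Strand V)}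
    (hM : LeftExposed pos M) {f : Strand V} (hf : f ∈ M) (hf2 : f.2 ≠ 0) {y : V} (hy : y ∈ f.1)
    (hS : ∀ e ∈ S, e ∈ M) (hc : ∀ e ∈ S, IsCurve e) (hne : ∀ x ∈ ends S, pos x ≠ pos y) :
    below pos (ends S) y % 2 = 0 := by
  induction S using Multiset.induction_on with
  | empty => simp [below, ends]
  | cons e S ih =>
    have h1 : below pos e.1 y % 2 = 0 := by
      rcases exists_pair (hc e (Multiset.mem_cons_self _ _)) with h | ⟨a, b, h⟩
      · simp [below, h]
      · have ha : a ∈ e.1 := by simp [h]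
        have hb : b ∈ e.1 := by simp [h]
        have he := hS e (Multiset.mem_cons_self _ _)
        have h1 := hM f hf hf2 e he a ha y hy b hb
        have h2 := hM f hf hf2 e he b hb y hy a ha
        have n1 := hne a (by rw [ends_cons]; exact Multiset.mem_add.2 (Or.inl ha))
        have n2 := hne b (by rw [ends_cons]; exact Multiset.mem_add.2 (Or.inl hb))
        simp only [below, h, Multiset.insert_eq_cons, Multiset.countP_cons, ← Multiset.cons_zero,
          Multiset.countP_zero]
        split_ifs <;> omega
    rw [ends_cons, below_add, Nat.add_mod, h1,
      ih (fun e he => hS e (Multiset.mem_cons_of_mem he))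
        (fun e he => hc e (Multiset.mem_cons_of_mem he))
        fun x hx => hne x (by rw [ends_cons]; exact Multiset.mem_add.2 (Or.inr hx))]

theorem exists_split {α : Type*} [DecidableEq α] {S T A B : Multiset α} (h : S + T ≤ A + B) :
    ∃ S₁ S₂ T₁ T₂, S = S₁ + S₂ ∧ T = T₁ + T₂ ∧ S₁ + T₁ ≤ A ∧ S₂ + T₂ ≤ B := by
  refine ⟨S ∩ A, S - A, T ∩ (A - S), T - (A - S), ?_, ?_, ?_, ?_⟩
  · ext x; simp only [Multiset.count_add, Multiset.count_inter, Multiset.count_sub]; omega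
  · ext x; simp only [Multiset.count_add, Multiset.count_inter, Multiset.count_sub]; omega
  · rw [Multiset.le_iff_count]; intro x
    simp only [Multiset.count_add, Multiset.count_inter, Multiset.count_sub]; omega
  · rw [Multiset.le_iff_count] at h ⊢; intro x
    have := h x
    simp only [Multiset.count_add, Multiset.count_sub] at this ⊢; omega

theorem even_card_ends {V : Type*} {S : Multiset (Strand V)} (h : ∀ e ∈ S, IsCurve e) :
    Multiset.card (ends S) % 2 = 0 := by
  induction S using Multiset.induction_on with
  | empty => simp [ends]
  | cons e S ih =>
    have h1 := ih fun e he => h e (Multiset.mem_cons_of_mem he)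
    have h2 := h e (Multiset.mem_cons_self _ _)
    rw [ends_cons, Multiset.card_add]
    unfold IsCurve at h2
    omega

theorem countP_add_countP {α : Type*} (p q : α → Prop) [DecidablePred p] [DecidablePred q]
    {A : Multiset α} (h : ∀ x ∈ A, (q x ↔ ¬ p x)) :
    A.countP p + A.countP q = Multiset.card A := by
  rw [Multiset.card_eq_countP_add_countP p, Multiset.countP_congr (s := A) rfl fun x hx => propext (h x hx)]

theorem exists_concat_groups {d d' : Multiset (Strand (Node k))} (hd : IsDiagram d)
    (hd' : IsDiagram d') {p q : Strand (Fin 3 × Fin k)}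
    (hp : p ∈ fuseList (level k 1) (stack d d')) (hq : q ∈ fuseList (level k 1) (stack d d'))
    (hpq : p ≠ q) :
    ∃ S₁ S₂ T₁ T₂ : Multiset (Strand (Fin 3 × Fin k)),
      p = groupStrand (level k 1) (S₁ + S₂) ∧ q = groupStrand (level k 1) (T₁ + T₂) ∧
      S₁ + T₁ ≤ relabel (place 0 1) d ∧ S₂ + T₂ ≤ relabel (place 1 2) d' ∧
      (∀ i : Fin k, (ends (S₁ + S₂)).count (1, i) ≠ 1) ∧
      (∀ i : Fin k, (ends (S₁ + S₂)).count (1, i) ≠ 0 → (ends (T₁ + T₂)).count (1, i) = 0) ∧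
      (∀ g : Fin 3 × Fin k → ℕ, (∀ e ∈ T₁ + T₂, ∀ x ∈ e.1, ∀ y ∈ e.1, g x = g y) →
        ∀ x ∈ ends (T₁ + T₂), ∀ y ∈ ends (T₁ + T₂), g x = g y) ∧
      (∀ e ∈ T₁ + T₂, e.1 = 0 → T₁ + T₂ = {e}) := by
  obtain ⟨F, h1, h2, h3, h4, h5⟩ := exists_groups (level k (1 : Fin 3)) (nodup_level _) (stack d d')
  rw [h2] at hp hq
  obtain ⟨S, hS, rfl⟩ := Multiset.mem_map.1 hp
  obtain ⟨T, hT, rfl⟩ := Multiset.mem_map.1 hq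
  have hne : T ≠ S := fun h => hpq (by rw [h])
  obtain ⟨F', rfl⟩ := Multiset.exists_cons_of_mem hS
  obtain ⟨F'', rfl⟩ := Multiset.exists_cons_of_mem ((Multiset.mem_cons.1 hT).resolve_left hne)
  have hle : S + T ≤ stack d d' := by
    rw [← h1, Multiset.sum_cons, Multiset.sum_cons, ← add_assoc]
    exact Multiset.le_add_right _ _
  have hcle : ∀ x, (ends S).count x + (ends T).count x ≤ (ends (stack d d')).count x := by
    intro x
    rw [← h1, Multiset.sum_cons, Multiset.sum_cons, ends_add, ends_add, Multiset.count_add,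
      Multiset.count_add]
    omega
  obtain ⟨S₁, S₂, T₁, T₂, rfl, rfl, hle₁, hle₂⟩ := exists_split hle
  have hc : ∀ i : Fin k, (ends (stack d d')).count ((1 : Fin 3), i) = 2 := fun i => by
    rw [count_stack hd.2 hd'.2]; simp
  refine ⟨S₁, S₂, T₁, T₂, rfl, rfl, hle₁, hle₂, fun i h => ?_, fun i h => ?_, h4 _ hT, h5 _ hT⟩
  · have := h3 (1, i) (mem_level.2 rfl) _ hS
    rw [hc, h] at this
    omega
  · have h6 := h3 (1, i) (mem_level.2 rfl) _ hS
    have h7 := hcle (1, i)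
    rw [hc] at h6 h7
    omega

theorem concat_parity {d d' : Multiset (Strand (Node k))} (hd : IsDiagram d)
    (hd' : IsDiagram d') (hP : Planar nodePos d) (hP' : Planar nodePos d')
    {p q : Strand (Fin 3 × Fin k)} (hp : p ∈ fuseList (level k 1) (stack d d'))
    (hq : q ∈ fuseList (level k 1) (stack d d')) (hpq : p ≠ q) :
    (∀ y ∈ q.1, ∀ z ∈ q.1, below (boxPos 0) p.1 y % 2 = below (boxPos 0) p.1 z % 2) ∧
      (LeftExposed nodePos d → LeftExposed nodePos d' → q.2 ≠ 0 →
        ∀ y ∈ q.1, below (boxPos 0) p.1 y % 2 = 0) := by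
  obtain ⟨S₁, S₂, T₁, T₂, rfl, rfl, hle₁, hle₂, hS1, hST, hg, hT0⟩ :=
    exists_concat_groups hd hd' hp hq hpq
  set M₁ := relabel (place (0 : Fin 3) 1) d with hM₁
  set M₂ := relabel (place (1 : Fin 3) 2) d' with hM₂
  have hi₁ : Function.Injective (place 0 1 : Node k → Fin 3 × Fin k) :=
    place_injective (by decide)
  have hi₂ : Function.Injective (place 1 2 : Node k → Fin 3 × Fin k) :=
    place_injective (by decide)
  have hPM₁ : Planar (boxPos 0) M₁ := (planar_relabel (boxPos_place (by decide)) d).2 hP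
  have hPM₂ : Planar (boxPos 1) M₂ := (planar_relabel (boxPos_place (by decide)) d').2 hP'
  have hS₁M : ∀ e ∈ S₁, e ∈ M₁ := fun e he =>
    Multiset.mem_of_le hle₁ (Multiset.mem_add.2 (Or.inl he))
  have hT₁M : ∀ e ∈ T₁, e ∈ M₁ := fun e he =>
    Multiset.mem_of_le hle₁ (Multiset.mem_add.2 (Or.inr he))
  have hS₂M : ∀ e ∈ S₂, e ∈ M₂ := fun e he =>
    Multiset.mem_of_le hle₂ (Multiset.mem_add.2 (Or.inl he))
  have hT₂M : ∀ e ∈ T₂, e ∈ M₂ := fun e he =>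
    Multiset.mem_of_le hle₂ (Multiset.mem_add.2 (Or.inr he))
  have hcM₁ : ∀ e ∈ M₁, IsCurve e := isCurve_relabel hd.1
  have hcM₂ : ∀ e ∈ M₂, IsCurve e := isCurve_relabel hd'.1
  have hcS₁ : ∀ e ∈ S₁, IsCurve e := fun e he => hcM₁ e (hS₁M e he)
  have hcS₂ : ∀ e ∈ S₂, IsCurve e := fun e he => hcM₂ e (hS₂M e he)
  have hlev₁ : ∀ x ∈ ends M₁, x.1 = 0 ∨ x.1 = 1 := fun x hx => mem_ends_place hx
  have hlev₂ : ∀ x ∈ ends M₂, x.1 = 1 ∨ x.1 = 2 := fun x hx => mem_ends_place hx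
  have hsub : ∀ {A B : Multiset (Strand (Fin 3 × Fin k))}, (∀ e ∈ A, e ∈ B) →
      ∀ x ∈ ends A, x ∈ ends B := fun h x hx => by
    obtain ⟨e, he, hx⟩ := mem_ends.1 hx
    exact mem_ends.2 ⟨e, h e he, hx⟩
  have hone₁ : ∀ x, (ends M₁).count x ≤ 1 := by
    intro x
    by_cases hx : x ∈ ends M₁
    · rw [hM₁, ends_relabel] at hx ⊢
      obtain ⟨v, _, rfl⟩ := Multiset.mem_map.1 hx
      rw [Multiset.count_map_eq_count' _ _ hi₁, hd.2]
    · rw [Multiset.count_eq_zero_of_notMem hx]; exact Nat.zero_le 1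
  have hone₂ : ∀ x, (ends M₂).count x ≤ 1 := by
    intro x
    by_cases hx : x ∈ ends M₂
    · rw [hM₂, ends_relabel] at hx ⊢
      obtain ⟨v, _, rfl⟩ := Multiset.mem_map.1 hx
      rw [Multiset.count_map_eq_count' _ _ hi₂, hd'.2]
    · rw [Multiset.count_eq_zero_of_notMem hx]; exact Nat.zero_le 1
  have hcount : ∀ {A B : Multiset (Strand (Fin 3 × Fin k))}, A ≤ B → ∀ x,
      (ends A).count x ≤ (ends B).count x := by
    intro A B h x
    obtain ⟨C, rfl⟩ := Multiset.le_iff_exists_add.1 h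
    rw [ends_add, Multiset.count_add]
    exact Nat.le_add_right _ _
  have hST₁ : ∀ x, (ends S₁).count x + (ends T₁).count x ≤ 1 := fun x => by
    have := (hcount hle₁ x).trans (hone₁ x)
    rwa [ends_add, Multiset.count_add] at this
  have hST₂ : ∀ x, (ends S₂).count x + (ends T₂).count x ≤ 1 := fun x => by
    have := (hcount hle₂ x).trans (hone₂ x)
    rwa [ends_add, Multiset.count_add] at this
  -- the two sides of a cut through the middle level agree on `S`
  have hmid : (ends S₁).filter (fun x => x.1 = 1) = (ends S₂).filter (fun x => x.1 = 1) := by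
    ext ⟨l, i⟩
    rw [Multiset.count_filter, Multiset.count_filter]
    split_ifs with h
    · simp only at h
      subst h
      have h1 := hST₁ (1, i)
      have h2 := hST₂ (1, i)
      have h3 := hS1 i
      rw [ends_add, Multiset.count_add] at h3
      omega
    · rfl
  have hcS : ∀ x ∈ ends (T₁ + T₂), x.1 = 1 → x ∉ ends S₁ ∧ x ∉ ends S₂ := by
    rintro ⟨l, i⟩ hx h
    simp only at h
    subst h
    have h1 := Multiset.one_le_count_iff_mem.2 hx
    have h2 := hST i
    rw [ends_add, Multiset.count_add] at h2
    rw [← Multiset.count_eq_zero, ← Multiset.count_eq_zero]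
    omega
  have hlt : ∀ i : Fin k, (i : ℕ) < k := fun i => i.2
  -- positions in a box are distinct
  have hpos : ∀ (s : Fin 3) (x y : Fin 3 × Fin k), boxPos s x = boxPos s y →
      (x.1 = s ↔ y.1 = s) ∧ x.2 = y.2 := by
    intro s x y h
    have h1 := hlt x.2
    have h2 := hlt y.2
    rw [Fin.ext_iff]
    unfold boxPos at h
    split_ifs at h with h3 h4 h4 <;> simp [h3, h4] <;> omega
  have hposne₁ : ∀ x ∈ ends S₁, ∀ y ∈ ends T₁, boxPos 0 x ≠ boxPos 0 y := by
    intro x hx y hy h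
    obtain ⟨h1, h2⟩ := hpos 0 x y h
    have h3 := hlev₁ x (hsub hS₁M x hx)
    have h4 := hlev₁ y (hsub hT₁M y hy)
    have h5 : x = y := by
      refine Prod.ext ?_ h2
      rcases h3 with h3 | h3 <;> rcases h4 with h4 | h4 <;> simp [h3, h4] at h1 ⊢
    subst h5
    have h6 := hST₁ x
    have h7 := Multiset.one_le_count_iff_mem.2 hx
    have h8 := Multiset.one_le_count_iff_mem.2 hy
    omega
  have hposne₂ : ∀ x ∈ ends S₂, ∀ y ∈ ends T₂, boxPos 1 x ≠ boxPos 1 y := by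
    intro x hx y hy h
    obtain ⟨h1, h2⟩ := hpos 1 x y h
    have h3 := hlev₂ x (hsub hS₂M x hx)
    have h4 := hlev₂ y (hsub hT₂M y hy)
    have h5 : x = y := by
      refine Prod.ext ?_ h2
      rcases h3 with h3 | h3 <;> rcases h4 with h4 | h4 <;> simp [h3, h4] at h1 ⊢
    subst h5
    have h6 := hST₂ x
    have h7 := Multiset.one_le_count_iff_mem.2 hx
    have h8 := Multiset.one_le_count_iff_mem.2 hy
    omega
  -- the parity function that is constant along `T`
  have hlink : ∀ y ∈ ends (T₁ + T₂), y.1 = 1 →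
      below (boxPos 0) (ends S₁) y % 2 = below (boxPos 1) (ends S₂) y % 2 := by
    intro y hy hy1
    obtain ⟨hn1, hn2⟩ := hcS y hy hy1
    have h1 : below (boxPos 1) (ends S₂) y =
        (ends S₁).countP fun x => x.1 = 1 ∧ x.2 < y.2 := by
      have e1 : (ends S₁).countP (fun x => x.1 = 1 ∧ x.2 < y.2) =
          ((ends S₁).filter fun x => x.1 = 1).countP fun x => x.2 < y.2 := by
        rw [Multiset.countP_filter]
        exact Multiset.countP_congr rfl fun x _ => by rw [and_comm]
      rw [e1, hmid, Multiset.countP_filter]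
      refine Multiset.countP_congr rfl fun x hx => propext ?_
      have h2 := hlt x.2
      have h3 := hlt y.2
      rw [Fin.lt_def]
      rcases hlev₂ x (hsub hS₂M x hx) with h | h
      · simp [boxPos, h, hy1]
      · simp [boxPos, h, hy1]; omega
    rw [h1]
    have h2 : below (boxPos 0) (ends S₁) y + (ends S₁).countP (fun x => x.1 = 1 ∧ x.2 < y.2)
        = Multiset.card (ends S₁) := by
      refine countP_add_countP _ _ fun x hx => ?_
      have h2 := hlt x.2
      have h3 := hlt y.2
      have h4 : x.1 = 1 → (x.2 : ℕ) ≠ y.2 := fun h h' =>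
        hn1 ((Prod.ext (h.trans hy1.symm) (Fin.ext h') : x = y) ▸ hx)
      rw [Fin.lt_def]
      rcases hlev₁ x (hsub hS₁M x hx) with h | h
      · simp [boxPos, h, hy1]; omega
      · have h5 := h4 h
        simp [boxPos, h, hy1]; omega
    have h3 := even_card_ends hcS₁
    omega
  set g : Fin 3 × Fin k → ℕ := fun y =>
    if y.1 = 0 then below (boxPos 0) (ends S₁) y % 2 else below (boxPos 1) (ends S₂) y % 2 with hgdef
  have hg₁ : ∀ y ∈ ends T₁, g y = below (boxPos 0) (ends S₁) y % 2 := by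
    intro y hy
    rcases hlev₁ y (hsub hT₁M y hy) with h | h
    · simp [hgdef, h]
    · rw [hlink y (by rw [ends_add]; exact Multiset.mem_add.2 (Or.inl hy)) h]
      simp [hgdef, h]
  have hg₂ : ∀ y ∈ ends T₂, g y = below (boxPos 1) (ends S₂) y % 2 := by
    intro y hy
    rcases hlev₂ y (hsub hT₂M y hy) with h | h
    · simp [hgdef, h]
    · simp [hgdef, h]
  have hconst : ∀ x ∈ ends (T₁ + T₂), ∀ y ∈ ends (T₁ + T₂), g x = g y := by
    refine hg g fun e he x hx y hy => ?_
    rcases Multiset.mem_add.1 he with he | he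
    · have hx' := mem_ends.2 ⟨e, he, hx⟩
      have hy' := mem_ends.2 ⟨e, he, hy⟩
      rw [hg₁ x hx', hg₁ y hy']
      exact below_ends hPM₁ (hT₁M e he) hx hy hS₁M hcS₁ fun z hz =>
        ⟨hposne₁ z hz x hx', hposne₁ z hz y hy'⟩
    · have hx' := mem_ends.2 ⟨e, he, hx⟩
      have hy' := mem_ends.2 ⟨e, he, hy⟩
      rw [hg₂ x hx', hg₂ y hy']
      exact below_ends hPM₂ (hT₂M e he) hx hy hS₂M hcS₂ fun z hz =>
        ⟨hposne₂ z hz x hx', hposne₂ z hz y hy'⟩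
  have hgs : ∀ S, (groupStrand (level k (1 : Fin 3)) S).1 = (ends S).filter fun x => x.1 ≠ 1 :=
    fun S => groupStrand_fst _ S _ fun x => not_congr mem_level
  have hout : ∀ y ∈ ends (T₁ + T₂), y.1 ≠ 1 →
      below (boxPos 0) (groupStrand (level k (1 : Fin 3)) (S₁ + S₂)).1 y % 2 = g y := by
    intro y hy hy1
    rw [hgs]
    have h3 := hlt y.2
    rw [ends_add, Multiset.filter_add, below_add, below, below, Multiset.countP_filter,
      Multiset.countP_filter]
    by_cases hy0 : y.1 = 0
    · have e1 : (ends S₁).countP (fun x => boxPos 0 x < boxPos 0 y ∧ x.1 ≠ 1) =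
          below (boxPos 0) (ends S₁) y := by
        refine Multiset.countP_congr rfl fun x hx => propext ?_
        have h2 := hlt x.2
        rcases hlev₁ x (hsub hS₁M x hx) with h | h
        · simp [boxPos, h, hy0]
        · simp [boxPos, h, hy0]; omega
      have e2 : (ends S₂).countP (fun x => boxPos 0 x < boxPos 0 y ∧ x.1 ≠ 1) =
          0 := by
        refine Multiset.countP_eq_zero.2 fun x hx => ?_
        have h2 := hlt x.2
        rcases hlev₂ x (hsub hS₂M x hx) with h | h
        · simp [h]
        · simp [boxPos, h, hy0]; omega
      rw [e1, e2, add_zero, hgdef]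
      simp [hy0]
    · have hy2 : y.1 = 2 := by
        have : ∀ l : Fin 3, l ≠ 1 → l ≠ 0 → l = 2 := by decide
        exact this _ hy1 hy0
      have e1 : (ends S₁).countP (fun x => boxPos 0 x < boxPos 0 y ∧ x.1 ≠ 1) +
          (ends S₁).countP (fun x => x.1 = 1) = Multiset.card (ends S₁) := by
        refine countP_add_countP _ _ fun x hx => ?_
        have h2 := hlt x.2
        rcases hlev₁ x (hsub hS₁M x hx) with h | h
        · simp [boxPos, h, hy2]; omega
        · simp [h]
      have e2 : (ends S₂).countP (fun x => boxPos 0 x < boxPos 0 y ∧ x.1 ≠ 1) +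
          (ends S₂).countP (fun x => x.1 = 1) = below (boxPos 1) (ends S₂) y := by
        rw [below, Multiset.countP_eq_countP_filter_add (ends S₂)
          (fun x => boxPos 1 x < boxPos 1 y) (fun x => ¬ x.1 = 1), Multiset.countP_filter,
          Multiset.countP_filter]
        congr 1
        · refine Multiset.countP_congr rfl fun x hx => propext ?_
          rcases hlev₂ x (hsub hS₂M x hx) with h | h
          · simp [h]
          · simp [boxPos, h, hy2]
        · refine Multiset.countP_congr rfl fun x hx => propext ?_
          have h2 := hlt x.2
          rcases hlev₂ x (hsub hS₂M x hx) with h | h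
          · simp [boxPos, h, hy2]; omega
          · simp [h]
      have e3 : (ends S₁).countP (fun x => x.1 = 1) = (ends S₂).countP (fun x => x.1 = 1) := by
        rw [Multiset.countP_eq_card_filter, hmid, Multiset.countP_eq_card_filter]
      have e4 := even_card_ends hcS₁
      have e5 : g y = below (boxPos 1) (ends S₂) y % 2 := by simp [hgdef, hy0]
      omega
  have hmemq : ∀ y ∈ (groupStrand (level k (1 : Fin 3)) (T₁ + T₂)).1,
      y ∈ ends (T₁ + T₂) ∧ y.1 ≠ 1 := by
    intro y hy
    rw [hgs] at hy
    exact Multiset.mem_filter.1 hy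
  refine ⟨fun y hy z hz => ?_, fun hE hE' hq2 y hy => ?_⟩
  · obtain ⟨hy, hy1⟩ := hmemq y hy
    obtain ⟨hz, hz1⟩ := hmemq z hz
    exact (hout y hy hy1).trans ((hconst y hy z hz).trans (hout z hz hz1).symm)
  · obtain ⟨hy, hy1⟩ := hmemq y hy
    refine (hout y hy hy1).trans ?_
    have hEM₁ : LeftExposed (boxPos 0) M₁ :=
      (leftExposed_relabel (boxPos_place (by decide)) d).2 hE
    have hEM₂ : LeftExposed (boxPos 1) M₂ :=
      (leftExposed_relabel (boxPos_place (by decide)) d').2 hE'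
    have hex : ∃ f ∈ T₁ + T₂, f.2 ≠ 0 := by
      by_contra hcon
      push Not at hcon
      refine hq2 ?_
      change (T₁ + T₂).sum.2 = 0
      have : ∀ A : Multiset (Strand (Fin 3 × Fin k)), (∀ f ∈ A, f.2 = 0) → A.sum.2 = 0 := by
        intro A
        induction A using Multiset.induction_on with
        | empty => exact fun _ => rfl
        | cons e A ih =>
          intro h
          rw [Multiset.sum_cons, Prod.snd_add, h e (Multiset.mem_cons_self _ _),
            ih fun f hf => h f (Multiset.mem_cons_of_mem hf)]
      exact this _ hcon
    obtain ⟨f, hf, hf2⟩ := hex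
    have hf0 : f.1 ≠ 0 := by
      intro h0
      rw [hT0 f hf h0] at hy
      simp [ends, h0] at hy
    obtain ⟨x, hx⟩ := Multiset.exists_mem_of_ne_zero hf0
    rw [hconst y hy x (mem_ends.2 ⟨f, hf, hx⟩)]
    rcases Multiset.mem_add.1 hf with hf | hf
    · have hx' := mem_ends.2 ⟨f, hf, hx⟩
      rw [hg₁ x hx']
      exact below_ends_exposed hEM₁ (hT₁M f hf) hf2 hx hS₁M hcS₁ fun z hz => hposne₁ z hz x hx'
    · have hx' := mem_ends.2 ⟨f, hf, hx⟩
      rw [hg₂ x hx']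
      exact below_ends_exposed hEM₂ (hT₂M f hf) hf2 hx hS₂M hcS₂ fun z hz => hposne₂ z hz x hx'

theorem isDiagram_concat {d d' : Multiset (Strand (Node k))} (hd : IsDiagram d)
    (hd' : IsDiagram d') : IsDiagram (concat d d') :=
  ⟨isCurve_concat hd.2 hd'.2 hd.1 hd'.1, count_concat hd.2 hd'.2⟩

theorem planar_concat {d d' : Multiset (Strand (Node k))} (hd : IsDiagram d)
    (hd' : IsDiagram d') (hP : Planar nodePos d) (hP' : Planar nodePos d') :
    Planar nodePos (concat d d') := by
  have hc := isCurve_relabel (f := (place 0 2 : Node k → Fin 3 × Fin k))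
    (isDiagram_concat hd hd').1
  rw [← planar_relabel (boxPos_place (k := k) (s := (0 : Fin 3)) (t := 2) (by decide))]
  rw [relabel_place_concat (m := (1 : Fin 3)) (by decide) (by decide) (by decide)] at hc ⊢
  intro p hp q hq a ha b hb c hc' x hx ⟨h1, h2, h3⟩
  rcases exists_pair (hc p hp) with h | ⟨u, v, h⟩
  · simp [h] at ha
  rw [h] at ha hc'
  simp only [Multiset.insert_eq_cons, Multiset.mem_cons, Multiset.mem_singleton] at ha hc'
  by_cases hpq : p = q
  · rw [← hpq, h] at hb hx
    simp only [Multiset.insert_eq_cons, Multiset.mem_cons, Multiset.mem_singleton] at hb hx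
    rcases ha with rfl | rfl <;> rcases hb with rfl | rfl <;> rcases hc' with rfl | rfl <;> omega
  · have := (concat_parity hd hd' hP hP' hp hq hpq).1 b hb x hx
    simp only [below, h, Multiset.insert_eq_cons, Multiset.countP_cons, ← Multiset.cons_zero,
      Multiset.countP_zero] at this
    rcases ha with rfl | rfl <;> rcases hc' with rfl | rfl <;> split_ifs at this <;> omega

theorem leftExposed_concat {d d' : Multiset (Strand (Node k))} (hd : IsDiagram d)
    (hd' : IsDiagram d') (hP : Planar nodePos d) (hP' : Planar nodePos d')
    (hE : LeftExposed nodePos d) (hE' : LeftExposed nodePos d') :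
    LeftExposed nodePos (concat d d') := by
  have hc := isCurve_relabel (f := (place 0 2 : Node k → Fin 3 × Fin k))
    (isDiagram_concat hd hd').1
  rw [← leftExposed_relabel (boxPos_place (k := k) (s := (0 : Fin 3)) (t := 2) (by decide))]
  rw [relabel_place_concat (m := (1 : Fin 3)) (by decide) (by decide) (by decide)] at hc ⊢
  intro q hq hq2 p hp a ha b hb c hc' ⟨h1, h2⟩
  rcases exists_pair (hc p hp) with h | ⟨u, v, h⟩
  · simp [h] at ha
  rw [h] at ha hc'
  simp only [Multiset.insert_eq_cons, Multiset.mem_cons, Multiset.mem_singleton] at ha hc'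
  by_cases hpq : p = q
  · rw [← hpq, h] at hb
    simp only [Multiset.insert_eq_cons, Multiset.mem_cons, Multiset.mem_singleton] at hb
    rcases ha with rfl | rfl <;> rcases hb with rfl | rfl <;> rcases hc' with rfl | rfl <;> omega
  · have := (concat_parity hd hd' hP hP' hp hq hpq).2 hE hE' hq2 b hb
    simp only [below, h, Multiset.insert_eq_cons, Multiset.countP_cons, ← Multiset.cons_zero,
      Multiset.countP_zero] at this
    rcases ha with rfl | rfl <;> rcases hc' with rfl | rfl <;> split_ifs at this <;> omega

theorem aValue_eq_zero {d : Multiset (Strand (Node k))} :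
    aValue d = 0 ↔ ∀ e ∈ d, e.1 ≠ 0 → ∃ v ∈ e.1, v.isLeft = false := by
  rw [aValue, Multiset.card_eq_zero, Multiset.filter_eq_nil]
  simp

theorem countP_ends_le (b : Bool) (S : Multiset (Strand (Node k))) (hc : ∀ e ∈ S, IsCurve e)
    (h : ∀ e ∈ S, e.1 ≠ 0 → ∃ v ∈ e.1, v.isLeft = !b) :
    (ends S).countP (fun v => v.isLeft = b) ≤ (ends S).countP (fun v => v.isLeft = !b) ∧
      ((∃ e ∈ S, e.1 ≠ 0 ∧ ∀ v ∈ e.1, v.isLeft = !b) →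
        (ends S).countP (fun v => v.isLeft = b) < (ends S).countP (fun v => v.isLeft = !b)) := by
  induction S using Multiset.induction_on with
  | empty => simp [ends]
  | cons e S ih =>
    obtain ⟨h1, h2⟩ := ih (fun e he => hc e (Multiset.mem_cons_of_mem he))
      fun e he => h e (Multiset.mem_cons_of_mem he)
    have h3 := h e (Multiset.mem_cons_self _ _)
    have h4 : e.1.countP (fun v => v.isLeft = b) ≤ e.1.countP (fun v => v.isLeft = !b) ∧
        ((e.1 ≠ 0 ∧ ∀ v ∈ e.1, v.isLeft = !b) →
          e.1.countP (fun v => v.isLeft = b) < e.1.countP (fun v => v.isLeft = !b)) := by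
      rcases exists_pair (hc e (Multiset.mem_cons_self _ _)) with h0 | ⟨x, y, h0⟩
      · simp [h0]
      · rw [h0] at h3 ⊢
        have h5 := h3 (by simp)
        simp only [Multiset.insert_eq_cons, Multiset.mem_cons,
          exists_eq_or_imp, exists_eq_left, forall_eq_or_imp, forall_eq,
          Multiset.countP_cons, ← Multiset.cons_zero, Multiset.countP_zero, Multiset.notMem_zero,
          or_false] at h5 ⊢
        revert h5
        cases b <;> rcases x with x | x <;> rcases y with y | y <;> simp
    rw [ends_cons, Multiset.countP_add, Multiset.countP_add]
    refine ⟨by omega, ?_⟩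
    rintro ⟨f, hf, hf'⟩
    rcases Multiset.mem_cons.1 hf with rfl | hf
    · have := h4.2 hf'; omega
    · have := h2 ⟨f, hf, hf'⟩; omega

theorem ends_eq_univ {d : Multiset (Strand (Node k))} (hd : IsDiagram d) :
    ends d = (Finset.univ : Finset (Node k)).val := by
  ext v
  rw [hd.2, Multiset.count_univ]

theorem arcs_symm {d : Multiset (Strand (Node k))} (hd : IsDiagram d) (b : Bool)
    (h : ∀ e ∈ d, e.1 ≠ 0 → ∃ v ∈ e.1, v.isLeft = !b) :
    ∀ e ∈ d, e.1 ≠ 0 → ∃ v ∈ e.1, v.isLeft = b := by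
  by_contra hcon
  push Not at hcon
  obtain ⟨e, he, he0, h1⟩ := hcon
  have h2 := (countP_ends_le b d hd.1 h).2 ⟨e, he, he0, fun v hv => by
    have := h1 v hv
    revert this
    cases v.isLeft <;> cases b <;> decide⟩
  have key : ∀ c : Bool, (ends d).countP (fun v => v.isLeft = c) = k := by
    intro c
    rw [ends_eq_univ hd, ← Finset.univ_disjSum_univ, Finset.val_disjSum, Multiset.disjSum,
      Multiset.countP_add, Multiset.countP_map, Multiset.countP_map]
    cases c <;> simp
  rw [key, key] at h2
  exact lt_irrefl _ h2

theorem bare_concat {d d' : Multiset (Strand (Node k))} (hd : IsDiagram d) (hd' : IsDiagram d')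
    (h : aValue d = 0 → ∀ e ∈ d, e.2 = 0) (h' : aValue d' = 0 → ∀ e ∈ d', e.2 = 0)
    (ha : aValue (concat d d') = 0) : ∀ e ∈ concat d d', e.2 = 0 := by
  have hN := aValue_eq_zero.1 ha
  have hS := arcs_symm (isDiagram_concat hd hd') true hN
  have h1 : aValue d = 0 := by
    rw [aValue_eq_zero]
    by_contra hcon
    push Not at hcon
    obtain ⟨e, he, he0, h1⟩ := hcon
    have h2 : (e.1.map (place (0 : Fin 3) 1), e.2) ∈ fuseList (level k 1) (stack d d') := by
      refine mem_fuseList (Multiset.mem_add.2 (Or.inl (Multiset.mem_map_of_mem _ he))) ?_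
      intro x hx
      obtain ⟨v, hv, rfl⟩ := Multiset.mem_map.1 hx
      have := h1 v hv
      rw [mem_level]
      rcases v with i | i <;> simp [place] at this ⊢
    obtain ⟨x, hx, hx'⟩ := hN _ (Multiset.mem_map_of_mem _ h2) (by simpa using he0)
    simp only [Multiset.map_map, Multiset.mem_map] at hx
    obtain ⟨v, hv, rfl⟩ := hx
    have := h1 v hv
    rcases v with i | i <;> simp [place, unplace] at this hx'
  have h2 : aValue d' = 0 := by
    rw [aValue_eq_zero]
    refine arcs_symm hd' false ?_
    by_contra hcon
    push Not at hcon
    obtain ⟨e, he, he0, h1⟩ := hcon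
    have h2 : (e.1.map (place (1 : Fin 3) 2), e.2) ∈ fuseList (level k 1) (stack d d') := by
      refine mem_fuseList (Multiset.mem_add.2 (Or.inr (Multiset.mem_map_of_mem _ he))) ?_
      intro x hx
      obtain ⟨v, hv, rfl⟩ := Multiset.mem_map.1 hx
      have := h1 v hv
      rw [mem_level]
      rcases v with i | i <;> simp [place] at this ⊢
    obtain ⟨x, hx, hx'⟩ := hS _ (Multiset.mem_map_of_mem _ h2) (by simpa using he0)
    simp only [Multiset.map_map, Multiset.mem_map] at hx
    obtain ⟨v, hv, rfl⟩ := hx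
    have := h1 v hv
    rcases v with i | i <;> simp [place, unplace] at this hx'
  intro e he
  obtain ⟨F, hF, hF', -⟩ :=
    exists_groups (level k (1 : Fin 3)) (nodup_level _) (stack d d')
  rw [concat, hF'] at he
  obtain ⟨p, hp, rfl⟩ := Multiset.mem_map.1 he
  obtain ⟨S, hS, rfl⟩ := Multiset.mem_map.1 hp
  obtain ⟨F', rfl⟩ := Multiset.exists_cons_of_mem hS
  have hz : ∀ f ∈ S, f.2 = 0 := by
    intro f hf
    have hf' : f ∈ stack d d' := by
      rw [← hF, Multiset.sum_cons]
      exact Multiset.mem_add.2 (Or.inl hf)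
    rcases Multiset.mem_add.1 hf' with hf' | hf'
    · obtain ⟨f', hf₀, rfl⟩ := Multiset.mem_map.1 hf'
      exact h h1 f' hf₀
    · obtain ⟨f', hf₀, rfl⟩ := Multiset.mem_map.1 hf'
      exact h' h2 f' hf₀
  change S.sum.2 = 0
  clear hp hF hF' he hS
  induction S using Multiset.induction_on with
  | empty => rfl
  | cons f S ih =>
    rw [Multiset.sum_cons, Prod.snd_add, hz f (Multiset.mem_cons_self _ _),
      ih fun f hf => hz f (Multiset.mem_cons_of_mem hf)]

theorem ends_straight (l : List (Fin k)) :
    ends (straight l) = (l.map Sum.inl : List (Node k)) + (l.map Sum.inr : List (Node k)) := by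
  induction l with
  | nil => rfl
  | cons i l ih =>
    have : straight (i :: l) = (({Sum.inl i, Sum.inr i} : Multiset (Node k)), 0) ::ₘ straight l :=
      rfl
    rw [this, ends_cons, ih, List.map_cons, List.map_cons, ← Multiset.cons_coe,
      ← Multiset.cons_coe, ← Multiset.singleton_add, ← Multiset.singleton_add (Sum.inr i),
      Multiset.insert_eq_cons, ← Multiset.singleton_add]
    exact add_add_add_comm _ _ _ _

theorem mem_straight {l : List (Fin k)} {e : Strand (Node k)} :
    e ∈ straight l ↔ ∃ i ∈ l, (({Sum.inl i, Sum.inr i} : Multiset (Node k)), 0) = e := by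
  simp [straight]

theorem count_straight {l : List (Fin k)} (hl : l.Nodup) (i : Fin k) :
    (ends (straight l)).count (Sum.inl i) = (if i ∈ l then 1 else 0) ∧
      (ends (straight l)).count (Sum.inr i) = (if i ∈ l then 1 else 0) := by
  rw [ends_straight]
  have h1 : ((l.map Sum.inl : List (Node k)) : Multiset (Node k)).Nodup :=
    Multiset.coe_nodup.2 (hl.map Sum.inl_injective)
  have h2 : ((l.map Sum.inr : List (Node k)) : Multiset (Node k)).Nodup :=
    Multiset.coe_nodup.2 (hl.map Sum.inr_injective)
  simp only [Multiset.count_add, Multiset.count_eq_of_nodup h1, Multiset.count_eq_of_nodup h2]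
  simp

theorem isDiagram_id : IsDiagram (idStrands k) := by
  refine ⟨fun e he => ?_, ?_⟩
  · obtain ⟨i, _, rfl⟩ := mem_straight.1 he
    exact Or.inr rfl
  · rintro (i | i)
    · rw [idStrands, (count_straight (List.nodup_finRange k) i).1, if_pos (List.mem_finRange i)]
    · rw [idStrands, (count_straight (List.nodup_finRange k) i).2, if_pos (List.mem_finRange i)]

theorem planar_straight (l : List (Fin k)) : Planar nodePos (straight l) := by
  intro e he f hf a ha b hb c hc x hx
  obtain ⟨i, _, rfl⟩ := mem_straight.1 he
  obtain ⟨j, _, rfl⟩ := mem_straight.1 hf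
  have hi := i.2
  have hj := j.2
  simp only [Multiset.insert_eq_cons, Multiset.mem_cons, Multiset.mem_singleton] at ha hb hc hx
  rcases ha with rfl | rfl <;> rcases hb with rfl | rfl <;> rcases hc with rfl | rfl <;>
    rcases hx with rfl | rfl <;> simp only [nodePos, Sum.elim_inl, Sum.elim_inr] <;> omega

theorem isDiagram_simple {i j : Fin k} (hij : i ≠ j) (m : ℕ) :
    IsDiagram (simpleStrands i j m) := by
  refine ⟨fun e he => ?_, ?_⟩
  · rw [simpleStrands, Multiset.mem_cons, Multiset.mem_cons] at he
    rcases he with rfl | rfl | he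
    · exact Or.inr rfl
    · exact Or.inr rfl
    · obtain ⟨i, _, rfl⟩ := mem_straight.1 he
      exact Or.inr rfl
  · have hn : ((List.finRange k).filter fun l => l ≠ i ∧ l ≠ j).Nodup :=
      (List.nodup_finRange k).filter _
    rintro (l | l) <;>
    · simp only [simpleStrands, ends_cons, Multiset.count_add, (count_straight hn l).1,
        (count_straight hn l).2, Multiset.insert_eq_cons, Multiset.count_cons,
        Multiset.count_singleton, List.mem_filter, List.mem_finRange, true_and, Sum.inl.injEq,
        Sum.inr.injEq, decide_eq_true_eq, reduceCtorEq, if_false]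
      by_cases h1 : l = i <;> by_cases h2 : l = j
      · exact absurd (h1.symm.trans h2) hij
      · simp [h1, hij]
      · simp [h2, hij.symm]
      · simp [h1, h2]

theorem planar_simple {i j : Fin k} (hij : (j : ℕ) = i + 1) (m : ℕ) :
    Planar nodePos (simpleStrands i j m) := by
  intro e he f hf a ha b hb c hc x hx
  have hi := i.2
  have hj := j.2
  have hmem : ∀ {e : Strand (Node k)}, e ∈ simpleStrands i j m →
      (e.1 = {Sum.inl i, Sum.inl j} ∨ e.1 = {Sum.inr i, Sum.inr j} ∨
        ∃ l : Fin k, (l : ℕ) ≠ i ∧ (l : ℕ) ≠ j ∧ e.1 = {Sum.inl l, Sum.inr l}) := by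
    intro e he
    rw [simpleStrands, Multiset.mem_cons, Multiset.mem_cons] at he
    rcases he with rfl | rfl | he
    · exact Or.inl rfl
    · exact Or.inr (Or.inl rfl)
    · obtain ⟨l, hl, rfl⟩ := mem_straight.1 he
      simp only [List.mem_filter, List.mem_finRange, true_and, decide_eq_true_eq, ne_eq,
        Fin.ext_iff] at hl
      exact Or.inr (Or.inr ⟨l, hl.1, hl.2, rfl⟩)
  rcases hmem he with h1 | h1 | ⟨l, hl1, hl2, h1⟩ <;>
  rcases hmem hf with h2 | h2 | ⟨l', hl1', hl2', h2⟩ <;>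
  rw [h1] at ha hc <;> rw [h2] at hb hx <;>
  simp only [Multiset.insert_eq_cons, Multiset.mem_cons, Multiset.mem_singleton] at ha hb hc hx <;>
  rcases ha with rfl | rfl <;> rcases hb with rfl | rfl <;> rcases hc with rfl | rfl <;>
    rcases hx with rfl | rfl <;> simp only [nodePos, Sum.elim_inl, Sum.elim_inr] <;> omega

theorem leftExposed_simple {i j : Fin k} (hij : (j : ℕ) = i + 1) (m : ℕ) (hm : m = 0 ∨ (i : ℕ) = 0) :
    LeftExposed nodePos (simpleStrands i j m) := by
  intro e he he2 f hf a ha b hb c hc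
  have hi := i.2
  have hj := j.2
  rw [simpleStrands, Multiset.mem_cons, Multiset.mem_cons] at he hf
  have hb' : (i : ℕ) = 0 ∧ (b = Sum.inl i ∨ b = Sum.inl j ∨ b = Sum.inr i ∨ b = Sum.inr j) := by
    rcases he with rfl | rfl | he
    · simp only [Multiset.insert_eq_cons, Multiset.mem_cons, Multiset.mem_singleton] at hb
      exact ⟨hm.resolve_left he2, by tauto⟩
    · simp only [Multiset.insert_eq_cons, Multiset.mem_cons, Multiset.mem_singleton] at hb
      exact ⟨hm.resolve_left he2, by tauto⟩
    · obtain ⟨l, _, rfl⟩ := mem_straight.1 he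
      exact absurd rfl he2
  obtain ⟨hi0, hb'⟩ := hb'
  rcases hf with rfl | rfl | hf
  · simp only [Multiset.insert_eq_cons, Multiset.mem_cons, Multiset.mem_singleton] at ha hc
    rcases ha with rfl | rfl <;> rcases hc with rfl | rfl <;> rcases hb' with rfl | rfl | rfl | rfl <;>
      simp only [nodePos, Sum.elim_inl, Sum.elim_inr] <;> omega
  · simp only [Multiset.insert_eq_cons, Multiset.mem_cons, Multiset.mem_singleton] at ha hc
    rcases ha with rfl | rfl <;> rcases hc with rfl | rfl <;> rcases hb' with rfl | rfl | rfl | rfl <;>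
      simp only [nodePos, Sum.elim_inl, Sum.elim_inr] <;> omega
  · obtain ⟨l, hl, rfl⟩ := mem_straight.1 hf
    simp only [List.mem_filter, List.mem_finRange, true_and, decide_eq_true_eq, ne_eq,
      Fin.ext_iff] at hl
    have hl' := l.2
    simp only [Multiset.insert_eq_cons, Multiset.mem_cons, Multiset.mem_singleton] at ha hc
    rcases ha with rfl | rfl <;> rcases hc with rfl | rfl <;> rcases hb' with rfl | rfl | rfl | rfl <;>
      simp only [nodePos, Sum.elim_inl, Sum.elim_inr] <;> omega

end Concat

/-- L-decorated pseudo `k`-diagrams. -/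
@[ext]
structure LDiagram (k : ℕ) where
  /-- the curves -/
  strands : Multiset (Strand (Node k))
  isDiagram : IsDiagram strands
  planar : Planar nodePos strands
  /-- A diagram all of whose edges propagate carries no decorations. -/
  bare : aValue strands = 0 → ∀ e ∈ strands, e.2 = 0
  leftExposed : LeftExposed nodePos strands

/-- The product `d * d'` is concatenation with `d` on top of `d'`. -/
instance (k : ℕ) : Monoid (LDiagram k) where
  mul d d' :=
    { strands := concat d.strands d'.strands
      isDiagram := isDiagram_concat d.isDiagram d'.isDiagram
      planar := planar_concat d.isDiagram d'.isDiagram d.planar d'.planar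
      bare := bare_concat d.isDiagram d'.isDiagram d.bare d'.bare
      leftExposed := leftExposed_concat d.isDiagram d'.isDiagram d.planar d'.planar
        d.leftExposed d'.leftExposed }
  one :=
    { strands := idStrands k
      isDiagram := isDiagram_id
      planar := planar_straight _
      bare := fun _ e he => by
        obtain ⟨i, _, rfl⟩ := mem_straight.1 he
        rfl
      leftExposed := fun e he he2 => by
        obtain ⟨i, _, rfl⟩ := mem_straight.1 he
        exact absurd rfl he2 }
  mul_assoc a b c := LDiagram.ext (concat_assoc a.strands b.strands c.strands)
  one_mul d := LDiagram.ext (id_concat d.strands d.isDiagram.2)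
  mul_one d := LDiagram.ext (concat_id d.strands d.isDiagram.2)

/-- The diagram that joins the nodes `i` and `i + 1` (counted from `0`) in both faces by edges
with `m` decorations, with vertical edges elsewhere. Decorations are possible only for `i = 0`. -/
def simpleDiagram {n : ℕ} (i : ℕ) (hi : i + 1 < n) (m : ℕ) (hm : m = 0 ∨ i = 0) : LDiagram n where
  strands := simpleStrands ⟨i, by omega⟩ ⟨i + 1, hi⟩ m
  isDiagram := isDiagram_simple (by simp) m
  planar := planar_simple rfl m
  bare := fun h => by
    rw [aValue_eq_zero] at h
    obtain ⟨v, hv, hv'⟩ := h _ (Multiset.mem_cons_self _ _) (by simp)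
    simp only [Multiset.insert_eq_cons, Multiset.mem_cons, Multiset.mem_singleton] at hv
    rcases hv with rfl | rfl <;> simp at hv'
  leftExposed := leftExposed_simple rfl m hm

/-- The free `ℤ[δ]`-module on the L-decorated pseudo `k`-diagrams, with concatenation as the product;
the variable `X` of the polynomial ring is `δ`. -/
abbrev LDiagramAlgebra (k : ℕ) := MonoidAlgebra ℤ[X] (LDiagram k)

/-- The local relations, read as replacements of a diagram: an undecorated loop is replaced by `δ`;
two decorations on the same curve cancel; a curve loses a decoration in the presence of a
decorated loop. -/
inductive DiagramRel {k : ℕ} : LDiagram k → LDiagramAlgebra k → Prop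
  | loop (d d' : LDiagram k) (h : d.strands = (0, 0) ::ₘ d'.strands) :
      DiagramRel d ((X : ℤ[X]) • MonoidAlgebra.of ℤ[X] (LDiagram k) d')
  | cancel (d d' : LDiagram k) (e : Multiset (Node k)) (m : ℕ) (R : Multiset (Strand (Node k)))
      (h : d.strands = (e, m + 2) ::ₘ R) (h' : d'.strands = (e, m) ::ₘ R) :
      DiagramRel d (MonoidAlgebra.of ℤ[X] (LDiagram k) d')
  | absorb (d d' : LDiagram k) (e : Multiset (Node k)) (m : ℕ) (R : Multiset (Strand (Node k)))
      (h : d.strands = (0, 1) ::ₘ (e, m + 1) ::ₘ R) (h' : d'.strands = (0, 1) ::ₘ (e, m) ::ₘ R) :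
      DiagramRel d (MonoidAlgebra.of ℤ[X] (LDiagram k) d')

/-- The relations as relations between elements of the diagram algebra. -/
def AlgebraRel (k : ℕ) (x y : LDiagramAlgebra k) : Prop :=
  ∃ d : LDiagram k, x = MonoidAlgebra.of ℤ[X] (LDiagram k) d ∧ DiagramRel d y

/-- The quotient of the diagram algebra by the local relations. -/
abbrev HatAlgebra (k : ℕ) := RingQuot (AlgebraRel k)

/-- The image of a diagram in the quotient by the local relations. -/
noncomputable def diagramClass {k : ℕ} (d : LDiagram k) : HatAlgebra k :=
  RingQuot.mkAlgHom ℤ[X] (AlgebraRel k) (MonoidAlgebra.of ℤ[X] (LDiagram k) d)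

/-- The diagram algebra `DTL(D_n)`: the unital subalgebra generated by the simple diagrams
`d_1, …, d_{n-1}` (without decorations) and the decorated one, which joins the first two nodes in
both faces by edges with one decoration. -/
noncomputable def DTL (n : ℕ) : Subalgebra ℤ[X] (HatAlgebra n) :=
  Algebra.adjoin ℤ[X]
    {x | (∃ (i : ℕ) (hi : i + 1 < n), x = diagramClass (simpleDiagram i hi 0 (Or.inl rfl))) ∨
      ∃ h : 0 + 1 < n, x = diagramClass (simpleDiagram 0 h 1 (Or.inr rfl))}

/-- The relation that a decorated loop is zero: an element of `DTL(D_n)` that is represented by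
a diagram with a decorated loop is set to zero. -/
def LoopRel (n : ℕ) (x y : DTL n) : Prop :=
  y = 0 ∧ ∃ d : LDiagram n, ((0, 1) : Strand (Node n)) ∈ d.strands ∧ (x : HatAlgebra n) = diagramClass d

/-- The loop-free diagram algebra `LFD(D_n)`. -/
abbrev LFD (n : ℕ) := RingQuot (LoopRel n)

/-- No local relation applies. -/
def IsIrreducible {k : ℕ} (d : LDiagram k) : Prop := ∀ y, ¬ DiagramRel d y

/-- `D`-admissible diagrams of type II: irreducible, without loops, and with an even total number of
decorations. -/
structure IsTypeII {k : ℕ} (d : LDiagram k) : Prop where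
  irreducible : IsIrreducible d
  loopless : ∀ e ∈ d.strands, e.1 ≠ 0
  even : Even (d.strands.map Prod.snd).sum

end DecTL

/-! Three facts are combined: type II diagrams are linearly independent in LFD(D_n), they span it,
and each of them lies in the subalgebra generated by the simple diagrams.

Independence comes from a representation. Let a diagram act on the free module over reduced diagrams
(no loops, at most one decoration per edge): concatenate, replace each loop by δ or by 0 according
to the parity of its decorations, and count decorations on edges modulo two. The outcome of a
concatenation depends on each factor only through its reduced form and the value of its loops
(`reduce_loopValue_concat_right`, `reduce_loopValue_concat_left`), so associativity of concatenation
makes this an action. Relations (1) and (2) hold by design; in (3) both sides contain a decorated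
loop, hence act as zero. The action descends to LFD(D_n). Applied to the identity diagram, a type II
diagram returns its own basis vector, so the classes are independent, and in particular distinct.

For spanning, a product of generators is a single diagram with an even total number of decorations,
because concatenation preserves the total. Cancelling pairs keeps the total even. Then either a
decorated loop is present and the class vanishes, or the undecorated loops are taken out as powers
of δ and a type II diagram is left.

Membership in the subalgebra is an induction on the total horizontal length of the edges. A type II
diagram other than the identity has a cup {i, i + 1} in its north face. With a suitable second edge
{x, y} the cup is split off: up to cancelling two decorations, the diagram is the simple diagram at
i on top of the diagram in which the cup and {x, y} become {i, x} and {i + 1, y}. The edge must be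
chosen so that the new edges cross nothing, decorated edges stay exposed to the left wall, and the
total length drops. This choice is `IsArcSystem.exists_move`, and `concat_simple` computes the
product. Evenness is essential here too: it ensures that when the remaining diagram has only
propagating edges, it has no decorations (`bare_of_even`). -/

namespace DecTL

/-! ### Decorations modulo two and values of loops. -/

section Reduction

variable {V : Type*}

/-- Decorations modulo two. -/
def parity (M : Multiset (Strand V)) : Multiset (Strand V) := M.map fun e => (e.1, e.2 % 2)

theorem parity_add (M N : Multiset (Strand V)) : parity (M + N) = parity M + parity N := by
  simp [parity]

theorem parity_relabel {W : Type*} (f : V → W) (M : Multiset (Strand V)) :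
    parity (relabel f M) = relabel f (parity M) := by
  simp [parity, relabel]

theorem ends_parity (M : Multiset (Strand V)) : ends (parity M) = ends M := by
  simp [parity, ends]

theorem parity_parity (M : Multiset (Strand V)) : parity (parity M) = parity M := by
  simp [parity]

theorem sum_snd (M : Multiset (Strand V)) : M.sum.2 = (M.map Prod.snd).sum := by
  induction M using Multiset.induction_on with
  | empty => rfl
  | cons e M ih => simp [ih]

theorem sum_snd_parity (M : Multiset (Strand V)) : (parity M).sum.2 % 2 = M.sum.2 % 2 := by
  rw [sum_snd, sum_snd, Multiset.sum_nat_mod, Multiset.sum_nat_mod (M.map Prod.snd)]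
  simp [parity]

theorem filter_parity (p : Multiset V → Prop) [DecidablePred p] (M : Multiset (Strand V)) :
    (parity M).filter (fun e => p e.1) = parity (M.filter fun e => p e.1) := by
  rw [parity, Multiset.filter_map]
  rfl

/-- Which strands are joined depends only on their ends, and joining adds the numbers of
decorations; both are compatible with reduction modulo two. -/
theorem parity_fuse_parity [DecidableEq V] (v : V) (M : Multiset (Strand V)) :
    parity (fuse v (parity M)) = parity (fuse v M) := by
  rw [fuse, fuse, filter_parity (fun s => v ∈ s), filter_parity (fun s => v ∉ s), ← ends_eq,
    ends_parity, ← ends_eq]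
  simp only [parity, Multiset.map_cons, Multiset.map_map, Function.comp_def, Nat.mod_mod]
  congr 2
  exact sum_snd_parity _

theorem parity_fuseList_parity [DecidableEq V] (l : List V) (M : Multiset (Strand V)) :
    parity (fuseList l (parity M)) = parity (fuseList l M) := by
  induction l with
  | nil => exact parity_parity M
  | cons v l ih =>
    change parity (fuse v (fuseList l (parity M))) = parity (fuse v (fuseList l M))
    rw [← parity_fuse_parity, ih, parity_fuse_parity]

theorem sum_snd_fuse [DecidableEq V] (v : V) (M : Multiset (Strand V)) :
    (fuse v M).sum.2 = M.sum.2 := by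
  conv_rhs => rw [← Multiset.filter_add_not (fun e => v ∈ e.1) M]
  simp [fuse]

theorem sum_snd_fuseList [DecidableEq V] (l : List V) (M : Multiset (Strand V)) :
    (fuseList l M).sum.2 = M.sum.2 := by
  induction l with
  | nil => rfl
  | cons v l ih => exact (sum_snd_fuse v _).trans ih

/-- No decoration is lost or created when strands are joined. Consequently the diagrams with an even
total are closed under products, which is how evenness enters the spanning argument. -/
theorem sum_snd_concat {k : ℕ} (d d' : Multiset (Strand (Node k))) :
    (concat d d').sum.2 = d.sum.2 + d'.sum.2 := by
  simp only [concat, stack, sum_relabel, sum_snd_fuseList, Multiset.sum_add, Prod.snd_add]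

theorem relabel_loops {W : Type*} {f : V → W} {N : Multiset (Strand V)} (h : ∀ e ∈ N, e.1 = 0) :
    ∀ e ∈ relabel f N, e.1 = 0 := by
  intro e he
  obtain ⟨e', he', rfl⟩ := Multiset.mem_map.1 he
  simp [h e' he']

theorem notMem_ends_loops {N : Multiset (Strand V)} (h : ∀ e ∈ N, e.1 = 0) (v : V) :
    v ∉ ends N := by
  rw [mem_ends]
  rintro ⟨e, he, hv⟩
  simp [h e he] at hv

variable [DecidableEq V]

/-- Loops are removed and decorations are counted modulo two. -/
def reduce (M : Multiset (Strand V)) : Multiset (Strand V) := parity (M.filter fun e => e.1 ≠ 0)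

/-- The value of the loops of a diagram: `δ` for an even loop and `0` for an odd one. -/
noncomputable def loopValue (M : Multiset (Strand V)) : ℤ[X] :=
  (M.map fun e => if e.1 = 0 then (if e.2 % 2 = 0 then X else 0) else (1 : ℤ[X])).prod

theorem reduce_add (M N : Multiset (Strand V)) : reduce (M + N) = reduce M + reduce N := by
  simp [reduce, parity_add]

theorem loopValue_add (M N : Multiset (Strand V)) :
    loopValue (M + N) = loopValue M * loopValue N := by
  simp [loopValue]

theorem reduce_parity (M : Multiset (Strand V)) : reduce (parity M) = reduce M := by
  simp [reduce, parity, Multiset.filter_map]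

theorem loopValue_parity (M : Multiset (Strand V)) : loopValue (parity M) = loopValue M := by
  simp [loopValue, parity]

theorem loopValue_eq_one {M : Multiset (Strand V)} (h : ∀ e ∈ M, e.1 ≠ 0) : loopValue M = 1 := by
  refine Multiset.prod_eq_one fun x hx => ?_
  obtain ⟨e, he, rfl⟩ := Multiset.mem_map.1 hx
  rw [if_neg (h e he)]

theorem reduce_eq_zero {M : Multiset (Strand V)} (h : ∀ e ∈ M, e.1 = 0) : reduce M = 0 := by
  rw [reduce, Multiset.filter_eq_nil.2 fun e he => not_not.2 (h e he)]
  rfl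

theorem reduce_eq_self {M : Multiset (Strand V)} (h : ∀ e ∈ M, e.1 ≠ 0 ∧ e.2 < 2) :
    reduce M = M := by
  rw [reduce, Multiset.filter_eq_self.2 fun e he => (h e he).1, parity]
  conv_rhs => rw [← Multiset.map_id M]
  exact Multiset.map_congr rfl fun e he => Prod.ext rfl (Nat.mod_eq_of_lt (h e he).2)

theorem loopValue_eq_zero {M : Multiset (Strand V)} (h : (0, 1) ∈ M) : loopValue M = 0 := by
  refine Multiset.prod_eq_zero (Multiset.mem_map.2 ⟨(0, 1), h, ?_⟩)
  simp

theorem reduce_spec {M : Multiset (Strand V)} : ∀ e ∈ reduce M, e.1 ≠ 0 ∧ e.2 < 2 := by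
  intro e he
  obtain ⟨e', he', rfl⟩ := Multiset.mem_map.1 he
  exact ⟨(Multiset.mem_filter.1 he').2, Nat.mod_lt _ two_pos⟩

theorem loopValue_relabel_loops {W : Type*} [DecidableEq W] (f : V → W)
    (M : Multiset (Strand V)) : loopValue (relabel f M) = loopValue M := by
  simp [loopValue, relabel]

end Reduction

/-! ### Compatibility of concatenation with reduction. -/

section Concat

variable {k : ℕ}

theorem concat_parity_right (a d : Multiset (Strand (Node k))) :
    parity (concat a (parity d)) = parity (concat a d) := by
  rw [concat, concat, parity_relabel, parity_relabel, ← parity_fuseList_parity,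
    ← parity_fuseList_parity _ (stack a d)]
  simp only [stack, parity_add, parity_relabel, parity_parity]

theorem concat_parity_left (a d : Multiset (Strand (Node k))) :
    parity (concat (parity a) d) = parity (concat a d) := by
  rw [concat, concat, parity_relabel, parity_relabel, ← parity_fuseList_parity,
    ← parity_fuseList_parity _ (stack a d)]
  simp only [stack, parity_add, parity_relabel, parity_parity]

/-- A loop has no ends, so nothing is ever joined to it, and it passes through the concatenation
unchanged. -/
theorem concat_add_loops (a d : Multiset (Strand (Node k))) {N : Multiset (Strand (Node k))}
    (h : ∀ e ∈ N, e.1 = 0) :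
    concat a (d + N) = concat a d + relabel unplace (relabel (place (1 : Fin 3) 2) N) := by
  rw [concat, stack, relabel_add, ← add_assoc, fuseList_add_of_notMem, relabel_add]
  · rfl
  · exact fun v _ => notMem_ends_loops (relabel_loops h) v

theorem concat_loops_add (a d : Multiset (Strand (Node k))) {N : Multiset (Strand (Node k))}
    (h : ∀ e ∈ N, e.1 = 0) :
    concat (a + N) d = concat a d + relabel unplace (relabel (place (0 : Fin 3) 1) N) := by
  rw [concat, stack, relabel_add, add_right_comm, fuseList_add_of_notMem, relabel_add]
  · rfl
  · exact fun v _ => notMem_ends_loops (relabel_loops h) v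

/-- The loops of `d` survive concatenation as loops: they contribute the factor `loopValue d` and
nothing to the edges. On the remaining edges, passing to parities before or after concatenation
makes no difference to the reduced form or to the loop value. This gives well-definedness of the
action on reduced diagrams. -/
theorem reduce_loopValue_concat_right (a d : Multiset (Strand (Node k))) :
    reduce (concat a d) = reduce (concat a (reduce d)) ∧
      loopValue (concat a d) = loopValue d * loopValue (concat a (reduce d)) := by
  have hd : d = d.filter (fun e => e.1 ≠ 0) + d.filter (fun e => ¬ e.1 ≠ 0) :=
    (Multiset.filter_add_not _ _).symm
  have hN : ∀ e ∈ d.filter (fun e => ¬ e.1 ≠ 0), e.1 = 0 := fun e he =>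
    not_not.1 (Multiset.mem_filter.1 he).2
  have hE : loopValue (d.filter fun e => e.1 ≠ 0) = 1 :=
    loopValue_eq_one fun e he => (Multiset.mem_filter.1 he).2
  have h1 : reduce (concat a (reduce d)) = reduce (concat a (d.filter fun e => e.1 ≠ 0)) := by
    rw [← reduce_parity, reduce.eq_1 d, concat_parity_right, reduce_parity]
  have h2 : loopValue (concat a (reduce d)) =
      loopValue (concat a (d.filter fun e => e.1 ≠ 0)) := by
    rw [← loopValue_parity, reduce, concat_parity_right, loopValue_parity]
  rw [h1, h2]
  constructor
  · conv_lhs => rw [hd]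
    rw [concat_add_loops _ _ hN, reduce_add, reduce_eq_zero (relabel_loops (relabel_loops hN)),
      add_zero]
  · conv_lhs => rw [hd]
    conv_rhs => rw [hd]
    rw [concat_add_loops _ _ hN, loopValue_add, loopValue_add, hE, loopValue_relabel_loops,
      loopValue_relabel_loops, one_mul, mul_comm, ← hd]

theorem reduce_loopValue_concat_left (a d : Multiset (Strand (Node k))) :
    reduce (concat d a) = reduce (concat (reduce d) a) ∧
      loopValue (concat d a) = loopValue d * loopValue (concat (reduce d) a) := by
  have hd : d = d.filter (fun e => e.1 ≠ 0) + d.filter (fun e => ¬ e.1 ≠ 0) :=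
    (Multiset.filter_add_not _ _).symm
  have hN : ∀ e ∈ d.filter (fun e => ¬ e.1 ≠ 0), e.1 = 0 := fun e he =>
    not_not.1 (Multiset.mem_filter.1 he).2
  have hE : loopValue (d.filter fun e => e.1 ≠ 0) = 1 :=
    loopValue_eq_one fun e he => (Multiset.mem_filter.1 he).2
  have h1 : reduce (concat (reduce d) a) = reduce (concat (d.filter fun e => e.1 ≠ 0) a) := by
    rw [← reduce_parity, reduce.eq_1 d, concat_parity_left, reduce_parity]
  have h2 : loopValue (concat (reduce d) a) =
      loopValue (concat (d.filter fun e => e.1 ≠ 0) a) := by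
    rw [← loopValue_parity, reduce, concat_parity_left, loopValue_parity]
  rw [h1, h2]
  constructor
  · conv_lhs => rw [hd]
    rw [concat_loops_add _ _ hN, reduce_add, reduce_eq_zero (relabel_loops (relabel_loops hN)),
      add_zero]
  · conv_lhs => rw [hd]
    conv_rhs => rw [hd]
    rw [concat_loops_add _ _ hN, loopValue_add, loopValue_add, hE, loopValue_relabel_loops,
      loopValue_relabel_loops, one_mul, mul_comm, ← hd]

end Concat

/-! ### The representation on reduced diagrams and the coordinate map. -/

section Representation

variable {k : ℕ}

/-- A diagram with the same edges as `d`, where only curves decorated in `d` are decorated. -/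
def LDiagram.refine (d : LDiagram k) (M : Multiset (Strand (Node k)))
    (h₁ : ∀ e ∈ M, ∃ e' ∈ d.strands, e.1 = e'.1 ∧ (e.2 ≠ 0 → e'.2 ≠ 0))
    (h₂ : ∀ e' ∈ d.strands, e'.1 ≠ 0 → ∃ e ∈ M, e.1 = e'.1)
    (h₃ : ends M = ends d.strands) : LDiagram k where
  strands := M
  isDiagram := by
    refine ⟨fun e he => ?_, fun v => h₃ ▸ d.isDiagram.2 v⟩
    obtain ⟨e', he', h, -⟩ := h₁ e he
    rw [IsCurve, h]
    exact d.isDiagram.1 e' he'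
  planar := by
    intro e he f hf
    obtain ⟨e', he', h, -⟩ := h₁ e he
    obtain ⟨f', hf', h', -⟩ := h₁ f hf
    rw [h, h']
    exact d.planar e' he' f' hf'
  bare := by
    intro h e he
    obtain ⟨e', he', -, h'⟩ := h₁ e he
    by_contra h0
    refine h' h0 (d.bare (aValue_eq_zero.2 fun f hf hf0 => ?_) e' he')
    obtain ⟨g, hg, hgf⟩ := h₂ f hf hf0
    rw [← hgf] at hf0 ⊢
    exact aValue_eq_zero.1 h g hg hf0
  leftExposed := by
    intro e he he2 f hf
    obtain ⟨e', he', h, h0⟩ := h₁ e he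
    obtain ⟨f', hf', h', -⟩ := h₁ f hf
    rw [h, h']
    exact d.leftExposed e' he' (h0 he2) f' hf'

theorem ends_filter_ne_zero {V : Type*} [DecidableEq V] (M : Multiset (Strand V)) :
    ends (M.filter fun e => e.1 ≠ 0) = ends M := by
  rw [← ends_filter_add_not (fun e => e.1 ≠ 0) M]
  simp only [ends]
  rw [Multiset.sum_eq_zero (s := Multiset.map Prod.fst (M.filter fun e => ¬ e.1 ≠ 0)), add_zero]
  intro x hx
  obtain ⟨e, he, rfl⟩ := Multiset.mem_map.1 hx
  exact not_not.1 (Multiset.mem_filter.1 he).2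

/-- The reduced form of a diagram. -/
def LDiagram.reduced (d : LDiagram k) : LDiagram k :=
  d.refine (reduce d.strands)
    (by
      intro e he
      obtain ⟨e', he', rfl⟩ := Multiset.mem_map.1 he
      exact ⟨e', (Multiset.mem_filter.1 he').1, rfl, fun h h' => h (by simp [h'])⟩)
    (fun e he he0 => ⟨_, Multiset.mem_map_of_mem _ (Multiset.mem_filter.2 ⟨he, he0⟩), rfl⟩)
    (by rw [reduce, ends_parity, ends_filter_ne_zero])

/-- Diagrams without loops, all of whose edges have at most one decoration. -/
abbrev ReducedDiagram (k : ℕ) := {d : LDiagram k // ∀ e ∈ d.strands, e.1 ≠ 0 ∧ e.2 < 2}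

/-- The reduced form of `d`, with the value of the loops as coefficient. -/
noncomputable def normalForm (d : LDiagram k) : ReducedDiagram k →₀ ℤ[X] :=
  Finsupp.single ⟨d.reduced, reduce_spec⟩ (loopValue d.strands)

theorem normalForm_eq {d : LDiagram k} {e : LDiagram k} {c : ℤ[X]}
    (h₁ : reduce d.strands = reduce e.strands)
    (h₂ : loopValue d.strands = c * loopValue e.strands) :
    normalForm d = c • normalForm e := by
  rw [normalForm, normalForm, Finsupp.smul_single, smul_eq_mul, h₂]
  congr 1
  exact Subtype.ext (LDiagram.ext h₁)

theorem normalForm_mul_right (a d : LDiagram k) :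
    normalForm (a * d) = loopValue d.strands • normalForm (a * d.reduced) :=
  normalForm_eq (reduce_loopValue_concat_right a.strands d.strands).1
    (reduce_loopValue_concat_right a.strands d.strands).2

theorem normalForm_mul_left (a d : LDiagram k) :
    normalForm (d * a) = loopValue d.strands • normalForm (d.reduced * a) :=
  normalForm_eq (reduce_loopValue_concat_left a.strands d.strands).1
    (reduce_loopValue_concat_left a.strands d.strands).2

theorem normalForm_of_reduced (d : ReducedDiagram k) :
    normalForm d.1 = Finsupp.single d 1 := by
  rw [normalForm, loopValue_eq_one fun e he => (d.2 e he).1]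
  congr 1
  exact Subtype.ext (LDiagram.ext (reduce_eq_self d.2))

/-- Left multiplication by a diagram on the reduced diagrams. -/
noncomputable def leftMul (a : LDiagram k) : Module.End ℤ[X] (ReducedDiagram k →₀ ℤ[X]) :=
  Finsupp.linearCombination ℤ[X] fun d => normalForm (a * d.1)

theorem leftMul_single (a : LDiagram k) (d : ReducedDiagram k) :
    leftMul a (Finsupp.single d 1) = normalForm (a * d.1) := by
  simp [leftMul]

theorem leftMul_normalForm (a d : LDiagram k) : leftMul a (normalForm d) = normalForm (a * d) := by
  rw [normalForm_mul_right, normalForm, leftMul, Finsupp.linearCombination_single]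

/-- The operator of a diagram sees only its reduced form and, as a scalar, the value of its loops.
All relations of the algebra are checked through this criterion. -/
theorem leftMul_congr {a b : LDiagram k} {c : ℤ[X]}
    (h₁ : reduce a.strands = reduce b.strands)
    (h₂ : loopValue a.strands = c * loopValue b.strands) :
    leftMul a = c • leftMul b := by
  have hab : a.reduced = b.reduced := LDiagram.ext h₁
  refine Finsupp.lhom_ext' fun d => LinearMap.ext_ring ?_
  change leftMul a (Finsupp.single d 1) = c • leftMul b (Finsupp.single d 1)
  rw [leftMul_single, leftMul_single, normalForm_mul_left, normalForm_mul_left d.1 b, hab, h₂,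
    mul_smul]

theorem leftMul_eq_zero {a : LDiagram k} (ha : (0, 1) ∈ a.strands) : leftMul a = 0 := by
  rw [leftMul_congr (c := 0) (b := a) rfl (by rw [loopValue_eq_zero ha, zero_mul]), zero_smul]

/-- The representation of the diagram algebra on the reduced diagrams. -/
noncomputable def representation (k : ℕ) :
    LDiagramAlgebra k →ₐ[ℤ[X]] Module.End ℤ[X] (ReducedDiagram k →₀ ℤ[X]) :=
  MonoidAlgebra.lift ℤ[X] _ (LDiagram k)
    { toFun := leftMul
      map_one' := by
        refine Finsupp.lhom_ext' fun d => LinearMap.ext_ring ?_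
        change leftMul 1 (Finsupp.single d 1) = Finsupp.single d 1
        rw [leftMul_single, one_mul, normalForm_of_reduced]
      map_mul' := fun a b => by
        refine Finsupp.lhom_ext' fun d => LinearMap.ext_ring ?_
        change leftMul (a * b) (Finsupp.single d 1) = leftMul a (leftMul b (Finsupp.single d 1))
        -- The normal form of a product may be taken after normalising the right factor, so
        -- multiplicativity is associativity of concatenation.
        rw [leftMul_single, leftMul_single, leftMul_normalForm, mul_assoc] }

theorem representation_of (d : LDiagram k) :
    representation k (MonoidAlgebra.of ℤ[X] (LDiagram k) d) = leftMul d := by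
  rw [representation, MonoidAlgebra.lift_of]
  rfl

theorem representation_rel {x y : LDiagramAlgebra k} (h : AlgebraRel k x y) :
    representation k x = representation k y := by
  obtain ⟨d, rfl, h⟩ := h
  have key : ∀ {d d' : LDiagram k}, reduce d.strands = reduce d'.strands →
      loopValue d.strands = loopValue d'.strands → leftMul d = leftMul d' := by
    intro d d' h₁ h₂
    rw [leftMul_congr (c := 1) h₁ (by rw [h₂, one_mul]), one_smul]
  cases h with
  | loop d' h =>
    rw [map_smul, representation_of, representation_of]
    refine leftMul_congr ?_ ?_
    · rw [h]; simp [reduce]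
    · rw [h]; simp [loopValue]
  | cancel d' e m R h h' =>
    rw [representation_of, representation_of]
    have : parity d.strands = parity d'.strands := by
      rw [h, h']; simp [parity]
    refine key ?_ ?_
    · rw [← reduce_parity, this, reduce_parity]
    · rw [← loopValue_parity, this, loopValue_parity]
  -- The strand that loses a decoration changes parity, so the reduced forms may differ; but both
  -- diagrams contain a loop with one decoration, of value zero, and both operators vanish.
  | absorb d' e m R h h' =>
    rw [representation_of, representation_of]
    have h1 : (0, 1) ∈ d.strands := by simp [h]
    have h2 : (0, 1) ∈ d'.strands := by simp [h']
    rw [leftMul_eq_zero h1, leftMul_eq_zero h2]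

/-- The action of the quotient by the local relations on the reduced diagrams. -/
noncomputable def hatRepresentation (k : ℕ) :
    HatAlgebra k →ₐ[ℤ[X]] Module.End ℤ[X] (ReducedDiagram k →₀ ℤ[X]) :=
  RingQuot.liftAlgHom ℤ[X] ⟨representation k, fun _ _ h => representation_rel h⟩

theorem hatRepresentation_diagramClass (d : LDiagram k) :
    hatRepresentation k (diagramClass d) = leftMul d := by
  rw [hatRepresentation, diagramClass, RingQuot.liftAlgHom_mkAlgHom_apply, representation_of]

/-- The action of the loop-free diagram algebra on the reduced diagrams. -/
noncomputable def loopFreeRepresentation (k : ℕ) :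
    LFD k →ₐ[ℤ[X]] Module.End ℤ[X] (ReducedDiagram k →₀ ℤ[X]) :=
  RingQuot.liftAlgHom ℤ[X] ⟨(hatRepresentation k).comp (DTL k).val, fun x y h => by
    obtain ⟨rfl, d, hd, hx⟩ := h
    change hatRepresentation k (x : HatAlgebra k) = hatRepresentation k ((0 : DTL k) : HatAlgebra k)
    rw [hx, hatRepresentation_diagramClass, leftMul_eq_zero hd, ZeroMemClass.coe_zero, map_zero]⟩

/-- The class of a diagram in the loop-free algebra. -/
noncomputable def loopFreeClass (x : DTL k) : LFD k := RingQuot.mkAlgHom ℤ[X] (LoopRel k) x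

theorem idStrands_reduced : ∀ e ∈ (1 : LDiagram k).strands, e.1 ≠ 0 ∧ e.2 < 2 := by
  intro e he
  obtain ⟨i, -, rfl⟩ := mem_straight.1 he
  simp

/-- The coordinates of an element of the loop-free algebra in terms of reduced diagrams. -/
noncomputable def coordinates (k : ℕ) : LFD k →ₗ[ℤ[X]] (ReducedDiagram k →₀ ℤ[X]) :=
  (LinearMap.applyₗ (Finsupp.single ⟨1, idStrands_reduced⟩ 1)).comp
    (loopFreeRepresentation k).toLinearMap

/-- Acting on the identity diagram, `d` gives the normal form of `d * 1 = d`, and a reduced diagram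
is its own normal form with coefficient one. -/
theorem coordinates_loopFreeClass {d : LDiagram k} (h : diagramClass d ∈ DTL k)
    (hd : ∀ e ∈ d.strands, e.1 ≠ 0 ∧ e.2 < 2) :
    coordinates k (loopFreeClass ⟨diagramClass d, h⟩) = Finsupp.single ⟨d, hd⟩ 1 := by
  have h1 : loopFreeRepresentation k (loopFreeClass ⟨diagramClass d, h⟩) = leftMul d := by
    rw [loopFreeRepresentation, loopFreeClass, RingQuot.liftAlgHom_mkAlgHom_apply]
    exact hatRepresentation_diagramClass d
  change loopFreeRepresentation k (loopFreeClass ⟨diagramClass d, h⟩) (Finsupp.single _ 1) = _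
  rw [h1, leftMul_single, mul_one, ← normalForm_of_reduced]

end Representation

/-! ### Spanning by type II diagrams, and the basis. -/

section Spanning

variable {k : ℕ}

theorem diagramClass_mul (d d' : LDiagram k) :
    diagramClass (d * d') = diagramClass d * diagramClass d' := by
  simp only [diagramClass, map_mul]

theorem diagramClass_one : diagramClass (1 : LDiagram k) = 1 := by
  simp only [diagramClass, map_one]

theorem diagramClass_cancel {d d' : LDiagram k} {e : Multiset (Node k)} {m : ℕ}
    {R : Multiset (Strand (Node k))} (h : d.strands = (e, m + 2) ::ₘ R)
    (h' : d'.strands = (e, m) ::ₘ R) : diagramClass d = diagramClass d' :=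
  RingQuot.mkAlgHom_rel _ ⟨d, rfl, DiagramRel.cancel d d' e m R h h'⟩

theorem diagramClass_loop {d d' : LDiagram k} (h : d.strands = (0, 0) ::ₘ d'.strands) :
    diagramClass d = (X : ℤ[X]) • diagramClass d' := by
  rw [diagramClass, diagramClass, ← map_smul]
  exact RingQuot.mkAlgHom_rel _ ⟨d, rfl, DiagramRel.loop d d' h⟩

/-- The relations relate actual L-decorated diagrams, so cancelling can be used only once its result
is known to be such a diagram. It is, since the edges are the same and no undecorated strand becomes
decorated. -/
theorem LDiagram.exists_cancel (d : LDiagram k) {e : Multiset (Node k)} {m : ℕ}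
    {R : Multiset (Strand (Node k))} (h : d.strands = (e, m + 2) ::ₘ R) :
    ∃ d' : LDiagram k, d'.strands = (e, m) ::ₘ R := by
  refine ⟨d.refine ((e, m) ::ₘ R) ?_ ?_ ?_, rfl⟩
  · intro f hf
    rcases Multiset.mem_cons.1 hf with rfl | hf
    · exact ⟨(e, m + 2), by simp [h], rfl, by simp⟩
    · exact ⟨f, by simp [h, hf], rfl, id⟩
  · intro f hf _
    rw [h] at hf
    rcases Multiset.mem_cons.1 hf with rfl | hf
    · exact ⟨(e, m), by simp, rfl⟩
    · exact ⟨f, by simp [hf], rfl⟩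
  · rw [h, ends_cons, ends_cons]

theorem LDiagram.exists_removeLoop (d : LDiagram k) {R : Multiset (Strand (Node k))} {m : ℕ}
    (h : d.strands = (0, m) ::ₘ R) : ∃ d' : LDiagram k, d'.strands = R := by
  refine ⟨d.refine R ?_ ?_ ?_, rfl⟩
  · exact fun f hf => ⟨f, by simp [h, hf], rfl, id⟩
  · intro f hf hf0
    rw [h] at hf
    rcases Multiset.mem_cons.1 hf with rfl | hf
    · exact absurd rfl hf0
    · exact ⟨f, hf, rfl⟩
  · rw [h, ends_cons, zero_add]

theorem IsTypeII.of_reduced {d : LDiagram k} (h : ∀ e ∈ d.strands, e.1 ≠ 0 ∧ e.2 < 2)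
    (he : Even d.strands.sum.2) : IsTypeII d := by
  refine ⟨fun y hy => ?_, fun e he => (h e he).1, sum_snd d.strands ▸ he⟩
  cases hy with
  | loop d' h' => exact (h (0, 0) (by simp [h'])).1 rfl
  | cancel d' e m R h' _ =>
    have := (h (e, m + 2) (by simp [h'])).2
    simp at this
  | absorb d' e m R h' _ => exact (h (0, 1) (by simp [h'])).1 rfl

/-- A strand with two or more decorations would allow the cancelling relation, contrary to
irreducibility. -/
theorem IsTypeII.reduced {d : LDiagram k} (h : IsTypeII d) :
    ∀ e ∈ d.strands, e.1 ≠ 0 ∧ e.2 < 2 := by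
  rintro ⟨e, m⟩ he
  refine ⟨h.loopless _ he, ?_⟩
  by_contra hm
  obtain ⟨m, rfl⟩ : ∃ l, m = l + 2 := ⟨m - 2, by simp only [] at hm; omega⟩
  obtain ⟨R, hR⟩ := Multiset.exists_cons_of_mem he
  obtain ⟨d', hd'⟩ := d.exists_cancel hR
  exact h.irreducible _ (DiagramRel.cancel d d' e m R hR hd')

/-- The span of the classes of the diagrams of type II. -/
noncomputable def typeIISpan (k : ℕ) : Submodule ℤ[X] (LFD k) :=
  Submodule.span ℤ[X]
    {x | ∃ d, IsTypeII d ∧ ∃ h : diagramClass d ∈ DTL k, x = loopFreeClass ⟨diagramClass d, h⟩}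

/-- Each undecorated loop can be removed at the cost of a factor δ, which lowers the number of
strands; when no loop is left the diagram is of type II. Membership in the subalgebra is carried
along because the class is a multiple of the class with one loop fewer. -/
theorem mem_typeIISpan_of_even_loops (hmem : ∀ d : LDiagram k, IsTypeII d → diagramClass d ∈ DTL k)
    (N : ℕ) (d : LDiagram k) (hN : Multiset.card d.strands = N)
    (hd : ∀ e ∈ d.strands, e.2 < 2 ∧ (e.1 = 0 → e.2 = 0)) (he : Even d.strands.sum.2) :
    ∃ h : diagramClass d ∈ DTL k, loopFreeClass ⟨diagramClass d, h⟩ ∈ typeIISpan k := by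
  induction N generalizing d with
  | zero =>
    rw [Multiset.card_eq_zero] at hN
    have ht : IsTypeII d := IsTypeII.of_reduced (by simp [hN]) he
    exact ⟨hmem d ht, Submodule.subset_span ⟨d, ht, hmem d ht, rfl⟩⟩
  | succ N ih =>
    by_cases hl : ∃ e ∈ d.strands, e.1 = 0
    · obtain ⟨⟨e, m⟩, hm, rfl : e = 0⟩ := hl
      obtain rfl : m = 0 := (hd _ hm).2 rfl
      obtain ⟨R, hR⟩ := Multiset.exists_cons_of_mem hm
      obtain ⟨d', rfl⟩ := d.exists_removeLoop hR
      obtain ⟨h1, h2⟩ := ih d' (by simpa [hR] using hN) (fun e he => hd e (by simp [hR, he]))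
        (by simpa [hR] using he)
      have h3 := diagramClass_loop hR
      refine ⟨h3 ▸ (DTL k).smul_mem h1 X, ?_⟩
      have h4 : loopFreeClass ⟨diagramClass d, h3 ▸ (DTL k).smul_mem h1 X⟩ =
          (X : ℤ[X]) • loopFreeClass ⟨diagramClass d', h1⟩ := by
        rw [loopFreeClass, loopFreeClass, ← map_smul]
        congr 1
        exact Subtype.ext h3
      rw [h4]
      exact Submodule.smul_mem _ _ h2
    · push Not at hl
      have ht : IsTypeII d := IsTypeII.of_reduced (fun e he => ⟨hl e he, (hd e he).1⟩) he
      exact ⟨hmem d ht, Submodule.subset_span ⟨d, ht, hmem d ht, rfl⟩⟩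

/-- Cancelling two decorations lowers the total by two, so the induction ends at a diagram with at
most one decoration per strand. If one of its loops is decorated, the second alternative holds; no
membership in the subalgebra is claimed there, since it is not yet known. -/
theorem mem_typeIISpan_or (hmem : ∀ d : LDiagram k, IsTypeII d → diagramClass d ∈ DTL k)
    (N : ℕ) (d : LDiagram k) (hN : d.strands.sum.2 ≤ N) (he : Even d.strands.sum.2) :
    (∃ h : diagramClass d ∈ DTL k, loopFreeClass ⟨diagramClass d, h⟩ ∈ typeIISpan k) ∨
      ∃ d' : LDiagram k, (0, 1) ∈ d'.strands ∧ diagramClass d = diagramClass d' := by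
  induction N using Nat.strong_induction_on generalizing d with
  | h N ih =>
    by_cases h2 : ∃ e ∈ d.strands, 2 ≤ e.2
    · obtain ⟨⟨e, m⟩, hm, h2⟩ := h2
      obtain ⟨m, rfl⟩ : ∃ l, m = l + 2 := ⟨m - 2, by simp only [] at h2; omega⟩
      obtain ⟨R, hR⟩ := Multiset.exists_cons_of_mem hm
      obtain ⟨d', hd'⟩ := d.exists_cancel hR
      have hs : d.strands.sum.2 = d'.strands.sum.2 + 2 := by
        rw [hR, hd']; simp only [Multiset.sum_cons, Prod.snd_add]; omega
      rw [diagramClass_cancel hR hd']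
      refine ih (N - 2) (by omega) d' (by omega) ?_
      rw [hs] at he
      exact (Nat.even_add.1 he).2 even_two
    · push Not at h2
      by_cases h1 : (0, 1) ∈ d.strands
      · exact Or.inr ⟨d, h1, rfl⟩
      · refine Or.inl (mem_typeIISpan_of_even_loops hmem _ d rfl (fun e hE => ⟨h2 e hE, ?_⟩) he)
        intro h0
        have := h2 e hE
        by_contra hne
        refine h1 ?_
        obtain ⟨e, m⟩ := e
        simp only at h0 this hne
        obtain rfl : m = 1 := by omega
        rwa [← h0]

theorem loopFreeClass_mem_typeIISpan
    (hmem : ∀ d : LDiagram k, IsTypeII d → diagramClass d ∈ DTL k) (d : LDiagram k)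
    (h : diagramClass d ∈ DTL k) (he : Even d.strands.sum.2) :
    loopFreeClass ⟨diagramClass d, h⟩ ∈ typeIISpan k := by
  rcases mem_typeIISpan_or hmem _ d le_rfl he with ⟨_, h1⟩ | ⟨d', h1, h2⟩
  · exact h1
  · have : loopFreeClass ⟨diagramClass d, h⟩ = loopFreeClass 0 :=
      -- The loop relation applies to any element of the subalgebra represented by a diagram with a
      -- decorated loop, so it is enough that `d` and `d'` have the same class, even when `d` itself
      -- has no such loop.
      RingQuot.mkAlgHom_rel _ ⟨rfl, d', h1, h2⟩
    rw [this, loopFreeClass, map_zero]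
    exact Submodule.zero_mem _

theorem sum_snd_straight (l : List (Fin k)) : (straight l).sum.2 = 0 := by
  rw [sum_snd]
  refine Multiset.sum_eq_zero fun x hx => ?_
  obtain ⟨e, he, rfl⟩ := Multiset.mem_map.1 hx
  obtain ⟨i, -, rfl⟩ := mem_straight.1 he
  rfl

theorem even_simpleDiagram (i : ℕ) (hi : i + 1 < k) (m : ℕ) (hm : m = 0 ∨ i = 0) :
    Even (simpleDiagram i hi m hm).strands.sum.2 := by
  refine ⟨m, ?_⟩
  simp [simpleDiagram, simpleStrands, sum_snd_straight]

/-- The generators carry zero or two decorations in all, and totals add under concatenation. -/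
theorem exists_even_of_mem_closure {x : HatAlgebra k}
    (hx : x ∈ Submonoid.closure
      {x | (∃ (i : ℕ) (hi : i + 1 < k), x = diagramClass (simpleDiagram i hi 0 (Or.inl rfl))) ∨
        ∃ h : 0 + 1 < k, x = diagramClass (simpleDiagram 0 h 1 (Or.inr rfl))}) :
    ∃ d : LDiagram k, Even d.strands.sum.2 ∧ x = diagramClass d := by
  induction hx using Submonoid.closure_induction with
  | mem x hx =>
    rcases hx with ⟨i, hi, rfl⟩ | ⟨h, rfl⟩
    · exact ⟨_, even_simpleDiagram i hi 0 _, rfl⟩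
    · exact ⟨_, even_simpleDiagram 0 h 1 _, rfl⟩
  | one =>
    refine ⟨1, ?_, diagramClass_one.symm⟩
    have : (1 : LDiagram k).strands.sum.2 = 0 := sum_snd_straight _
    simp [this]
  | mul x y _ _ hx hy =>
    obtain ⟨d, hd, rfl⟩ := hx
    obtain ⟨d', hd', rfl⟩ := hy
    refine ⟨d * d', ?_, (diagramClass_mul d d').symm⟩
    have : (d * d').strands.sum.2 = d.strands.sum.2 + d'.strands.sum.2 := sum_snd_concat _ _
    rw [this]
    exact hd.add hd'

/-- The subalgebra is linearly spanned by the monoid generated by the simple diagrams, and each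
element of this monoid is the class of a diagram with an even total of decorations. -/
theorem typeIISpan_eq_top (hmem : ∀ d : LDiagram k, IsTypeII d → diagramClass d ∈ DTL k) :
    typeIISpan k = ⊤ := by
  refine Submodule.eq_top_iff'.2 fun y => ?_
  obtain ⟨⟨x, hx⟩, rfl⟩ := RingQuot.mkAlgHom_surjective ℤ[X] (LoopRel k) y
  change loopFreeClass ⟨x, hx⟩ ∈ _
  have hx' := hx
  rw [DTL, ← Subalgebra.mem_toSubmodule, Algebra.adjoin_eq_span] at hx'
  suffices ∀ h, loopFreeClass ⟨x, h⟩ ∈ typeIISpan k from this hx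
  have hsub : ∀ z, z ∈ Submonoid.closure
      {x | (∃ (i : ℕ) (hi : i + 1 < k), x = diagramClass (simpleDiagram i hi 0 (Or.inl rfl))) ∨
        ∃ h : 0 + 1 < k, x = diagramClass (simpleDiagram 0 h 1 (Or.inr rfl))} → z ∈ DTL k := by
    intro z hz
    rw [DTL, ← Subalgebra.mem_toSubmodule, Algebra.adjoin_eq_span]
    exact Submodule.subset_span hz
  -- Membership is made part of the conclusion: in the span induction the summands need to have
  -- classes in the loop-free algebra themselves.
  suffices ∃ h : x ∈ DTL k, loopFreeClass ⟨x, h⟩ ∈ typeIISpan k from fun _ => this.2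
  clear hx
  induction hx' using Submodule.span_induction with
  | mem x hx =>
    obtain ⟨d, hd, rfl⟩ := exists_even_of_mem_closure hx
    exact ⟨hsub _ hx, loopFreeClass_mem_typeIISpan hmem d _ hd⟩
  | zero =>
    refine ⟨Subalgebra.zero_mem _, ?_⟩
    have : loopFreeClass (⟨0, Subalgebra.zero_mem _⟩ : DTL k) = 0 := map_zero _
    rw [this]
    exact Submodule.zero_mem _
  | add x y _ _ hx hy =>
    obtain ⟨h1, h2⟩ := hx
    obtain ⟨h3, h4⟩ := hy
    refine ⟨Subalgebra.add_mem _ h1 h3, ?_⟩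
    have : loopFreeClass (⟨x + y, Subalgebra.add_mem _ h1 h3⟩ : DTL k) =
      loopFreeClass ⟨x, h1⟩ + loopFreeClass ⟨y, h3⟩ := map_add _ (⟨x, h1⟩ : DTL k) ⟨y, h3⟩
    rw [this]
    exact Submodule.add_mem _ h2 h4
  | smul c x _ hx =>
    obtain ⟨h1, h2⟩ := hx
    refine ⟨Subalgebra.smul_mem _ h1 c, ?_⟩
    have : loopFreeClass (⟨c • x, Subalgebra.smul_mem _ h1 c⟩ : DTL k) =
      c • loopFreeClass ⟨x, h1⟩ := map_smul (RingQuot.mkAlgHom ℤ[X] (LoopRel k)) c (⟨x, h1⟩ : DTL k)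
    rw [this]
    exact Submodule.smul_mem _ _ h2

/-- The coordinate map sends the family to distinct standard basis vectors of the free module on
reduced diagrams. -/
theorem linearIndependent_typeII (hmem : ∀ d : LDiagram k, IsTypeII d → diagramClass d ∈ DTL k) :
    LinearIndependent ℤ[X] fun d : {d : LDiagram k // IsTypeII d} =>
      loopFreeClass ⟨diagramClass d.1, hmem d.1 d.2⟩ := by
  refine LinearIndependent.of_comp (coordinates k) ?_
  have hinj : Function.Injective fun d : {d : LDiagram k // IsTypeII d} =>
      (⟨d.1, d.2.reduced⟩ : ReducedDiagram k) := fun a b h =>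
    Subtype.ext (congrArg (fun z : ReducedDiagram k => z.1) h)
  convert (Finsupp.linearIndependent_single_one ℤ[X] (ReducedDiagram k)).comp _ hinj using 1
  ext1 d
  exact coordinates_loopFreeClass (hmem d.1 d.2) d.2.reduced

theorem exists_basis (hmem : ∀ d : LDiagram k, IsTypeII d → diagramClass d ∈ DTL k) :
    ∃ b : Module.Basis {d : LDiagram k // IsTypeII d} ℤ[X] (LFD k),
      ∀ d : {d : LDiagram k // IsTypeII d}, ∃ h : diagramClass d.1 ∈ DTL k,
        b d = RingQuot.mkAlgHom ℤ[X] (LoopRel k) ⟨diagramClass d.1, h⟩ := by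
  refine ⟨Module.Basis.mk (linearIndependent_typeII hmem) ?_, fun d => ⟨hmem d.1 d.2, ?_⟩⟩
  · rw [← typeIISpan_eq_top hmem]
    refine Submodule.span_le.2 ?_
    rintro _ ⟨d, hd, h, rfl⟩
    exact Submodule.subset_span ⟨⟨d, hd⟩, rfl⟩
  · rw [Module.Basis.mk_apply]
    rfl

end Spanning

/-! ### Multiplication by a simple diagram on top. -/

section SimpleConcat

theorem fuse_pair {V : Type*} [DecidableEq V] {v u w : V} (hu : u ≠ v) (hw : w ≠ v) (p q : ℕ)
    {N : Multiset (Strand V)} (hN : v ∉ ends N) :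
    fuse v (({v, u}, p) ::ₘ ({v, w}, q) ::ₘ N) = (({u, w} : Multiset V), p + q) ::ₘ N := by
  have h1 : ∀ e ∈ N, v ∉ e.1 := fun e he hv => hN (mem_ends.2 ⟨e, he, hv⟩)
  have h2 : N.filter (fun e => v ∈ e.1) = 0 := Multiset.filter_eq_nil.2 h1
  have h3 : N.filter (fun e => v ∉ e.1) = N := Multiset.filter_eq_self.2 h1
  rw [fuse]
  simp only [Multiset.insert_eq_cons, Multiset.filter_cons, Multiset.mem_cons, true_or, if_true,
    not_true_eq_false, if_false, h2, h3, add_zero, zero_add, Multiset.sum_add,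
    Multiset.sum_singleton, Prod.fst_add, Prod.snd_add, ne_eq, Multiset.filter_add,
    Multiset.filter_singleton, hu, hw, not_false_eq_true]
  simp

theorem fuseList_perm {V : Type*} [DecidableEq V] {l l' : List V} (h : l.Perm l')
    (M : Multiset (Strand V)) : fuseList l M = fuseList l' M := by
  have : LeftCommutative (fuse : V → Multiset (Strand V) → Multiset (Strand V)) := ⟨fuse_comm⟩
  exact h.foldr_eq M

variable {k : ℕ}

/-- The vertical strands of the simple diagram only rename nodes. Its lower arc {i, j} links the
edges {i, x} and {j, y} into one edge {x, y}, which collects the decorations of all three, while its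
upper arc becomes a cup of the product. Read backwards, this shows how a cup is split off. -/
theorem concat_simple {i j : Fin k} (hij : i ≠ j) (m q r : ℕ) {x y : Node k}
    (hxi : x ≠ Sum.inl i) (hxj : x ≠ Sum.inl j) (hyi : y ≠ Sum.inl i) (hyj : y ≠ Sum.inl j)
    {R : Multiset (Strand (Node k))}
    (hd : ∀ v, (ends (({Sum.inl i, x}, q) ::ₘ ({Sum.inl j, y}, r) ::ₘ R)).count v = 1) :
    concat (simpleStrands i j m) (({Sum.inl i, x}, q) ::ₘ ({Sum.inl j, y}, r) ::ₘ R) =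
      (({Sum.inl i, Sum.inl j} : Multiset (Node k)), m) ::ₘ ({x, y}, m + q + r) ::ₘ R := by
  set D := (({Sum.inl i, x} : Multiset (Node k)), q) ::ₘ ({Sum.inl j, y}, r) ::ₘ R with hD
  set T := (List.finRange k).filter fun l => l ≠ i ∧ l ≠ j with hT
  have hmemT : ∀ l, l ∈ T ↔ l ≠ i ∧ l ≠ j := fun l => by simp [hT]
  have hTn : T.Nodup := (List.nodup_finRange k).filter _
  have hinj : Function.Injective (place 1 2 : Node k → Fin 3 × Fin k) :=
    place_injective (by decide)
  -- The order of joining is immaterial. With `i` and `j` at the head of the list, `foldr` treats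
  -- them last, after the vertical strands have been absorbed.
  have hperm : (level k (1 : Fin 3)).Perm ((1, i) :: (1, j) :: T.map fun l => (1, l)) := by
    refine (List.perm_ext_iff_of_nodup (nodup_level _) ?_).2 ?_
    · have : (T.map fun l => ((1 : Fin 3), l)).Nodup := hTn.map fun _ _ h => (Prod.mk.inj h).2
      simp [this, hij, hmemT]
    · rintro ⟨a, b⟩
      rw [mem_level]
      simp only [List.mem_cons, List.mem_map, Prod.mk.injEq, hmemT]
      constructor
      · intro h
        by_cases h1 : b = i
        · exact Or.inl ⟨h, h1⟩
        · by_cases h2 : b = j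
          · exact Or.inr (Or.inl ⟨h, h2⟩)
          · exact Or.inr (Or.inr ⟨b, ⟨h1, h2⟩, h.symm, rfl⟩)
      · rintro (⟨h, -⟩ | ⟨h, -⟩ | ⟨_, -, h, -⟩)
        · exact h
        · exact h
        · exact h.symm
  obtain ⟨h, h1, h2, h3⟩ := fuseList_straight (V := Fin 3 × Fin k) (fun l : Fin k => (1, l))
    (fun l => (0, l)) (fun _ _ h => (Prod.mk.inj h).2) (fun a b => by simp) T hTn
    (relabel (place 1 2) D) (fun l => (count_ends_relabel hinj D (Sum.inl l)).trans (hd _))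
  have hstack : stack (simpleStrands i j m) D =
      (((T.map fun l => (({(0, l), (1, l)} : Multiset (Fin 3 × Fin k)), 0) :
        List (Strand (Fin 3 × Fin k))) : Multiset (Strand (Fin 3 × Fin k))) + relabel (place 1 2) D) +
      (({(0, i), (0, j)}, m) ::ₘ {({(1, i), (1, j)}, m)}) := by
    have : relabel (place (0 : Fin 3) 1) (simpleStrands i j m) =
        ((T.map fun l => (({(0, l), (1, l)} : Multiset (Fin 3 × Fin k)), 0) :
          List (Strand (Fin 3 × Fin k))) : Multiset (Strand (Fin 3 × Fin k))) +
        (({(0, i), (0, j)}, m) ::ₘ {({(1, i), (1, j)}, m)}) := by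
      rw [add_comm]
      simp [simpleStrands, straight, relabel, place, hT, Function.comp_def]
    rw [stack, this, add_right_comm]
  -- After the vertical strands are absorbed, a node of the lower box other than the north nodes `i`
  -- and `j` sits at level 0 or 2 at its own place, so `unplace` recovers it.
  set g : Node k → Fin 3 × Fin k := h ∘ place 1 2 with hg
  have gi : g (Sum.inl i) = (1, i) :=
    h2 _ fun l hl e => ((hmemT l).1 hl).1 (Prod.mk.inj e).2.symm
  have gj : g (Sum.inl j) = (1, j) :=
    h2 _ fun l hl e => ((hmemT l).1 hl).2 (Prod.mk.inj e).2.symm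
  have gv : ∀ v : Node k, v ≠ Sum.inl i → v ≠ Sum.inl j → (g v).1 ≠ 1 ∧ unplace (g v) = v := by
    rintro (l | l) hi hj
    · have : g (Sum.inl l) = (0, l) := h1 l ((hmemT l).2 ⟨fun e => hi (e ▸ rfl), fun e => hj (e ▸ rfl)⟩)
      rw [this]
      exact ⟨by simp, rfl⟩
    · have : g (Sum.inr l) = (2, l) := h2 _ fun l' _ e => by simp [place] at e
      rw [this]
      exact ⟨by simp, rfl⟩
  have hRi : Sum.inl i ∉ ends R := fun hR => by
    have := hd (Sum.inl i)
    have h4 := Multiset.one_le_count_iff_mem.2 hR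
    rw [hD, ends_cons, ends_cons] at this
    simp only [Multiset.insert_eq_cons, Multiset.count_add, Multiset.count_cons_self] at this
    omega
  have hRj : Sum.inl j ∉ ends R := fun hR => by
    have := hd (Sum.inl j)
    have h4 := Multiset.one_le_count_iff_mem.2 hR
    rw [hD, ends_cons, ends_cons] at this
    simp only [Multiset.insert_eq_cons, Multiset.count_add, Multiset.count_cons_self] at this
    omega
  have hR : ∀ v ∈ ends R, v ≠ Sum.inl i ∧ v ≠ Sum.inl j := fun v hv =>
    ⟨fun e => hRi (e ▸ hv), fun e => hRj (e ▸ hv)⟩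
  have hRg : ∀ l, (1, l) ∉ ends (relabel g R) := fun l hl => by
    rw [ends_relabel, Multiset.mem_map] at hl
    obtain ⟨v, hv, e⟩ := hl
    exact (gv v (hR v hv).1 (hR v hv).2).1 (by rw [e])
  have hgD : relabel h (relabel (place 1 2) D) =
      ({(1, i), g x}, q) ::ₘ ({(1, j), g y}, r) ::ₘ relabel g R := by
    rw [relabel_relabel, ← hg, hD]
    simp [relabel, gi, gj]
  have hx := gv x hxi hxj
  have hy := gv y hyi hyj
  rw [concat, fuseList_perm hperm]
  change relabel unplace (fuse (1, i) (fuse (1, j) (fuseList (T.map fun l => (1, l)) _))) = _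
  rw [hstack, fuseList_add_of_notMem, h3, hgD]
  · have e1 : (({(1, i), g x}, q) ::ₘ ({(1, j), g y}, r) ::ₘ relabel g R) +
        (({(0, i), (0, j)}, m) ::ₘ {({(1, i), (1, j)}, m)}) =
        ({(1, j), (1, i)}, m) ::ₘ ({(1, j), g y}, r) ::ₘ
          ({(1, i), g x}, q) ::ₘ ({(0, i), (0, j)}, m) ::ₘ relabel g R := by
      rw [Multiset.pair_comm (1, j) (1, i)]
      simp only [← Multiset.singleton_add]
      abel
    have hN : ((1 : Fin 3), i) ∉ ends (({(0, i), (0, j)}, m) ::ₘ relabel g R) := by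
      rw [ends_cons, Multiset.mem_add, not_or]
      exact ⟨by simp, hRg i⟩
    have hN' : ((1 : Fin 3), j) ∉ ends (({(1, i), g x}, q) ::ₘ ({(0, i), (0, j)}, m) ::ₘ
        relabel g R) := by
      rw [ends_cons, ends_cons, Multiset.mem_add, Multiset.mem_add, not_or, not_or]
      refine ⟨?_, by simp, hRg j⟩
      simp only [Multiset.insert_eq_cons, Multiset.mem_cons, Multiset.mem_singleton, not_or]
      exact ⟨fun e => hij (Prod.mk.inj e).2.symm, fun e => hx.1 (by rw [← e])⟩
    have hRu : relabel unplace (relabel g R) = R := by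
      rw [relabel_relabel]
      conv_rhs => rw [← relabel_id R]
      exact relabel_congr fun v hv => (gv v (hR v hv).1 (hR v hv).2).2
    rw [e1, fuse_pair (by simp [hij]) (fun e => hy.1 (by rw [e])) _ _ hN',
      fuse_pair (fun e => hy.1 (by rw [e])) (fun e => hx.1 (by rw [e])) _ _ hN]
    have hcons : ∀ (e : Strand (Fin 3 × Fin k)) (N : Multiset (Strand (Fin 3 × Fin k))),
        relabel unplace (e ::ₘ N) = (e.1.map unplace, e.2) ::ₘ relabel unplace N :=
      fun e N => Multiset.map_cons _ _ _
    rw [hcons, hcons, hRu, Multiset.cons_swap, Multiset.pair_comm x y, add_right_comm m q r]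
    have h0 : ∀ l : Fin k, unplace (0, l) = Sum.inl l := fun l => rfl
    simp [hx.2, hy.2, h0]
  · intro v hv
    obtain ⟨l, hl, rfl⟩ := List.mem_map.1 hv
    rw [hmemT] at hl
    simp [ends, hl]

end SimpleConcat

/-! ### Combinatorics of noncrossing arcs: finding a cup that can be split off. -/

section Arcs

/-- Noncrossing arcs on the positions `0, …, 2 * n - 1`, where `A a c m` says that `a` and `c` are
joined by an arc with `m` decorations. -/
structure IsArcSystem (n : ℕ) (A : ℕ → ℕ → ℕ → Prop) : Prop where
  symm : ∀ {a c m}, A a c m → A c a m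
  lt : ∀ {a c m}, A a c m → a < 2 * n
  total : ∀ {a}, a < 2 * n → ∃ c m, A a c m
  unique : ∀ {a c c' m m'}, A a c m → A a c' m' → c = c' ∧ m = m'
  ne : ∀ {a c m}, A a c m → a ≠ c
  planar : ∀ {a c b x m m'}, A a c m → A b x m' → ¬ (a < b ∧ b < c ∧ c < x)
  exposed : ∀ {a c b x m m'}, A a c m → A b x m' → m' ≠ 0 → ¬ (a < b ∧ b < c)
  le_one : ∀ {a c m}, A a c m → m < 2
  odd : ∀ {a c m}, A a c m → (a + c) % 2 = 1
  -- This follows from the two faces having equally many nodes; as an axiom it keeps counting out of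
  -- the arguments on arcs.
  balanced : (∀ a c m, A a c m → a < n → n ≤ c) → ∀ a c m, A a c m → n ≤ a → c < n

/-- The column of a position on the boundary of the box. -/
def column (n p : ℕ) : ℕ := min p (2 * n - 1 - p)

/-- The horizontal length of an arc; a decorated arc passes along the left wall. -/
def arcLength (n a c m : ℕ) : ℕ :=
  -- Of the two truncated differences one is zero, so the sum is the distance of the columns.
  if m = 0 then (column n a - column n c) + (column n c - column n a)
  else column n a + column n c + 1

/-- The position `a` lies strictly between `p` and `q`. -/
def Between (p q a : ℕ) : Prop := (p < a ∧ a < q) ∨ (q < a ∧ a < p)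

/-- The cup `{i, i + 1}` and the arc `{x, y}` can be replaced by the arcs `{i, x}` and
`{i + 1, y}`, and this makes the arcs shorter. -/
structure IsMove (n : ℕ) (A : ℕ → ℕ → ℕ → Prop) (i x y m m' : ℕ) : Prop where
  cup : A i (i + 1) m
  arc : A x y m'
  top : i + 1 < n
  bare : m = 0 ∨ i = 0
  ne : x ≠ i ∧ x ≠ i + 1
  -- The new arcs {i, x} and {i + 1, y} do not cross each other: both ends of the second lie on the
  -- same side of the first.
  planar_self : Between i x (i + 1) ↔ Between i x y
  planar : ∀ {a c l}, A a c l → (a ≠ i ∧ a ≠ i + 1 ∧ a ≠ x ∧ a ≠ y) →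
    (Between i x a → Between i x c) ∧ (Between (i + 1) y a → Between (i + 1) y c)
  exposed : ∀ {a c l}, A a c l → l ≠ 0 → (a ≠ i ∧ a ≠ i + 1 ∧ a ≠ x ∧ a ≠ y) →
    ¬ Between i x a ∧ ¬ Between (i + 1) y a
  -- All surviving decorations are put on {i, x}, so only this one of the two new arcs has to be
  -- exposed, and only when their number is odd.
  exposed_new : (m + m') % 2 ≠ 0 → (¬ Between (i + 1) y i ∧ ¬ Between (i + 1) y x) ∧
    ∀ {a c l}, A a c l → (a ≠ i ∧ a ≠ i + 1 ∧ a ≠ x ∧ a ≠ y) →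
      ¬ Between a c i ∧ ¬ Between a c x
  length : arcLength n i x ((m + m') % 2) + arcLength n (i + 1) y 0 <
    arcLength n i (i + 1) m + arcLength n x y m'

variable {n : ℕ} {A : ℕ → ℕ → ℕ → Prop}

theorem IsArcSystem.eq_of_arc (hA : IsArcSystem n A) {a b c m m' : ℕ} (h : A a c m)
    (h' : A b c m') : a = b :=
  (hA.unique (hA.symm h) (hA.symm h')).1

theorem exists_nonvertical (h : ¬ ∀ j < n, ∃ m, A j (2 * n - 1 - j) m) :
    ∃ j < n, (∀ m, ¬ A j (2 * n - 1 - j) m) ∧ ∀ k < j, ∃ m, A k (2 * n - 1 - k) m := by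
  classical
  push Not at h
  refine ⟨Nat.find h, (Nat.find_spec h).1, (Nat.find_spec h).2, fun k hk => ?_⟩
  have := Nat.find_min h hk
  push Not at this
  exact this (hk.trans (Nat.find_spec h).1)

/-- An arc that starts within the vertical arcs `{k, 2 * n - 1 - k}`, `k < j`, ends within them. -/
theorem IsArcSystem.inside (hA : IsArcSystem n A) {j : ℕ}
    (hv : ∀ k < j, ∃ m, A k (2 * n - 1 - k) m) {a c m : ℕ} (h : A a c m) (h₁ : j ≤ a)
    (h₂ : a ≤ 2 * n - 1 - j) : j ≤ c ∧ c ≤ 2 * n - 1 - j := by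
  have hc := hA.lt (hA.symm h)
  constructor
  · by_contra hlt
    obtain ⟨m', hm'⟩ := hv c (by omega)
    have := (hA.unique (hA.symm h) hm').1
    omega
  · by_contra hlt
    obtain ⟨m', hm'⟩ := hv (2 * n - 1 - c) (by omega)
    have e : 2 * n - 1 - (2 * n - 1 - c) = c := by omega
    rw [e] at hm'
    have := hA.eq_of_arc h hm'
    omega

/-- Take the first position that closes an arc. The position just before it opens an arc, which by
planarity must be this same arc, so the arc is a cup. All positions before the closing one are
openings. The cup starts no earlier than `j` because the nodes before `j` have vertical arcs. -/
theorem IsArcSystem.exists_cup (hA : IsArcSystem n A) {j : ℕ} (hj : j < n)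
    (hj' : ∀ m, ¬ A j (2 * n - 1 - j) m) (hv : ∀ k < j, ∃ m, A k (2 * n - 1 - k) m) :
    ∃ i m, j ≤ i ∧ i + 1 < n ∧ A i (i + 1) m ∧ ∀ k ≤ i, ∀ c l, A k c l → k < c := by
  classical
  have h0 : ∃ q, ∃ p m, p < q ∧ A p q m := by
    obtain ⟨c, m, h⟩ := hA.total (a := 0) (by omega)
    exact ⟨c, 0, m, by have := hA.ne h; omega, h⟩
  set q := Nat.find h0 with hq
  obtain ⟨p, m, hpq, hp⟩ := Nat.find_spec h0
  have hmin : ∀ k < q, ∀ c l, A k c l → k < c := by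
    intro k hk c l h
    have := Nat.find_min h0 hk
    push Not at this
    have h1 := hA.ne h
    by_contra h2
    exact this c l (by omega) (hA.symm h)
  -- Otherwise every north position is joined to the south face and, by balance, conversely. Then
  -- the arcs at `j` and at `2 * n - 1 - j`, which are not joined to each other, would cross inside
  -- the vertical arcs.
  have hqn : q < n := by
    by_contra hqn
    have hb : ∀ a c m, A a c m → a < n → n ≤ c := by
      intro a c m h ha
      by_contra hc
      have h1 := hmin a (by omega) c m h
      have h2 := hmin c (by omega) a m (hA.symm h)
      omega
    obtain ⟨c, l, hc⟩ := hA.total (a := j) (by omega)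
    have h1 := hA.inside hv hc le_rfl (by omega)
    have h2 := hb j c l hc hj
    have h3 : c ≠ 2 * n - 1 - j := fun e => hj' l (e ▸ hc)
    obtain ⟨c', l', hc'⟩ := hA.total (a := 2 * n - 1 - j) (by omega)
    have h4 := hA.inside hv hc' (by omega) le_rfl
    have h5 := hA.balanced hb _ _ _ hc' (by omega)
    have h6 : c' ≠ j := by
      rintro rfl
      exact h3 (hA.unique hc (hA.symm hc')).1
    exact hA.planar hc (hA.symm hc') (by omega)
  -- If there were a gap, the arc opened at `q - 1` would end after `q` and cross {p, q}.
  have hpq1 : p + 1 = q := by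
    by_contra hne
    obtain ⟨r, l, hr⟩ := hA.total (a := q - 1) (by omega)
    have h1 := hmin (q - 1) (by omega) r l hr
    have h2 : r ≠ q := by
      rintro h2
      rw [h2] at hr
      have := hA.eq_of_arc hr hp
      omega
    exact hA.planar hp hr (by omega)
  refine ⟨p, m, ?_, by omega, by rw [hpq1]; exact hp, fun k hk => hmin k (by omega)⟩
  by_contra hlt
  obtain ⟨l, hl⟩ := hv p (by omega)
  have := (hA.unique hl hp).1
  omega

/-- The cup is covered by the arc opened immediately to its left, so it is undecorated. Exchanging
the two moves the cup one step to the left, to {i, i + 1}, and starts the other arc at `i + 2`. The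
bounds on `y` put its column at `i + 2` or beyond, and this makes the total length drop by two. -/
theorem IsArcSystem.isMove_left (hA : IsArcSystem n A) {i y m m' : ℕ} (hi : i + 1 + 1 < n)
    (hc : A (i + 1) (i + 1 + 1) m) (hx : A i y m') (hy : i + 1 + 1 < y)
    (hy' : y ≤ 2 * n - 3 - i) :
    IsMove n A (i + 1) i y m m' where
  cup := hc
  arc := hx
  top := hi
  bare := by
    left
    by_contra hm
    exact hA.exposed hx hc hm (by omega)
  ne := by omega
  planar_self := by unfold Between; omega
  planar := by
    intro a c l h hne
    have h1 := hA.planar hx h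
    have h2 := hA.planar (hA.symm h) hx
    have h3 : c ≠ i := fun e => hne.2.2.2 (hA.unique (e ▸ hA.symm h) hx).1
    have h4 : c ≠ i + 1 := fun e => hne.2.1 (hA.unique (e ▸ hA.symm h) hc).1
    have h5 : c ≠ i + 1 + 1 := fun e => hne.1 (hA.unique (e ▸ hA.symm h) (hA.symm hc)).1
    have h6 : c ≠ y := fun e => hne.2.2.1 (hA.unique (e ▸ hA.symm h) (hA.symm hx)).1
    unfold Between
    omega
  exposed := by
    intro a c l h hl hne
    have h1 := hA.exposed hx h hl
    unfold Between
    omega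
  exposed_new := by
    intro hm
    have hm0 : m = 0 := by
      by_contra hm
      exact hA.exposed hx hc hm (by omega)
    have hm' : m' ≠ 0 := by omega
    refine ⟨by unfold Between; omega, fun {a c l} h hne => ?_⟩
    have h1 := hA.exposed h hx hm'
    have h2 := hA.exposed (hA.symm h) hx hm'
    have h3 : c ≠ i := fun e => hne.2.2.2 (hA.unique (e ▸ hA.symm h) hx).1
    unfold Between
    omega
  length := by
    have hm0 : m = 0 := by
      by_contra hm
      exact hA.exposed hx hc hm (by omega)
    have hm' := hA.le_one hx
    have hm'' : m' = 0 ∨ m' = 1 := by omega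
    rcases hm'' with rfl | rfl <;> subst hm0 <;> simp only [arcLength, column] <;> norm_num <;> omega

/-- The cup lies at the first non-vertical column. The partner arc either ends at the south node
below `i`, so that {i, x} becomes vertical, or is decorated, in which case `i = 0` and {i, x} runs
at the left wall. The other new arc {i + 1, y} covers no decorated arc because `y` was chosen first
among the admissible ones, which is the hypothesis `hmin`. -/
theorem IsArcSystem.isMove_right (hA : IsArcSystem n A) {i x y m m' : ℕ} (hi : i + 1 < n)
    (hv : ∀ k < i, ∃ m, A k (2 * n - 1 - k) m) (hc : A i (i + 1) m) (hx : A x y m')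
    (hy : i + 1 < y) (hyx : y < x) (hxi : m' ≠ 0 ∨ x = 2 * n - 1 - i)
    (hmin : ∀ a c l, A a c l → i + 1 < a → a < y → a < c → l = 0) :
    IsMove n A i x y m m' := by
  have hwall : i = 0 ∨ ∃ l, A 0 (2 * n - 1) l := by
    rcases Nat.eq_zero_or_pos i with h | h
    · exact Or.inl h
    · exact Or.inr (hv 0 h)
  have hx2 := hA.lt hx
  have hyx2 := hA.lt (hA.symm hx)
  -- For `i > 0` the vertical arc at position 0 separates everything strictly inside from the left
  -- wall, so nothing there can be decorated.
  have hdec : ∀ {a c l}, A a c l → l ≠ 0 → 0 < a → a < 2 * n - 1 → i = 0 := by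
    intro a c l h hl h1 h2
    rcases hwall with h0 | ⟨l', h0⟩
    · exact h0
    · exact absurd ⟨h1, h2⟩ (hA.exposed h0 h hl)
  have hm : m = 0 ∨ i = 0 := by
    by_cases hm : m = 0
    · exact Or.inl hm
    · exact Or.inr (by
        by_contra hi0
        exact hi0 (hdec hc hm (by omega) (by omega)))
  have hxle : x ≤ 2 * n - 1 - i := by
    rcases hxi with h | h
    · have := hdec (hA.symm hx) h (by omega) (by omega)
      omega
    · exact h.le
  have hother : ∀ {a c l}, A a c l → (a ≠ i ∧ a ≠ i + 1 ∧ a ≠ x ∧ a ≠ y) →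
      c ≠ i ∧ c ≠ i + 1 ∧ c ≠ x ∧ c ≠ y := fun h hne =>
    ⟨fun e => hne.2.1 (hA.unique (e ▸ hA.symm h) hc).1,
      fun e => hne.1 (hA.unique (e ▸ hA.symm h) (hA.symm hc)).1,
      fun e => hne.2.2.2 (hA.unique (e ▸ hA.symm h) hx).1,
      fun e => hne.2.2.1 (hA.unique (e ▸ hA.symm h) (hA.symm hx)).1⟩
  have hplanar : ∀ {a c l}, A a c l → (a ≠ i ∧ a ≠ i + 1 ∧ a ≠ x ∧ a ≠ y) →
      (Between i x a → Between i x c) ∧ (Between (i + 1) y a → Between (i + 1) y c) := by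
    intro a c l h hne
    have h1 := hA.planar h (hA.symm hx)
    have h2 := hA.planar (hA.symm hx) h
    have h3 := hA.planar (hA.symm h) (hA.symm hx)
    have h5 := hother h hne
    have h6 : i < a → a < x → i ≤ c ∧ c ≤ 2 * n - 1 - i := fun h7 h8 =>
      hA.inside hv h (by omega) (by omega)
    -- An arc from a position before `y` to one beyond `x` would cover the arc {x, y} if that is
    -- decorated; if `x = 2 * n - 1 - i`, it would leave the region bounded by the vertical arcs.
    have h7 : a < x → x < c → i < a → ¬ a < y := fun h8 h9 h10 h11 => by
      rcases hxi with h12 | h12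
      · exact hA.exposed h hx h12 ⟨h8, h9⟩
      · have := h6 h10 h8
        omega
    unfold Between
    omega
  refine ⟨hc, hx, hi, hm, by omega, by unfold Between; omega, hplanar, ?_, ?_, ?_⟩
  · intro a c l h hl hne
    have h1 := hA.exposed (hA.symm hx) h hl
    have h2 := hplanar h hne
    have h3 := hother h hne
    have h4 : i + 1 < a → a < y → ¬ a < c := fun h5 h6 h7 => hl (hmin a c l h h5 h6 h7)
    have h5 : i + 1 < c → c < y → ¬ c < a := fun h5 h6 h7 => hl (hmin c a l (hA.symm h) h5 h6 h7)
    have h6 := hA.ne h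
    unfold Between at h2 ⊢
    omega
  · intro hmm
    have hi0 : i = 0 := by
      by_cases h : m = 0
      · exact hdec (hA.symm hx) (by omega) (by omega) (by omega)
      · exact hm.resolve_left h
    refine ⟨by unfold Between; omega, fun {a c l} h hne => ?_⟩
    have h1 : m' ≠ 0 → ¬ (a < x ∧ x < c) ∧ ¬ (c < x ∧ x < a) := fun hm' =>
      ⟨hA.exposed h hx hm', hA.exposed (hA.symm h) hx hm'⟩
    have h2 := hA.lt h
    have h3 := hA.lt (hA.symm h)
    unfold Between
    omega
  · have h1 : m = 0 ∨ m = 1 := by have := hA.le_one hc; omega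
    have h2 : m' = 0 ∨ m' = 1 := by have := hA.le_one hx; omega
    have h3 : m' = 1 → i = 0 := fun h => hdec (hA.symm hx) (by omega) (by omega) (by omega)
    rcases h1 with rfl | rfl <;> rcases h2 with rfl | rfl <;> simp only [arcLength, column] <;>
      norm_num <;> omega

/-- The cup found by `exists_cup` either starts at the first non-vertical column, and then the move
uses an arc to its right, or further on, and then the arc opened next to it on the left is used. -/
theorem IsArcSystem.exists_move (hA : IsArcSystem n A)
    (h : ¬ ∀ j < n, ∃ m, A j (2 * n - 1 - j) m) : ∃ i x y m m', IsMove n A i x y m m' := by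
  classical
  obtain ⟨j, hj, hj', hv⟩ := exists_nonvertical h
  obtain ⟨i, m, hji, hi, hc, hopen⟩ := hA.exists_cup hj hj' hv
  rcases hji.eq_or_lt with rfl | hlt
  -- The arc at `2 * n - 1 - j` is a candidate. Choosing the least `y` ensures that no decorated arc
  -- opens between the cup and `y`.
  · have h0 : ∃ y x m', A x y m' ∧ j + 1 < y ∧ y < x ∧ (m' ≠ 0 ∨ x = 2 * n - 1 - j) := by
      obtain ⟨w, l, hw⟩ := hA.total (a := 2 * n - 1 - j) (by omega)
      have h1 := hA.inside hv hw (by omega) le_rfl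
      have h2 := hA.ne hw
      have h3 : w ≠ j := fun e => by
        rw [e] at hw
        exact hj' l (hA.symm hw)
      have h4 : w ≠ j + 1 := fun e => by
        rw [e] at hw
        have := hA.eq_of_arc hw hc
        omega
      exact ⟨w, _, l, hw, by omega, by omega, Or.inr rfl⟩
    obtain ⟨x, m', hx, h1, h2, h3⟩ := Nat.find_spec h0
    refine ⟨j, x, _, m, m', hA.isMove_right hi hv hc hx h1 h2 h3 fun a c l hac h4 h5 h6 => ?_⟩
    by_contra hl
    exact Nat.find_min h0 h5 ⟨c, l, hA.symm hac, h4, h6, Or.inl hl⟩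
  -- The positions from `j` up to the cup are all openings, so their arcs are nested. The outermost
  -- ends before the position below `j`, and each step inwards lowers the bound by at least one.
  · have hnest : ∀ s, j + s < i → ∀ y l, A (j + s) y l → y < 2 * n - 1 - (j + s) := by
      intro s
      induction s with
      | zero =>
        intro _ y l hy
        have h1 := hA.inside hv hy (by omega) (by omega)
        have h2 : y ≠ 2 * n - 1 - j := fun e => hj' l (e ▸ hy)
        simp only [add_zero]
        omega
      | succ s ih =>
        intro hs y l hy
        obtain ⟨z, l', hz⟩ := hA.total (a := j + s) (by omega)
        have h1 := ih (by omega) z l' hz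
        have h2 := hopen (j + s) (by omega) z l' hz
        have h3 : z ≠ j + (s + 1) := fun e => by
          have := hopen (j + (s + 1)) (by omega) _ _ (e ▸ hA.symm hz)
          omega
        have h4 := hA.planar hz hy
        have h5 : y ≠ z := fun e => by
          have := hA.eq_of_arc (e ▸ hy) hz
          omega
        have h6 := hopen _ (by omega) y l hy
        omega
    obtain ⟨i, rfl⟩ : ∃ s, i = s + 1 := ⟨i - 1, by omega⟩
    obtain ⟨y, m', hy⟩ := hA.total (a := i) (by omega)
    have h1 := hnest (i - j) (by omega) y m' (by rwa [Nat.add_sub_cancel' (by omega)])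
    have h2 := hopen i (by omega) y m' hy
    -- Parity excludes `2 * n - 2 - i`, which sharpens the bound on `y` to the one that
    -- `isMove_left` needs.
    have h3 := hA.odd hy
    have h4 : y ≠ i + 1 := fun e => by
      have := (hA.unique (hA.symm (e ▸ hy)) hc).1
      omega
    have h5 : y ≠ i + 1 + 1 := fun e => by
      have := hA.eq_of_arc (e ▸ hy) hc
      omega
    exact ⟨i + 1, i, y, m, m', hA.isMove_left hi hc hy (by omega) (by omega)⟩

end Arcs

/-! ### The arc system of a diagram. -/

section ArcsOfDiagram

variable {k : ℕ}

theorem nodePos_injective : Function.Injective (nodePos : Node k → ℕ) := by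
  rintro (i | i) (j | j) h <;> have hi := i.2 <;> have hj := j.2 <;>
    simp only [nodePos, Sum.elim_inl, Sum.elim_inr] at h
  · exact congrArg _ (Fin.ext h)
  · omega
  · omega
  · exact congrArg _ (Fin.ext (by omega))

theorem nodePos_lt (v : Node k) : nodePos v < 2 * k := by
  rcases v with i | i <;> have hi := i.2 <;> simp only [nodePos, Sum.elim_inl, Sum.elim_inr] <;>
    omega

theorem nodePos_lt_iff (v : Node k) : nodePos v < k ↔ v.isLeft = true := by
  rcases v with i | i <;> have hi := i.2 <;> simp only [nodePos, Sum.elim_inl, Sum.elim_inr]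
  · simp
  · simp only [Sum.isLeft_inr, Bool.false_eq_true, iff_false]
    omega

theorem exists_nodePos_eq {p : ℕ} (hp : p < 2 * k) : ∃ v : Node k, nodePos v = p := by
  by_cases h : p < k
  · exact ⟨Sum.inl ⟨p, h⟩, rfl⟩
  · exact ⟨Sum.inr ⟨2 * k - 1 - p, by omega⟩, by
      simp only [nodePos, Sum.elim_inr]
      omega⟩

theorem below_univ (v : Node k) :
    below nodePos (Finset.univ : Finset (Node k)).val v = nodePos v := by
  have h : (Finset.univ : Finset (Node k)).image nodePos = Finset.range (2 * k) := by
    ext p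
    simp only [Finset.mem_image, Finset.mem_univ, true_and, Finset.mem_range]
    exact ⟨fun ⟨w, hw⟩ => hw ▸ nodePos_lt w, exists_nodePos_eq⟩
  have h2 : below nodePos (Finset.univ : Finset (Node k)).val v =
      (((Finset.univ : Finset (Node k)).image nodePos).filter (· < nodePos v)).card := by
    rw [Finset.filter_image, Finset.card_image_of_injective _ nodePos_injective, below,
      Multiset.countP_eq_card_filter]
    rfl
  rw [h2, h]
  have h3 : (Finset.range (2 * k)).filter (· < nodePos v) = Finset.range (nodePos v) := by
    ext p
    have := nodePos_lt v
    simp only [Finset.mem_filter, Finset.mem_range]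
    omega
  rw [h3, Finset.card_range]

/-- The positions `a` and `c` are joined by an edge with `m` decorations. -/
def Arc (M : Multiset (Strand (Node k))) (a c m : ℕ) : Prop :=
  ∃ v w : Node k, (({v, w} : Multiset (Node k)), m) ∈ M ∧ nodePos v = a ∧ nodePos w = c

theorem IsDiagram.eq_of_mem {M : Multiset (Strand (Node k))} (hM : IsDiagram M)
    {e f : Strand (Node k)} (he : e ∈ M) (hf : f ∈ M) {v : Node k} (hve : v ∈ e.1)
    (hvf : v ∈ f.1) : e = f := by
  obtain ⟨R, rfl⟩ := Multiset.exists_cons_of_mem he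
  rcases Multiset.mem_cons.1 hf with h | h
  · exact h.symm
  · have h1 := hM.2 v
    have h2 := Multiset.one_le_count_iff_mem.2 hve
    have h3 := Multiset.one_le_count_iff_mem.2 (mem_ends.2 ⟨f, h, hvf⟩)
    rw [ends_cons, Multiset.count_add] at h1
    omega

theorem IsDiagram.ne_of_pair_mem {M : Multiset (Strand (Node k))} (hM : IsDiagram M)
    {v w : Node k} {m : ℕ} (h : (({v, w} : Multiset (Node k)), m) ∈ M) : v ≠ w := by
  rintro rfl
  obtain ⟨R, rfl⟩ := Multiset.exists_cons_of_mem h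
  have h1 := hM.2 v
  rw [ends_cons, Multiset.count_add] at h1
  simp at h1
  omega

theorem IsDiagram.exists_pair_of_mem {M : Multiset (Strand (Node k))} (hM : IsDiagram M)
    {e : Strand (Node k)} (he : e ∈ M) {v : Node k} (hv : v ∈ e.1) : ∃ w, e.1 = {v, w} := by
  rcases exists_pair (hM.1 e he) with h | ⟨a, b, h⟩
  · simp [h] at hv
  · rw [h] at hv
    simp only [Multiset.insert_eq_cons, Multiset.mem_cons, Multiset.mem_singleton] at hv
    rcases hv with rfl | rfl
    · exact ⟨b, h⟩
    · exact ⟨a, h.trans (Multiset.pair_comm _ _)⟩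

theorem IsDiagram.exists_mem {M : Multiset (Strand (Node k))} (hM : IsDiagram M) (v : Node k) :
    ∃ e ∈ M, v ∈ e.1 :=
  mem_ends.1 (Multiset.one_le_count_iff_mem.1 (hM.2 v).ge)

/-- A position is the number of nodes before it on the boundary. By planarity the other edges
contribute to these counts equally modulo two at both ends of the edge, and the edge itself
contributes one more at its later end. -/
theorem odd_of_pair_mem {M : Multiset (Strand (Node k))} (hM : IsDiagram M)
    (hP : Planar nodePos M) {v w : Node k} {m : ℕ}
    (h : (({v, w} : Multiset (Node k)), m) ∈ M) : (nodePos v + nodePos w) % 2 = 1 := by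
  have hvw := hM.ne_of_pair_mem h
  obtain ⟨S, hS⟩ := Multiset.exists_cons_of_mem h
  have hend : ends M = {v, w} + ends S := by rw [hS, ends_cons]
  have hv : v ∉ ends S := fun hv => by
    have h1 := hM.2 v
    have h2 := Multiset.one_le_count_iff_mem.2 hv
    rw [hend, Multiset.count_add] at h1
    simp only [Multiset.insert_eq_cons, Multiset.count_cons_self] at h1
    omega
  have hw : w ∉ ends S := fun hw => by
    have h1 := hM.2 w
    have h2 := Multiset.one_le_count_iff_mem.2 hw
    rw [hend, Multiset.count_add, Multiset.pair_comm] at h1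
    simp only [Multiset.insert_eq_cons, Multiset.count_cons_self] at h1
    omega
  have key := below_ends hP h (y := v) (z := w) (S := S) (by simp) (by simp)
    (fun e he => by simp [hS, he]) (fun e he => hM.1 e (by simp [hS, he]))
    (fun x hx => ⟨fun e => hv (nodePos_injective e ▸ hx), fun e => hw (nodePos_injective e ▸ hx)⟩)
  have h1 : ∀ u, nodePos u = below nodePos {v, w} u + below nodePos (ends S) u := fun u => by
    rw [← below_add, ← hend, ends_eq_univ hM, below_univ]
  have hv' := h1 v
  have hw' := h1 w
  have hne : nodePos v ≠ nodePos w := fun e => hvw (nodePos_injective e)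
  have hv2 : below nodePos {v, w} v = if nodePos w < nodePos v then 1 else 0 := by
    simp [below, Multiset.countP_cons, ← Multiset.cons_zero]
  have hw2 : below nodePos {v, w} w = if nodePos v < nodePos w then 1 else 0 := by
    simp [below, Multiset.countP_cons, ← Multiset.cons_zero]
  rw [hv2] at hv'
  rw [hw2] at hw'
  split_ifs at hv' hw' <;> omega

theorem isArcSystem (d : LDiagram k) (hd : ∀ e ∈ d.strands, e.2 < 2) :
    IsArcSystem k (Arc d.strands) where
  symm := by
    rintro _ _ m ⟨v, w, h, rfl, rfl⟩
    exact ⟨w, v, Multiset.pair_comm v w ▸ h, rfl, rfl⟩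
  lt := by
    rintro _ _ m ⟨v, w, h, rfl, rfl⟩
    exact nodePos_lt v
  total := by
    intro a ha
    obtain ⟨v, rfl⟩ := exists_nodePos_eq ha
    obtain ⟨⟨e, m⟩, he, hv⟩ := d.isDiagram.exists_mem v
    obtain ⟨w, rfl : e = _⟩ := d.isDiagram.exists_pair_of_mem he hv
    exact ⟨nodePos w, m, v, w, he, rfl, rfl⟩
  unique := by
    rintro _ _ _ m m' ⟨v, w, h, rfl, rfl⟩ ⟨v', w', h', e, rfl⟩
    obtain rfl := nodePos_injective e
    have h1 := d.isDiagram.eq_of_mem h h' (v := v') (by simp) (by simp)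
    obtain ⟨h2, h3⟩ := Prod.mk.inj h1
    refine ⟨?_, h3⟩
    simp only [Multiset.insert_eq_cons, Multiset.cons_inj_right, Multiset.singleton_inj] at h2
    rw [h2]
  ne := by
    rintro _ _ m ⟨v, w, h, rfl, rfl⟩ e
    exact d.isDiagram.ne_of_pair_mem h (nodePos_injective e)
  planar := by
    rintro _ _ _ _ m m' ⟨v, w, h, rfl, rfl⟩ ⟨v', w', h', rfl, rfl⟩
    exact d.planar _ h _ h' v (by simp) v' (by simp) w (by simp) w' (by simp)
  exposed := by
    rintro _ _ _ _ m m' ⟨v, w, h, rfl, rfl⟩ ⟨v', w', h', rfl, rfl⟩ hm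
    exact d.leftExposed _ h' hm _ h v (by simp) v' (by simp) w (by simp)
  le_one := by
    rintro _ _ m ⟨v, w, h, rfl, rfl⟩
    exact hd _ h
  odd := by
    rintro _ _ m ⟨v, w, h, rfl, rfl⟩
    exact odd_of_pair_mem d.isDiagram d.planar h
  balanced := by
    rintro hb _ _ m ⟨v, w, h, rfl, rfl⟩ hv
    -- The hypothesis says that no edge has both ends in the north face; equality of the numbers of
    -- nodes on the two faces then excludes edges with both ends in the south face.
    have h1 := arcs_symm d.isDiagram true (fun e he he0 => ?_) _ h (by simp)
    · obtain ⟨u, hu, hul⟩ := h1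
      simp only [Multiset.insert_eq_cons, Multiset.mem_cons, Multiset.mem_singleton] at hu
      rcases hu with rfl | rfl
      · have := (nodePos_lt_iff u).2 hul
        omega
      · exact (nodePos_lt_iff u).2 hul
    · rcases exists_pair (d.isDiagram.1 e he) with h' | ⟨a, b, h'⟩
      · exact absurd h' he0
      · have hab : (({a, b} : Multiset (Node k)), e.2) ∈ d.strands := by rwa [← h']
        by_cases ha : nodePos a < k
        · refine ⟨b, by simp [h'], ?_⟩
          have h2 := hb _ _ _ ⟨a, b, hab, rfl, rfl⟩ ha
          have h3 := mt (nodePos_lt_iff b).2 (by omega)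
          simpa using h3
        · refine ⟨a, by simp [h'], ?_⟩
          have h3 := mt (nodePos_lt_iff a).2 ha
          simpa using h3

/-- An exposed diagram with an even number of decorations, all of whose edges propagate, carries no
decorations. -/
theorem bare_of_even {M : Multiset (Strand (Node k))} (hM : IsDiagram M)
    (hE : LeftExposed nodePos M) (hl : ∀ e ∈ M, e.1 ≠ 0 ∧ e.2 < 2) (he : Even M.sum.2)
    (ha : aValue M = 0) : ∀ e ∈ M, e.2 = 0 := by
  have hS := aValue_eq_zero.1 ha
  have hN := arcs_symm hM true hS
  -- The edge at position 0 ends in the south face and so covers every other north node. A decorated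
  -- edge has a north end, which must be exposed, hence lies at position 0. At most one edge is then
  -- decorated, and one decoration would make the total odd.
  have key : ∀ e ∈ M, e.2 ≠ 0 → ∀ v : Node k, nodePos v = 0 → v ∈ e.1 := by
    intro e hem h0 v hv
    obtain ⟨u, hu, hul⟩ := hN e hem (hl e hem).1
    obtain ⟨f, hf, hvf⟩ := hM.exists_mem v
    obtain ⟨b, hb, hbl⟩ := hS f hf (hl f hf).1
    have h1 := hE e hem h0 f hf v hvf u hu b hb
    have h2 := (nodePos_lt_iff u).2 hul
    have h3 : ¬ nodePos b < k := by rw [nodePos_lt_iff, hbl]; simp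
    have h4 : nodePos u = nodePos v := by omega
    rwa [← nodePos_injective h4]
  intro e hem
  by_contra h0
  obtain ⟨u, hu, -⟩ := hN e hem (hl e hem).1
  obtain ⟨v, hv⟩ := exists_nodePos_eq (k := k) (p := 0) (by have := nodePos_lt u; omega)
  have hve := key e hem h0 v hv
  obtain ⟨R, hR⟩ := Multiset.exists_cons_of_mem hem
  have hR0 : R.sum.2 = 0 := by
    rw [sum_snd]
    refine Multiset.sum_eq_zero fun x hx => ?_
    obtain ⟨f, hf, rfl⟩ := Multiset.mem_map.1 hx
    by_contra hf0
    have hvf := key f (by simp [hR, hf]) hf0 v hv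
    have h1 := hM.2 v
    have h2 := Multiset.one_le_count_iff_mem.2 hve
    have h3 := Multiset.one_le_count_iff_mem.2 (mem_ends.2 ⟨f, hf, hvf⟩)
    rw [hR, ends_cons, Multiset.count_add] at h1
    omega
  have h1 := (hl e hem).2
  rw [hR, Multiset.sum_cons, Prod.snd_add, hR0, Nat.even_iff] at he
  omega

/-- The horizontal length of a strand. -/
def strandLength (e : Strand (Node k)) : ℕ :=
  -- Twice the maximum minus the sum is the distance of the two columns, written symmetrically in
  -- the unordered pair of ends.
  if e.2 = 0 then 2 * (e.1.map fun v => column k (nodePos v)).sup -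
    (e.1.map fun v => column k (nodePos v)).sum
  else (e.1.map fun v => column k (nodePos v)).sum + 1

theorem strandLength_pair (v w : Node k) (m : ℕ) :
    strandLength (({v, w} : Multiset (Node k)), m) = arcLength k (nodePos v) (nodePos w) m := by
  simp only [strandLength, arcLength, Multiset.insert_eq_cons, Multiset.map_cons,
    Multiset.map_singleton, Multiset.sup_cons, Multiset.sup_singleton, Multiset.sum_cons,
    Multiset.sum_singleton]
  split_ifs <;> omega

/-- Every edge propagates, so there are no decorations and the identity strands occur among those of
`d`. They use up all nodes, and without loops nothing else remains. -/
theorem eq_one_of_vertical {d : LDiagram k} (hd : ∀ e ∈ d.strands, e.1 ≠ 0)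
    (h : ∀ j < k, ∃ m, Arc d.strands j (2 * k - 1 - j) m) : d = 1 := by
  have hv : ∀ j : Fin k, ∃ m, (({Sum.inl j, Sum.inr j} : Multiset (Node k)), m) ∈ d.strands := by
    intro j
    obtain ⟨m, v, w, hvw, hv, hw⟩ := h j j.2
    obtain rfl : v = Sum.inl j := nodePos_injective hv
    obtain rfl : w = Sum.inr j := nodePos_injective hw
    exact ⟨m, hvw⟩
  have hedge : ∀ e ∈ d.strands, ∃ j : Fin k, e.1 = {Sum.inl j, Sum.inr j} := by
    intro e he
    obtain ⟨v, hve⟩ := Multiset.exists_mem_of_ne_zero (hd e he)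
    rcases v with j | j
    all_goals
      obtain ⟨m, hm⟩ := hv j
      refine ⟨j, ?_⟩
      rw [d.isDiagram.eq_of_mem he hm hve (by simp)]
  have h0 : ∀ e ∈ d.strands, e.2 = 0 := d.bare (aValue_eq_zero.2 fun e he _ => by
    obtain ⟨j, hj⟩ := hedge e he
    exact ⟨Sum.inr j, by simp [hj], rfl⟩)
  have hle : idStrands k ≤ d.strands := by
    rw [Multiset.le_iff_subset]
    · intro e he
      obtain ⟨j, -, rfl⟩ := mem_straight.1 he
      obtain ⟨m, hm⟩ := hv j
      obtain rfl : m = 0 := h0 _ hm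
      exact hm
    · refine Multiset.coe_nodup.2 ((List.nodup_finRange k).map_on fun i _ j _ hij => ?_)
      have h1 : (Sum.inl i : Node k) ∈ ({Sum.inl j, Sum.inr j} : Multiset (Node k)) := by
        rw [← (Prod.mk.inj hij).1]; simp
      simpa using h1
  obtain ⟨N, hN⟩ := Multiset.le_iff_exists_add.1 hle
  have hN0 : N = 0 := by
    refine Multiset.eq_zero_of_forall_notMem fun e he => ?_
    obtain ⟨v, hve⟩ := Multiset.exists_mem_of_ne_zero (hd e (by simp [hN, he]))
    have h1 := d.isDiagram.2 v
    have h2 := (isDiagram_id (k := k)).2 v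
    have h3 := Multiset.one_le_count_iff_mem.2 (mem_ends.2 ⟨e, he, hve⟩)
    rw [hN, ends_add, Multiset.count_add] at h1
    omega
  exact LDiagram.ext (by rw [hN, hN0, add_zero]; rfl)

end ArcsOfDiagram

/-! ### Splitting off a simple diagram, and generation by simple diagrams. -/

section Surgery

variable {k : ℕ}

/-- Two arcs do not cross when both ends of one lie on the same side of the other; this form serves
for either order of the two edges in `Planar`. -/
theorem not_crossing_of_between {p q r s : ℕ} (h : Between p q r ↔ Between p q s) {a b c x : ℕ}
    (ha : a = p ∨ a = q) (hb : b = r ∨ b = s) (hc : c = p ∨ c = q) (hx : x = r ∨ x = s) :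
    ¬ (a < b ∧ b < c ∧ c < x) ∧ ¬ (b < a ∧ a < x ∧ x < c) := by
  unfold Between at h
  omega

theorem not_covered_of_between {p q b : ℕ} (h : ¬ Between p q b) {a c : ℕ}
    (ha : a = p ∨ a = q) (hc : c = p ∨ c = q) : ¬ (a < b ∧ b < c) := by
  unfold Between at h
  omega

/-- The data of a move, in terms of the curves of the diagram `d`. -/
theorem exists_surgery {d : LDiagram k} (hd : IsTypeII d) (h1 : d ≠ 1) :
    ∃ (i : ℕ) (hi : i + 1 < k) (vx vy : Node k) (m m' : ℕ) (R : Multiset (Strand (Node k))),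
      IsMove k (Arc d.strands) i (nodePos vx) (nodePos vy) m m' ∧
      d.strands = (({Sum.inl ⟨i, by omega⟩, Sum.inl ⟨i + 1, hi⟩} : Multiset (Node k)), m) ::ₘ
        ({vx, vy}, m') ::ₘ R := by
  obtain ⟨i, x, y, m, m', hmove⟩ := (isArcSystem d fun e he => (hd.reduced e he).2).exists_move
    fun h => h1 (eq_one_of_vertical hd.loopless h)
  have hi := hmove.top
  obtain ⟨vx, vy, hxy, rfl, rfl⟩ := hmove.arc
  have hik : i < k := by omega
  obtain ⟨vi, vj, hij, hvi, hvj⟩ := hmove.cup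
  have hvi' : vi = Sum.inl ⟨i, hik⟩ := nodePos_injective hvi
  have hvj' : vj = Sum.inl ⟨i + 1, hi⟩ := nodePos_injective hvj
  rw [hvi', hvj'] at hij
  obtain ⟨R, hR⟩ := Multiset.exists_cons_of_mem hij
  have hxy' := hxy
  rw [hR] at hxy'
  rcases Multiset.mem_cons.1 hxy' with h | h
  · exfalso
    have h2 : vx ∈ ({Sum.inl ⟨i, by omega⟩, Sum.inl ⟨i + 1, hi⟩} : Multiset (Node k)) := by
      rw [← (Prod.mk.inj h).1]; simp
    simp only [Multiset.insert_eq_cons, Multiset.mem_cons, Multiset.mem_singleton] at h2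
    rcases h2 with h2 | h2
    · exact hmove.ne.1 (h2 ▸ rfl)
    · exact hmove.ne.2 (h2 ▸ rfl)
  · obtain ⟨R', rfl⟩ := Multiset.exists_cons_of_mem h
    exact ⟨i, hi, vx, vy, m, m', R', hmove, hR⟩

/-- The diagram that remains after removing a simple diagram from the top of `d`. -/
theorem exists_replace {d : LDiagram k} (hd : IsTypeII d) {i : ℕ} {I J vx vy : Node k}
    {m m' : ℕ} {R : Multiset (Strand (Node k))} (hI : nodePos I = i) (hJ : nodePos J = i + 1)
    (hmove : IsMove k (Arc d.strands) i (nodePos vx) (nodePos vy) m m')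
    (hs : d.strands = (({I, J} : Multiset (Node k)), m) ::ₘ ({vx, vy}, m') ::ₘ R) :
    ∃ d' : LDiagram k, IsTypeII d' ∧
      d'.strands = ({I, vx}, (m + m') % 2) ::ₘ ({J, vy}, 0) ::ₘ R := by
  set M := (({I, vx} : Multiset (Node k)), (m + m') % 2) ::ₘ ({J, vy}, 0) ::ₘ R with hM
  have hends : ends M = ends d.strands := by
    rw [hM, hs, ends_cons, ends_cons, ends_cons, ends_cons]
    simp only [Multiset.insert_eq_cons, ← Multiset.singleton_add]
    abel
  have hdiag : IsDiagram M := by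
    refine ⟨fun e he => ?_, fun v => hends ▸ d.isDiagram.2 v⟩
    rcases Multiset.mem_cons.1 he with rfl | he
    · exact Or.inr rfl
    · rcases Multiset.mem_cons.1 he with rfl | he
      · exact Or.inr rfl
      · exact d.isDiagram.1 e (by simp [hs, he])
  have hreduced : ∀ e ∈ M, e.1 ≠ 0 ∧ e.2 < 2 := by
    intro e he
    rcases Multiset.mem_cons.1 he with rfl | he
    · exact ⟨by simp, Nat.mod_lt _ two_pos⟩
    · rcases Multiset.mem_cons.1 he with rfl | he
      · exact ⟨by simp, two_pos⟩
      · exact hd.reduced e (by simp [hs, he])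
  -- The decorations `m + m'` of the two old edges are replaced by `(m + m') % 2`, so the parity of
  -- the total is unchanged.
  have heven : Even M.sum.2 := by
    have h1 := hd.even
    rw [← sum_snd, hs, Nat.even_iff] at h1
    rw [hM, Nat.even_iff]
    simp only [Multiset.sum_cons, Prod.snd_add] at h1 ⊢
    omega
  have hpos : ∀ {v w a : Node k}, a ∈ ({v, w} : Multiset (Node k)) →
      nodePos a = nodePos v ∨ nodePos a = nodePos w := by
    intro v w a ha
    simp only [Multiset.insert_eq_cons, Multiset.mem_cons, Multiset.mem_singleton] at ha
    rcases ha with rfl | rfl <;> simp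
  -- The untouched edges avoid the four nodes of the surgery, since each node is the end of exactly
  -- one edge; the conditions of the move therefore apply to them.
  have hR : ∀ e ∈ R, ∃ v w, e.1 = {v, w} ∧ Arc d.strands (nodePos v) (nodePos w) e.2 ∧
      Arc d.strands (nodePos w) (nodePos v) e.2 ∧
      (nodePos v ≠ i ∧ nodePos v ≠ i + 1 ∧ nodePos v ≠ nodePos vx ∧ nodePos v ≠ nodePos vy) ∧
      (nodePos w ≠ i ∧ nodePos w ≠ i + 1 ∧ nodePos w ≠ nodePos vx ∧ nodePos w ≠ nodePos vy) := by
    intro e he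
    have hed : e ∈ d.strands := by simp [hs, he]
    rcases exists_pair (d.isDiagram.1 e hed) with h | ⟨v, w, h⟩
    · exact absurd h (hd.loopless e hed)
    · have hne : ∀ u ∈ e.1, nodePos u ≠ i ∧ nodePos u ≠ i + 1 ∧ nodePos u ≠ nodePos vx ∧
          nodePos u ≠ nodePos vy := by
        intro u hu
        have h1 := d.isDiagram.2 u
        have h2 := Multiset.one_le_count_iff_mem.2 (mem_ends.2 ⟨e, he, hu⟩)
        rw [hs, ends_cons, ends_cons, Multiset.count_add, Multiset.count_add] at h1
        have h3 : ∀ u' ∈ ({I, J} : Multiset (Node k)), u ≠ u' := by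
          rintro _ h rfl
          have := Multiset.one_le_count_iff_mem.2 h
          simp only [] at h1
          omega
        have h4 : ∀ u' ∈ ({vx, vy} : Multiset (Node k)), u ≠ u' := by
          rintro _ h rfl
          have := Multiset.one_le_count_iff_mem.2 h
          simp only [] at h1
          omega
        rw [← hJ, ← hI]
        exact ⟨fun e => h3 I (by simp) (nodePos_injective e),
          fun e => h3 J (by simp) (nodePos_injective e),
          fun e => h4 vx (by simp) (nodePos_injective e),
          fun e => h4 vy (by simp) (nodePos_injective e)⟩
      have hvw : (({v, w} : Multiset (Node k)), e.2) ∈ d.strands := by rwa [← h]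
      exact ⟨v, w, h, ⟨v, w, hvw, rfl, rfl⟩, ⟨w, v, Multiset.pair_comm v w ▸ hvw, rfl, rfl⟩,
        hne v (by simp [h]), hne w (by simp [h])⟩
  have hplanar : ∀ e ∈ R, ∀ b ∈ e.1, ∀ x ∈ e.1, ∀ u v : Node k,
      ((u = I ∧ v = vx) ∨ (u = J ∧ v = vy)) → ∀ a ∈ ({u, v} : Multiset (Node k)),
        ∀ c ∈ ({u, v} : Multiset (Node k)),
        ¬ (nodePos a < nodePos b ∧ nodePos b < nodePos c ∧ nodePos c < nodePos x) ∧
        ¬ (nodePos b < nodePos a ∧ nodePos a < nodePos x ∧ nodePos x < nodePos c) := by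
    intro e he b hb x hx u v huv a ha c hc
    obtain ⟨s, t, hst, h1, h2, h3, h4⟩ := hR e he
    rw [hst] at hb hx
    refine not_crossing_of_between ?_ (hpos ha) (hpos hb) (hpos hc) (hpos hx)
    rcases huv with ⟨rfl, rfl⟩ | ⟨rfl, rfl⟩
    · rw [hI]
      exact ⟨(hmove.planar h1 h3).1, (hmove.planar h2 h4).1⟩
    · rw [hJ]
      exact ⟨(hmove.planar h1 h3).2, (hmove.planar h2 h4).2⟩
  have hself : ∀ {p q a b c x : ℕ}, (a = p ∨ a = q) → (b = p ∨ b = q) → (c = p ∨ c = q) →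
      (x = p ∨ x = q) → ¬ (a < b ∧ b < c ∧ c < x) := by
    intros
    omega
  have hnew : ∀ a ∈ ({I, vx} : Multiset (Node k)), ∀ b ∈ ({J, vy} : Multiset (Node k)),
      ∀ c ∈ ({I, vx} : Multiset (Node k)), ∀ x ∈ ({J, vy} : Multiset (Node k)),
      ¬ (nodePos a < nodePos b ∧ nodePos b < nodePos c ∧ nodePos c < nodePos x) ∧
      ¬ (nodePos b < nodePos a ∧ nodePos a < nodePos x ∧ nodePos x < nodePos c) := by
    intro a ha b hb c hc x hx
    refine not_crossing_of_between ?_ (hpos ha) (hpos hb) (hpos hc) (hpos hx)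
    rw [hI, hJ]
    exact hmove.planar_self
  have hmem : ∀ e ∈ M, e = ({I, vx}, (m + m') % 2) ∨ e = ({J, vy}, 0) ∨ e ∈ R := by
    intro e he
    simpa [hM] using he
  have hP : Planar nodePos M := by
    intro e he f hf a ha b hb c hc x hx
    rcases hmem e he with rfl | rfl | he' <;> rcases hmem f hf with rfl | rfl | hf'
    · exact hself (hpos ha) (hpos hb) (hpos hc) (hpos hx)
    · exact (hnew a ha b hb c hc x hx).1
    · exact (hplanar f hf' b hb x hx _ _ (Or.inl ⟨rfl, rfl⟩) a ha c hc).1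
    · exact (hnew b hb a ha x hx c hc).2
    · exact hself (hpos ha) (hpos hb) (hpos hc) (hpos hx)
    · exact (hplanar f hf' b hb x hx _ _ (Or.inr ⟨rfl, rfl⟩) a ha c hc).1
    · exact (hplanar e he' a ha c hc _ _ (Or.inl ⟨rfl, rfl⟩) b hb x hx).2
    · exact (hplanar e he' a ha c hc _ _ (Or.inr ⟨rfl, rfl⟩) b hb x hx).2
    · exact d.planar e (by simp [hs, he']) f (by simp [hs, hf']) a ha b hb c hc x hx
  have hE : LeftExposed nodePos M := by
    intro e he he0 f hf a ha b hb c hc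
    rcases hmem e he with rfl | rfl | he'
    · have hexp := hmove.exposed_new he0
      rcases hmem f hf with rfl | rfl | hf'
      · have h1 := hpos ha
        have h2 := hpos hb
        have h3 := hpos hc
        omega
      · refine not_covered_of_between ?_ (hpos ha) (hpos hc)
        rw [hJ]
        rcases hpos hb with h | h <;> rw [h]
        · rw [hI]; exact hexp.1.1
        · exact hexp.1.2
      · obtain ⟨s, t, hst, h1, h2, h3, h4⟩ := hR f hf'
        rw [hst] at ha hc
        refine not_covered_of_between ?_ (hpos ha) (hpos hc)
        rcases hpos hb with h | h <;> rw [h]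
        · rw [hI]; exact (hexp.2 h1 h3).1
        · exact (hexp.2 h1 h3).2
    · exact absurd rfl he0
    · obtain ⟨s, t, hst, h1, h2, h3, h4⟩ := hR e he'
      have hb' := hb
      rw [hst] at hb'
      have hexp : ¬ Between i (nodePos vx) (nodePos b) ∧
          ¬ Between (i + 1) (nodePos vy) (nodePos b) := by
        rcases hpos hb' with h | h <;> rw [h]
        · exact hmove.exposed h1 he0 h3
        · exact hmove.exposed h2 he0 h4
      rcases hmem f hf with rfl | rfl | hf'
      · refine not_covered_of_between ?_ (hpos ha) (hpos hc)
        rw [hI]; exact hexp.1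
      · refine not_covered_of_between ?_ (hpos ha) (hpos hc)
        rw [hJ]; exact hexp.2
      · exact d.leftExposed e (by simp [hs, he']) he0 f (by simp [hs, hf']) a ha b hb c hc
  -- The surgery may remove the last non-propagating edge. Even then no decoration is left, because
  -- the total is even and the decorated edges are exposed.
  exact ⟨⟨M, hdiag, hP, bare_of_even hdiag hE hreduced heven, hE⟩,
    IsTypeII.of_reduced hreduced heven, rfl⟩

theorem simpleDiagram_mem_DTL (i : ℕ) (hi : i + 1 < k) (m : ℕ) (hm : m = 0 ∨ i = 0)
    (hm2 : m < 2) : diagramClass (simpleDiagram i hi m hm) ∈ DTL k := by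
  refine Algebra.subset_adjoin ?_
  obtain rfl | rfl : m = 0 ∨ m = 1 := by omega
  · exact Or.inl ⟨i, hi, rfl⟩
  · obtain rfl : i = 0 := by omega
    exact Or.inr ⟨hi, rfl⟩

/-- Diagrams of type II represent elements of the subalgebra generated by the simple diagrams. -/
theorem diagramClass_mem_DTL (d : LDiagram k) (hd : IsTypeII d) : diagramClass d ∈ DTL k := by
  -- The induction is on the total horizontal length, which each move lowers; it stops at the
  -- identity diagram.
  induction hN : (d.strands.map strandLength).sum using Nat.strong_induction_on generalizing d with
  | h N ih =>
    by_cases h1 : d = 1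
    · rw [h1, diagramClass_one]
      exact (DTL k).one_mem
    obtain ⟨i, hi, vx, vy, m, m', R, hmove, hs⟩ := exists_surgery hd h1
    obtain ⟨d', hd', hs'⟩ := exists_replace hd (i := i) rfl rfl hmove hs
    have hA := isArcSystem d fun e he => (hd.reduced e he).2
    have hm := hA.le_one hmove.cup
    have hm' := hA.le_one hmove.arc
    have hlen := hmove.length
    have hmem' : diagramClass d' ∈ DTL k := by
      refine ih _ ?_ d' hd' rfl
      rw [← hN, hs, hs']
      simp only [Multiset.map_cons, Multiset.sum_cons, strandLength_pair]
      simp only [nodePos, Sum.elim_inl] at hlen ⊢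
      omega
    have hvx : ∀ a (ha : a < k), nodePos vx ≠ a → vx ≠ Sum.inl ⟨a, ha⟩ := fun a ha h e =>
      h (e ▸ rfl)
    have hcard := d'.isDiagram.2
    have hdc := d.isDiagram.2
    rw [hs] at hdc
    have hvy : ∀ u ∈ ({Sum.inl ⟨i, by omega⟩, Sum.inl ⟨i + 1, hi⟩} : Multiset (Node k)),
        vy ≠ u := by
      rintro _ hu rfl
      have h2 := hdc vy
      have h3 := Multiset.one_le_count_iff_mem.2 hu
      have h4 : vy ∈ ({vx, vy} : Multiset (Node k)) := by simp
      have h5 := Multiset.one_le_count_iff_mem.2 h4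
      rw [ends_cons, ends_cons, Multiset.count_add, Multiset.count_add] at h2
      simp only [] at h2
      omega
    rw [hs'] at hcard
    have hprod : (simpleDiagram i hi m hmove.bare * d').strands =
        (({Sum.inl ⟨i, by omega⟩, Sum.inl ⟨i + 1, hi⟩} : Multiset (Node k)), m) ::ₘ
          ({vx, vy}, m + (m + m') % 2 + 0) ::ₘ R := by
      change concat (simpleStrands _ _ _) d'.strands = _
      rw [hs']
      exact concat_simple (by simp) m _ 0 (hvx i _ hmove.ne.1) (hvx (i + 1) _ hmove.ne.2)
        (hvy _ (by simp)) (hvy _ (by simp)) hcard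
    have hclass : diagramClass d = diagramClass (simpleDiagram i hi m hmove.bare * d') := by
      -- The product restores `m'` decorations on {x, y}, except when the cup is decorated and the
      -- edge is not; then it has two, and they cancel.
      obtain h | h : m + (m + m') % 2 + 0 = m' ∨ m + (m + m') % 2 + 0 = m' + 2 := by omega
      · rw [h, ← hs] at hprod
        rw [LDiagram.ext hprod]
      · rw [h, Multiset.cons_swap] at hprod
        rw [Multiset.cons_swap] at hs
        exact (diagramClass_cancel hprod hs).symm
    rw [hclass, diagramClass_mul]
    exact (DTL k).mul_mem (simpleDiagram_mem_DTL i hi m hmove.bare hm) hmem'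

end Surgery

end DecTL

theorem mainTheorem6 (n : ℕ) (hn : 4 ≤ n) :
    ∃ b : Module.Basis {d : DecTL.LDiagram n // DecTL.IsTypeII d} ℤ[X] (DecTL.LFD n),
      ∀ d : {d : DecTL.LDiagram n // DecTL.IsTypeII d},
        ∃ h : DecTL.diagramClass d.1 ∈ DecTL.DTL n,
          b d = RingQuot.mkAlgHom ℤ[X] (DecTL.LoopRel n) ⟨DecTL.diagramClass d.1, h⟩ :=
  DecTL.exists_basis DecTL.diagramClass_mem_DTL
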